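/- Let $\mathbf g_{\mathbf C}$ be a complex Lie algebra with a root space decomposition: a basis $J_a$ consisting of raising generators (positive roots), lowering generators (their negatives) and finitely many commuting Cartan generators $J_h$, $h\in\Theta$, that act diagonally on the root vectors; a grading by the root lattice $\Lambda=\mathbf Z^{\Delta}$ with finitely many simple roots $\Delta$, finite-dimensional root spaces and one-dimensional simple root spaces; and such that the subalgebra of positive (negative) roots is generated by the generators of the simple roots (their negatives), if necessary together with some further "quasi-simple" ones. This includes the complexified Lie algebras of compact simple groups and of centrally extended loop groups, and the Virasoro algebra (quasi-simple generator $L_2$). Write $[J_a,J_b]=\sum_c i f_{ab}{}^c J_c$, and let $R=\mathbf C[\{z_\alpha\}]$ be the polynomial ring with one variable of degree $\alpha$ for every raising generator $J_\alpha$; $R_w$ is its part of degree $w\in\Lambda$. Let $b$ be a linear functional on $\mathbf g_{\mathbf C}$ that vanishes on all raising and lowering generators. Let $$\xi_a=\sum_{k\ge 0}\ \sum_{a_1,\dots,a_k\succ0,\ a+a_1+\cdots+a_k\succ0}\beta_{k,\lambda}\,C_a(a_1,\dots,a_k)\,z_{a_1}\cdots z_{a_k}\,\frac{\partial}{\partial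 z_{a+a_1+\cdots+a_k}},\qquad \beta_{k,\lambda}=(-1)^{k+1}\sum_{l=0}^{k-\lambda}\frac{B_l}{l!\,(k-l)!},$$ where $\lambda$ is the least integer with $a+a_1+\cdots+a_\lambda\succ0$, $C_a(a_1,\dots,a_k)$ is the coefficient of $J_{a+a_1+\cdots+a_k}$ in $[J_{a_k},\dots,[J_{a_1},J_a]\dots]$, and $B_l$ are the Bernoulli numbers ($B_1=-\tfrac12$); when root spaces are not one-dimensional, the sum is over the generators in them. Let $f_a\in R$ be defined by $f_a=0$ for $a\succ0$; $f_h=-i\langle b,J_h\rangle$ for $h\in\Theta$; $f_{-\alpha}=i\langle b,h_\alpha\rangle z_\alpha$ with $h_\alpha=[J_\alpha,J_{-\alpha}]$ for $\alpha$ simple; and $f_{[J_a,J_c]}=\xi_af_c-\xi_cf_a$ for $a,c\prec0$ with $[J_a,J_c]\ne0$, where $u\mapsto f_u$ is the linear extension of $J_a\mapsto f_a$. If $c$ is quasi-simple, $f_{-c}$ is required to be the element of $R_c$ with $\xi_af_{-c}=f_{[J_a,J_{-c}]}$ for all $a\succ0$. Then: 1. There is exactly one such family $f_a$, and the first-order differential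 operators $\hat J_a=\xi_a+f_a$ define a representation of $\mathbf g_{\mathbf C}$ on $R$: $[\hat J_a,\hat J_b]=\sum_c i f_{ab}{}^c\hat J_c$. 2. This is the coadjoint orbit representation in the gauge $f_a\in R_{-a}$. On the orbit let $\tilde u$ be the vector field of the action of $u$, $\omega(\tilde u,\tilde v)=\langle\cdot,[u,v]\rangle$ and $\Phi_u=-\langle\cdot,u\rangle$, and let $z_\alpha$ be the holomorphic coordinates of the coset of $\exp(\sum z_\alpha J_\alpha)$ modulo the group $B^-$ of the Cartan and lowering generators. Then $f_a\in R_{-a}$ for all $a$, and in a local trivialization the line bundle with curvature $i\omega$ has a connection form $A$ of type $(1,0)$ (so that holomorphic sections are represented by holomorphic functions) such that the operators $\hat u=-\tilde u^j(\partial_j+A_j)+i\Phi_u$ act on holomorphic sections as $\xi_u+f_u$. In general this holds on the formal neighbourhood of $b$ in the complexified orbit, i.e. for formal power series in the coordinates of $g=\exp(\sum z_\alpha J_\alpha)\exp(\sum a_\alpha J_{-\alpha})$, $g\mapsto \mathrm{Ad}^*_gb$, and $f$ is the only family with $f_a\in R_{-a}$ for which it holds. If $\mathbf g_{\mathbf C}$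 is finite-dimensional with a compact real form $\mathbf g$ on which $b$ is real, with adjoint group $G$ and maximal torus $T$ whose complexified Lie algebra is spanned by the $J_h$, it also holds, for $u\in\mathbf g$, all holomorphic functions and a smooth form $A$, on every open set of coordinates $z$ of $G/T=G_{\mathbf C}/B^-$ (which is the orbit of $b$ if the stabilizer of $b$ is $T$) over which a smooth section of $G\to G/T$ is given. 3. The raising operators $\hat J_a$, $a\succ0$, do not depend on $b$, hence not on the highest weight. -/

import Mathlib

open scoped ContDiff

noncomputable section

namespace CoadjointOrbit

universe u v w x

/-! ## Lie algebras with a root space decomposition -/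

/-- Labels of the generators `J_a` : raising generators, Cartan generators, lowering generators.
The raising and the lowering generators are both indexed by `I`; root spaces may have
dimension larger than one, so that several elements of `I` may belong to the same root. -/
abbrev Gen (I : Type w) (Θ : Type x) := I ⊕ (Θ ⊕ I)

/-- label of a raising generator (positive root) -/
abbrev Gen.raise {I : Type w} {Θ : Type x} (i : I) : Gen I Θ := Sum.inl i

/-- label of a Cartan generator -/
abbrev Gen.cartan {I : Type w} {Θ : Type x} (h : Θ) : Gen I Θ := Sum.inr (Sum.inl h)

/-- label of a lowering generator (negative root) -/
abbrev Gen.lower {I : Type w} {Θ : Type x} (i : I) : Gen I Θ := Sum.inr (Sum.inr i)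

/-- The degree of a generator in the root lattice `ℤ^Δ`, if `wt i` lists the coefficients of the
`i`-th positive root with respect to the simple roots. -/
def genDegree {Δ : Type v} {I : Type w} {Θ : Type x} (wt : I → Δ → ℕ) : Gen I Θ → Δ → ℤ :=
  Sum.elim (fun i s => (wt i s : ℤ)) (Sum.elim (fun _ => 0) (fun i s => -(wt i s : ℤ)))

/-- A root space decomposition of a complex Lie algebra `L`, with simple roots `Δ`.

This covers the complexified Lie algebras of the compact simple groups and of the centrally
extended loop groups (`quasiSimple = ∅`), and the Virasoro algebra
(`Δ` has one element, `wt L_n = n` for `n > 0`, `Θ = {L_0, C}`, `quasiSimple = {L_2}`). -/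
structure RootDecomposition (L : Type u) [LieRing L] [LieAlgebra ℂ L]
    (Δ : Type v) [DecidableEq Δ] (I : Type w) (Θ : Type x) where
  /-- the basis `J_a` of the complexified algebra -/
  J : Module.Basis (Gen I Θ) ℂ L
  /-- the coefficients of the positive roots in terms of the simple roots -/
  wt : I → Δ → ℕ
  wt_ne_zero : ∀ i, wt i ≠ 0
  /-- root spaces are finite-dimensional -/
  finite_mult : ∀ m : Δ → ℕ, {i | wt i = m}.Finite
  /-- the bracket is compatible with the grading by the root lattice -/
  graded : ∀ a b c, J.repr ⁅J a, J b⁆ c ≠ 0 → genDegree wt c = genDegree wt a + genDegree wt b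
  /-- the Cartan subalgebra is abelian -/
  cartan_comm : ∀ h k : Θ, ⁅J (Gen.cartan h), J (Gen.cartan k)⁆ = 0
  /-- the value of the `i`-th positive root on a Cartan generator -/
  root : I → Θ → ℂ
  cartan_raise : ∀ h i, ⁅J (Gen.cartan h), J (Gen.raise i)⁆ = root i h • J (Gen.raise i)
  cartan_lower : ∀ h i, ⁅J (Gen.cartan h), J (Gen.lower i)⁆ = -(root i h) • J (Gen.lower i)
  /-- the generators that belong to the simple roots; their root spaces are one-dimensional -/
  simple : Δ → I
  wt_simple : ∀ s, wt (simple s) = Pi.single s 1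
  simple_unique : ∀ i s, wt i = Pi.single s 1 → i = simple s
  /-- further generators that are needed, besides the simple ones, to generate all positive roots -/
  quasiSimple : Set I
  /-- the simple and quasi-simple roots generate the subalgebra of positive roots -/
  raise_generate : ∀ i, J (Gen.raise i) ∈
    LieSubalgebra.lieSpan ℂ L
      {y | ∃ j, (j ∈ Set.range simple ∨ j ∈ quasiSimple) ∧ y = J (Gen.raise j)}
  /-- their negatives generate the subalgebra of negative roots -/
  lower_generate : ∀ i, J (Gen.lower i) ∈
    LieSubalgebra.lieSpan ℂ L
      {y | ∃ j, (j ∈ Set.range simple ∨ j ∈ quasiSimple) ∧ y = J (Gen.lower j)}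

namespace RootDecomposition

variable {L : Type u} [LieRing L] [LieAlgebra ℂ L] {Δ : Type v} [DecidableEq Δ]
  {I : Type w} {Θ : Type x} (D : RootDecomposition L Δ I Θ)

/-- degree of the generator `J_a` in the root lattice -/
def deg (a : Gen I Θ) : Δ → ℤ := genDegree D.wt a

/-- degree of the variable `z_i` -/
def varDeg (i : I) : Δ → ℤ := genDegree (Θ := Θ) D.wt (Gen.raise i)

/-- The element `b` of the dual of the algebra lies in the dual of the Cartan subalgebra. -/
def IsCartanFunctional (b : L →ₗ[ℂ] ℂ) : Prop :=
  ∀ i, b (D.J (Gen.raise i)) = 0 ∧ b (D.J (Gen.lower i)) = 0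

/-! ## The vector fields `ξ_a` -/

/-- `β_{k,λ} = (-1)^{k+1} ∑_{l=0}^{k-λ} B_l / (l! (k-l)!)`, with `B_1 = -1/2` -/
def beta (k lam : ℕ) : ℂ :=
  (-1) ^ (k + 1) * ∑ l ∈ (Finset.range (k + 1)).filter (fun l => l + lam ≤ k),
    (bernoulli l : ℂ) / ((Nat.factorial l : ℂ) * (Nat.factorial (k - l) : ℂ))

/-- `[J_{a_k}, … [J_{a_2}, [J_{a_1}, y]] … ]` for the list `a_1, …, a_k` of positive generators -/
def iterAd (l : List I) (y : L) : L := l.foldl (fun y i => ⁅D.J (Gen.raise i), y⁆) y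

/-- `C_a(a_1, …, a_k)`, the contraction of the structure constants
`[J_c, J_d] = ∑ e, (i f_{cd}^e) J_e` along `a_1, …, a_k`, with final index the positive
generator `α`; it vanishes unless `a + a_1 + ⋯ + a_k = α` in the root lattice. -/
def Ccoef (a : Gen I Θ) (l : List I) (α : I) : ℂ :=
  D.J.repr (D.iterAd l (D.J a)) (Gen.raise α)

/-- the least `n` such that `a + a_1 + ⋯ + a_n` is positive -/
def lam (a : Gen I Θ) (l : List I) : ℕ :=
  sInf {n | 0 < D.deg a + ((l.take n).map D.varDeg).sum}

/-- the polynomial coefficient of `∂/∂z_α` in `ξ_a` -/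
def fieldCoef (a : Gen I Θ) (α : I) : MvPolynomial I ℂ :=
  ∑ᶠ l : List I, MvPolynomial.C (beta l.length (D.lam a l) * D.Ccoef a l α) *
    (l.map MvPolynomial.X).prod

/-- `ξ_a = ∑ β_{k,λ} C_a(a_1, …, a_k) z_{a_1} ⋯ z_{a_k} ∂/∂z_{a + a_1 + ⋯ + a_k}`,
acting on polynomials -/
def xi (a : Gen I Θ) : Derivation ℂ (MvPolynomial I ℂ) (MvPolynomial I ℂ) :=
  MvPolynomial.mkDerivation ℂ (D.fieldCoef a)

/-- the linear extension `u ↦ ξ_u` -/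
def xiLin : L →ₗ[ℂ] Derivation ℂ (MvPolynomial I ℂ) (MvPolynomial I ℂ) :=
  D.J.constr ℂ D.xi

/-! ## The functions `f_a` and the operators `Ĵ_a` -/

/-- the linear extension `u ↦ f_u` of a family of polynomials `f_a` -/
def famLin (f : Gen I Θ → MvPolynomial I ℂ) : L →ₗ[ℂ] MvPolynomial I ℂ := D.J.constr ℂ f

/-- `f_a` is homogeneous of degree `-a`, i.e. `f_a ∈ R_{-a}`, for every generator -/
def IsHomogeneousFamily (f : Gen I Θ → MvPolynomial I ℂ) : Prop :=
  ∀ a, MvPolynomial.IsWeightedHomogeneous D.varDeg (f a) (-D.deg a)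

/-- The family `f_a` satisfies the recursive formulae that define it:
`f_a = 0` for `a ≻ 0`, `f_h = -i⟨b,h⟩`, `f_{-α} = i⟨b,h_α⟩ z_α` for simple `α` with
`h_α = [J_α, J_{-α}]`, and `f_{[J_a,J_c]} = ξ_a f_c - ξ_c f_a` for `a, c ≺ 0`.
For a quasi-simple root `c`, `f_{-c}` is the element of `R_c` with
`ξ_a f_{-c} = f_{[J_a,J_{-c}]}` for `a ≻ 0`. -/
structure IsRecursiveFamily (b : L →ₗ[ℂ] ℂ) (f : Gen I Θ → MvPolynomial I ℂ) : Prop where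
  raise : ∀ i, f (Gen.raise i) = 0
  cartan : ∀ h, f (Gen.cartan h) = MvPolynomial.C (-Complex.I * b (D.J (Gen.cartan h)))
  simple : ∀ s, f (Gen.lower (D.simple s)) =
    MvPolynomial.C (Complex.I *
      b ⁅D.J (Gen.raise (D.simple s)), D.J (Gen.lower (D.simple s))⁆) *
      MvPolynomial.X (D.simple s)
  quasi : ∀ c ∈ D.quasiSimple,
    MvPolynomial.IsWeightedHomogeneous D.varDeg (f (Gen.lower c)) (D.varDeg c) ∧
    ∀ i, D.xi (Gen.raise i) (f (Gen.lower c)) =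
      D.famLin f ⁅D.J (Gen.raise i), D.J (Gen.lower c)⁆
  recursive : ∀ i j, ⁅D.J (Gen.lower i), D.J (Gen.lower j)⁆ ≠ 0 →
    D.famLin f ⁅D.J (Gen.lower i), D.J (Gen.lower j)⁆ =
      D.xi (Gen.lower i) (f (Gen.lower j)) - D.xi (Gen.lower j) (f (Gen.lower i))

/-- the first-order differential operator `Ĵ_a = ξ_a + f_a` on the polynomial ring -/
def Jhat (f : Gen I Θ → MvPolynomial I ℂ) (a : Gen I Θ) :
    Module.End ℂ (MvPolynomial I ℂ) :=
  (D.xi a).toLinearMap + LinearMap.mulLeft ℂ (f a)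

/-! ## The formal neighbourhood of the base point of the (complexified) coadjoint orbit

A point of the orbit near `b` is `Ad*_g b` with
`g = exp (∑ z_i J_i) exp (∑ a_i J_{-i})` (a further Cartan factor on the right fixes `b`).
The `z_i` are the holomorphic coordinates, and on the orbit of a real form the `a_i` take over the
role of the antiholomorphic coordinates. Functions are formal power series in the `z_i`, `a_i`. -/

/-- formal functions on the chart; `Sum.inl i` stands for `z_i`, `Sum.inr i` for `a_i` -/
abbrev FormalFun (I : Type w) := MvPowerSeries (I ⊕ I) ℂ

/-- formal functions with values in (a completion of) the Lie algebra,
given by their components with respect to the basis `J` -/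
abbrev FormalAlg (I : Type w) (Θ : Type x) := Gen I Θ → FormalFun I

/-- a polynomial in the `z_i` as a formal function -/
def ofPoly (p : MvPolynomial I ℂ) : FormalFun I :=
  ((MvPolynomial.rename Sum.inl p : MvPolynomial (I ⊕ I) ℂ) : MvPowerSeries (I ⊕ I) ℂ)

/-- `F ↦ [∑ i, x_i J_{e(i)}, F]`, where the `x_i` are coordinates -/
def formalAd (e : I → Gen I Θ) (x : I → I ⊕ I) (F : FormalAlg I Θ) : FormalAlg I Θ :=
  fun c n => ∑ᶠ p : I × Gen I Θ,
    MvPowerSeries.coeff n (MvPowerSeries.X (x p.1) * F p.2) *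
      D.J.repr ⁅D.J (e p.1), D.J p.2⁆ c

/-- `F ↦ [Z, F]` for `Z = ∑ z_i J_i` -/
def adZ : FormalAlg I Θ → FormalAlg I Θ := D.formalAd Gen.raise Sum.inl

/-- `F ↦ [A, F]` for `A = ∑ a_i J_{-i}` -/
def adA : FormalAlg I Θ → FormalAlg I Θ := D.formalAd Gen.lower Sum.inr

/-- `(∑ k, q_k T^k) F` for an operator `T` that raises the order in the coordinates, so that
the terms with `k` above the order of a monomial do not contribute to its coefficient -/
def opSeries (q : ℕ → ℂ) (T : FormalAlg I Θ → FormalAlg I Θ) (F : FormalAlg I Θ) :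
    FormalAlg I Θ :=
  fun c n => ∑ k ∈ Finset.range (n.degree + 1), q k * MvPowerSeries.coeff n (T^[k] F c)

/-- coefficients of `e^{-t}` -/
def expNeg (k : ℕ) : ℂ := (-1) ^ k / (Nat.factorial k : ℂ)

/-- coefficients of `(1 - e^{-t}) / t` -/
def dexpNeg (k : ℕ) : ℂ := (-1) ^ k / (Nat.factorial (k + 1) : ℂ)

/-- `Ad_{g⁻¹} y = e^{-ad A} e^{-ad Z} y` -/
def formalAdInv (y : L) : FormalAlg I Θ :=
  opSeries expNeg D.adA (opSeries expNeg D.adZ (fun c => MvPowerSeries.C (D.J.repr y c)))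

/-- `Φ_y = -⟨Ad*_g b, y⟩ = -⟨b, Ad_{g⁻¹} y⟩`, for `b` in the dual of the Cartan subalgebra -/
def formalPhi (b : L →ₗ[ℂ] ℂ) (y : L) : FormalFun I :=
  -∑ᶠ h : Θ, MvPowerSeries.C (b (D.J (Gen.cartan h))) * D.formalAdInv y (Gen.cartan h)

/-- a vector field on the formal chart: its components along `∂/∂z_i` and `∂/∂a_i` -/
abbrev FormalField (I : Type w) := I ⊕ I → FormalFun I

/-- `g⁻¹ δg` when the coordinates are displaced along `V`:
`e^{-ad A} ((1 - e^{-ad Z}) / ad Z) δZ + ((1 - e^{-ad A}) / ad A) δA` -/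
def formalMaurerCartan (V : FormalField I) : FormalAlg I Θ :=
  opSeries expNeg D.adA
    (opSeries dexpNeg D.adZ (Sum.elim (fun i => V (Sum.inl i)) (fun _ => 0))) +
  opSeries dexpNeg D.adA (Sum.elim (fun _ => 0) (Sum.elim (fun _ => 0) (fun i => V (Sum.inr i))))

/-- `V` is the vector field `ỹ` of the action of `y` on the orbit: `y g = δg` along `V`,
up to right multiplication by the Cartan subgroup, which stabilizes `b`. -/
def IsFormalActionField (y : L) (V : FormalField I) : Prop :=
  ∀ i, D.formalMaurerCartan V (Gen.raise i) = D.formalAdInv y (Gen.raise i) ∧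
    D.formalMaurerCartan V (Gen.lower i) = D.formalAdInv y (Gen.lower i)

/-- the derivative of a function along a vector field -/
def formalDeriv (V : FormalField I) (F : FormalFun I) : FormalFun I :=
  fun n => ∑ᶠ j : I ⊕ I, MvPowerSeries.coeff n (V j * MvPowerSeries.pderiv ℂ j F)

/-- the contraction of the form `∑ i, A_i dz_i` of type `(1,0)` with a vector field -/
def formalContract (A : I → FormalFun I) (V : FormalField I) : FormalFun I :=
  fun n => ∑ᶠ i : I, MvPowerSeries.coeff n (V (Sum.inl i) * A i)

/-- On the formal chart around `b`, the operators `ξ_y + f_y` on holomorphic functions are those of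
the coadjoint orbit representation, `ŷ = -∇_ỹ + i Φ_y = ξ_y - A_y + i Φ_y` with `ξ_y = -ỹ`, for some
connection `A` on the line bundle with curvature `i ω`; `ω(ỹ₁,ỹ₂) = ⟨·,[y₁,y₂]⟩`. The curvature
condition is `ξ_y A_y' - ξ_y' A_y = A_[y,y'] + i Φ_[y,y']`. That `A` has type `(1,0)` means that the
holomorphic sections are the holomorphic functions in this trivialization. -/
def IsFormalOrbitGauge (b : L →ₗ[ℂ] ℂ) (f : Gen I Θ → MvPolynomial I ℂ) : Prop :=
  ∃ V : L → FormalField I, (∀ y, D.IsFormalActionField y (V y)) ∧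
    ∃ A : I → FormalFun I,
      (∀ y y', -formalDeriv (V y) (formalContract A (V y')) +
          formalDeriv (V y') (formalContract A (V y)) =
        formalContract A (V ⁅y, y'⁆) + MvPowerSeries.C Complex.I * D.formalPhi b ⁅y, y'⁆) ∧
      ∀ (y : L) (ψ : MvPolynomial I ℂ),
        ofPoly (D.xiLin y ψ + D.famLin f y * ψ) =
          -formalDeriv (V y) (ofPoly ψ) - formalContract A (V y) * ofPoly ψ +
            MvPowerSeries.C Complex.I * D.formalPhi b y * ofPoly ψ

/-! ## The coadjoint orbit of a compact group -/

section Compact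

variable [Fintype I] [Fintype Θ] [DecidableEq I] [DecidableEq Θ]

/-- The fixed points of the conjugation `σ` form a compact real form of `L`
which contains a real form of the Cartan subalgebra. -/
structure IsCompactRealForm (σ : L →ₛₗ[starRingEnd ℂ] L) : Prop where
  invol : ∀ y, σ (σ y) = y
  lie : ∀ y y', σ ⁅y, y'⁆ = ⁅σ y, σ y'⁆
  cartan : ∀ h, σ (D.J (Gen.cartan h)) ∈
    Submodule.span ℂ (Set.range fun k : Θ => D.J (Gen.cartan k))
  negDef : ∀ y, σ y = y → y ≠ 0 → (killingForm ℂ L y y).re < 0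

/-- the matrix of `ad y` in the basis `J` -/
def adMat (y : L) : Matrix (Gen I Θ) (Gen I Θ) ℂ :=
  LinearMap.toMatrix D.J D.J (LieAlgebra.ad ℂ L y)

/-- the (adjoint) group of the real form: it is generated by the `exp (ad y)`, `y` real -/
def compactGroup (σ : L →ₛₗ[starRingEnd ℂ] L) : Submonoid (Matrix (Gen I Θ) (Gen I Θ) ℂ) :=
  Submonoid.closure {M | ∃ y, σ y = y ∧ M = NormedSpace.exp (D.adMat y)}

/-- the Borel subalgebra spanned by the Cartan and the lowering generators -/
def borel : Submodule ℂ L := Submodule.span ℂ (Set.range fun c : Θ ⊕ I => D.J (Sum.inr c))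

/-- the (adjoint) Borel subgroup `B⁻` -/
def borelGroup : Submonoid (Matrix (Gen I Θ) (Gen I Θ) ℂ) :=
  Submonoid.closure {M | ∃ y ∈ D.borel, M = NormedSpace.exp (D.adMat y)}

/-- `exp (∑ z_i J_i)`, in the adjoint representation -/
def expZ (z : I → ℂ) : Matrix (Gen I Θ) (Gen I Θ) ℂ :=
  NormedSpace.exp (D.adMat (∑ i, z i • D.J (Gen.raise i)))

/-- A holomorphic chart of `G/T = G_ℂ/B⁻` : `s z` is an element of `G` whose coset has the
coordinates `z`, i.e. `s z ∈ exp (∑ z_i J_i) B⁻`, and it depends smoothly on `z`. -/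
structure IsChart (σ : L →ₛₗ[starRingEnd ℂ] L) (O : Set (I → ℂ))
    (s : (I → ℂ) → Matrix (Gen I Θ) (Gen I Θ) ℂ) : Prop where
  isOpen : IsOpen O
  smooth : ∀ c d, ContDiffOn ℝ ∞ (fun z => s z c d) O
  mem_group : ∀ z ∈ O, s z ∈ D.compactGroup σ
  mem_coset : ∀ z ∈ O, ∃ β ∈ D.borelGroup, s z = D.expZ z * β

/-- the point `Ad*_g b` of the coadjoint orbit: `⟨Ad*_g b, y⟩ = ⟨b, Ad_{g⁻¹} y⟩` -/
def coadjoint (b : L →ₗ[ℂ] ℂ) (g : Matrix (Gen I Θ) (Gen I Θ) ℂ) (y : L) : ℂ :=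
  ∑ c, b (D.J c) * (g⁻¹.mulVec (D.J.repr y)) c

/-- `U` is the value at `z` of the vector field `ỹ` of the action of `y` on `G_ℂ/B⁻`:
`e^{ε y} exp (∑ z_i J_i) = exp (∑ (z_i + ε U_i) J_i) e^{ε w} + o(ε)` with `w` in the Borel
subalgebra. -/
def IsActionVector (y : L) (z U : I → ℂ) : Prop :=
  ∃ w ∈ D.borel, HasDerivAt
    (fun ε : ℝ => D.expZ (z + ε • U) * NormedSpace.exp (D.adMat (ε • w)))
    (D.adMat y * D.expZ z) 0

/-- the differential operator `ξ_y + f_y` applied to a holomorphic function -/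
def holOp (f : Gen I Θ → MvPolynomial I ℂ) (y : L) (ψ : (I → ℂ) → ℂ) (z : I → ℂ) : ℂ :=
  fderiv ℂ ψ z (fun i => MvPolynomial.eval z (D.xiLin y (MvPolynomial.X i))) +
    MvPolynomial.eval z (D.famLin f y) * ψ z

/-- In the chart, the line bundle with curvature `i ω`, `ω(ỹ₁,ỹ₂) = ⟨·,[y₁,y₂]⟩`, has a connection
form `A` of type `(1,0)` (the values `A z` are complex linear, so that the holomorphic sections are
the holomorphic functions in this trivialization) for which the operators
`ŷ = -ỹ·(∂ + A) + i Φ_y`, `Φ_y = -⟨·,y⟩`, of the coadjoint orbit representation act on holomorphic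
sections as `ξ_y + f_y`, for all `y` in the real form. -/
def IsOrbitGauge (σ : L →ₛₗ[starRingEnd ℂ] L) (b : L →ₗ[ℂ] ℂ) (O : Set (I → ℂ))
    (s : (I → ℂ) → Matrix (Gen I Θ) (Gen I Θ) ℂ) (f : Gen I Θ → MvPolynomial I ℂ) : Prop :=
  ∃ U : L → (I → ℂ) → (I → ℂ), (∀ y, σ y = y → ∀ z ∈ O, D.IsActionVector y z (U y z)) ∧
    ∃ A : (I → ℂ) → ((I → ℂ) →L[ℂ] ℂ), ContDiffOn ℝ ∞ A O ∧
      (∀ y y', σ y = y → σ y' = y' → ∀ z ∈ O,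
        (fderiv ℝ A z (U y z)) (U y' z) - (fderiv ℝ A z (U y' z)) (U y z) =
          Complex.I * D.coadjoint b (s z) ⁅y, y'⁆) ∧
      ∀ y, σ y = y → ∀ ψ : (I → ℂ) → ℂ, DifferentiableOn ℂ ψ O → ∀ z ∈ O,
        D.holOp f y ψ z =
          -(fderiv ℝ ψ z (U y z) + A z (U y z) * ψ z) +
            Complex.I * (-D.coadjoint b (s z) y) * ψ z

end Compact

end RootDecomposition

end CoadjointOrbit

end

noncomputable section

namespace CoadjointOrbit

set_option linter.unusedSectionVars false

open Finset hiding antidiagonal mem_antidiagonal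

open Finset.HasAntidiagonal

/-! ## Double sums -/

section Sums

variable {M : Type*} [AddCommMonoid M]

/-! Near `b` a point of the orbit is given by `g = e^Z e^A`, with `Z` raising and `A` lowering.
Everything rests on splitting `e^{-ad Z} y = n(y) + w(y)` into its positive part and its part in the
Borel subalgebra of Cartan and lowering generators. The equation `y g = δg`, up to the Cartan
subgroup, says that the logarithmic derivative of `e^Z` is `n(y)`, so `δZ = (ad Z / (1 - e^{-ad Z}))
n(y)`, and that `A` is moved by the negative part of `e^{-ad A} w(y)`. In particular `δZ` depends on
`Z` only. Expanded over words in the raising generators, `δZ` contains Bernoulli numbers times the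
coefficients of `e^{-t}`. The projection between the two series keeps a word exactly if it acts
after at least `λ` letters, and the truncated convolution is `-β_{k,λ}`. Thus `ξ_y` is minus the
vector field of the action (`neg_beta`, `repr_iterAd_projPos`, `ofPoly_fieldCoef`), and the
Maurer–Cartan equation makes `ξ` a homomorphism (`fieldDeriv_vSer`, `xiLin_lie`).

The functions are `f_y = -i⟨b, e^{-ad Z} y⟩` (`orbitFun`). As `b` vanishes on brackets of positive
elements and on brackets of Borel elements, `lie_nSer_add` yields the cocycle identity `f_{[y,y']} =
ξ_y f_{y'} - ξ_{y'} f_y` (`famLin_orbitFun_lie`). It gives the representation property and the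
bracket relations of the recursion. Since `b` sees only degree zero, `f_a ∈ R_{-a}`. The recursion
has one solution by induction on the height: a discrepancy at a quasi-simple root is annihilated by
all raising operators, hence constant, hence zero because of its degree
(`vars_eq_empty_of_xi_raise_eq_zero`, `lower_eq_of_height`).

The connection is `-i⟨b, e^{-ad A} ((1 - e^{-ad Z}) / ad Z) dZ⟩`. On the field of `y` it equals
`-i⟨b, e^{-ad A} n(y)⟩`, whence `f_y = -A_y + iΦ_y`; the curvature follows from the cocycle identity
and the equivariance of the moment map (`fieldDeriv_momentSer`). Conversely, the degree condition
forces `f_a = 0` on raising generators, whose fields begin with `∂/∂z_i`; this fixes the connection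
and then `f` (`eq_orbitFun`).

For a compact group the same algebra applies with `s(z)⁻¹ e^Z ∈ B⁻` in the place of `e^{-A}`, and
all series in `ad Z` are finite. The additional point is that along the action the section `s` moves
by `y` up to a Cartan element (`op_inv_sub_mem_zeroPart`). The error is real and lies in the Borel
subalgebra, and negative definiteness of the Killing form leaves only the Cartan subalgebra for such
elements (`IsCompactRealForm.mem_zeroPart`). -/

lemma sum_range_mul_eq_sum_antidiagonal (K : ℕ) (g : ℕ → ℕ → M)
    (hg : ∀ i j, K ≤ i + j → g i j = 0) :
    ∑ i ∈ range K, ∑ j ∈ range K, g i j =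
      ∑ k ∈ range K, ∑ p ∈ antidiagonal k, g p.1 p.2 := by
  classical
  rw [← Finset.sum_product', Finset.sum_sigma']
  symm
  refine Finset.sum_of_injOn (fun x => x.2) ?_ ?_ ?_ ?_
  · rintro ⟨k, i, j⟩ h ⟨k', i', j'⟩ h' e
    simp only [coe_sigma, Set.mem_sigma_iff, mem_coe, mem_range, mem_antidiagonal] at h h'
    simp only at e
    obtain ⟨rfl, rfl⟩ := Prod.mk.injEq _ _ _ _ ▸ e
    obtain rfl : k = k' := by omega
    rfl
  · rintro ⟨k, i, j⟩ h
    simp only [coe_sigma, Set.mem_sigma_iff, mem_coe, mem_range, mem_antidiagonal] at h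
    simp only [coe_product, Set.mem_prod, mem_coe, mem_range]
    omega
  · rintro ⟨i, j⟩ _ h2
    apply hg
    by_contra h
    apply h2
    refine ⟨⟨i + j, i, j⟩, ?_, rfl⟩
    simpa using h
  · intros; rfl

lemma sum_antidiagonal_assoc {A : Type*} [AddCommMonoid A] [HasAntidiagonal A]
    (n : A) (f : A → A → A → M) :
    ∑ p ∈ antidiagonal n, ∑ q ∈ antidiagonal p.1, f q.1 q.2 p.2 =
      ∑ p ∈ antidiagonal n, ∑ q ∈ antidiagonal p.2, f p.1 q.1 q.2 := by
  classical
  simp only [Finset.sum_sigma']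
  apply Finset.sum_nbij' (fun x => ⟨(x.2.1, x.2.2 + x.1.2), (x.2.2, x.1.2)⟩)
    (fun x => ⟨(x.1.1 + x.2.1, x.2.2), (x.1.1, x.2.1)⟩)
  all_goals
    rintro ⟨⟨a, b⟩, ⟨c, d⟩⟩ h
    simp only [mem_sigma, mem_antidiagonal] at h ⊢
  · obtain ⟨rfl, rfl⟩ := h; simp [add_assoc]
  · obtain ⟨rfl, rfl⟩ := h; simp [add_assoc]
  · obtain ⟨rfl, rfl⟩ := h; simp
  · obtain ⟨rfl, rfl⟩ := h; simp

lemma sum_antidiagonal_left_comm {A : Type*} [AddCommMonoid A] [HasAntidiagonal A]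
    (n : A) (f : A → A → A → M) :
    ∑ p ∈ antidiagonal n, ∑ q ∈ antidiagonal p.2, f p.1 q.1 q.2 =
      ∑ p ∈ antidiagonal n, ∑ q ∈ antidiagonal p.2, f q.1 p.1 q.2 := by
  rw [← sum_antidiagonal_assoc, ← sum_antidiagonal_assoc n (fun a b c => f b a c)]
  refine Finset.sum_congr rfl fun p _ => ?_
  apply Finset.sum_nbij' Prod.swap Prod.swap <;> simp [add_comm]

lemma sum_antidiagonal_add_single {σ : Type*} [DecidableEq σ] (n : σ →₀ ℕ) (j : σ)
    (f : (σ →₀ ℕ) → (σ →₀ ℕ) → M) (hf : ∀ c d, c j = 0 → f c d = 0) :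
    ∑ p ∈ antidiagonal (n + Finsupp.single j 1), f p.1 p.2 =
      ∑ p ∈ antidiagonal n, f (p.1 + Finsupp.single j 1) p.2 := by
  symm
  refine Finset.sum_of_injOn (fun p => (p.1 + Finsupp.single j 1, p.2)) ?_ ?_ ?_ ?_
  · rintro ⟨a, b⟩ _ ⟨a', b'⟩ _ e
    simpa using e
  · rintro ⟨a, b⟩ h
    simp only [mem_coe, mem_antidiagonal] at h ⊢
    rw [← h]; abel
  · rintro ⟨a, b⟩ h h2
    apply hf
    by_contra hne
    replace hne : ¬ a j = 0 := hne
    apply h2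
    simp only [mem_antidiagonal] at h
    have hle : Finsupp.single j 1 ≤ a := by
      rw [Finsupp.single_le_iff]; omega
    refine ⟨(a - Finsupp.single j 1, b), ?_, ?_⟩
    · simp only [mem_coe, mem_antidiagonal]
      have : a - Finsupp.single j 1 + b + Finsupp.single j 1 = n + Finsupp.single j 1 := by
        rw [← h, add_right_comm, tsub_add_cancel_of_le hle]
      exact add_right_cancel this
    · simp [tsub_add_cancel_of_le hle]
  · intros; rfl

/-- The weight `k + 1 = p.1 + p.2` is distributed over the two indices, and in each half the terms
of index zero drop out. This is the Leibniz rule for sequences given by recursions for `(k + 1)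
a_{k+1}`. -/
lemma sum_antidiagonal_succ_smul {N : Type*} [AddCommGroup N] [Module ℂ N] (k : ℕ)
    (g : ℕ → ℕ → N) :
    ∑ p ∈ antidiagonal (k + 1), ((k + 1 : ℕ) : ℂ) • g p.1 p.2 =
      ∑ p ∈ antidiagonal k, ((p.1 + 1 : ℕ) : ℂ) • g (p.1 + 1) p.2 +
      ∑ p ∈ antidiagonal k, ((p.2 + 1 : ℕ) : ℂ) • g p.1 (p.2 + 1) := by
  have h1 : ∑ p ∈ antidiagonal (k + 1), ((p.1 : ℕ) : ℂ) • g p.1 p.2 =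
      ∑ p ∈ antidiagonal k, ((p.1 + 1 : ℕ) : ℂ) • g (p.1 + 1) p.2 := by
    rw [Finset.Nat.sum_antidiagonal_succ]; simp
  have h2 : ∑ p ∈ antidiagonal (k + 1), ((p.2 : ℕ) : ℂ) • g p.1 p.2 =
      ∑ p ∈ antidiagonal k, ((p.2 + 1 : ℕ) : ℂ) • g p.1 (p.2 + 1) := by
    rw [Finset.Nat.sum_antidiagonal_succ']; simp
  rw [← h1, ← h2, ← Finset.sum_add_distrib]
  refine Finset.sum_congr rfl fun p hp => ?_
  rw [← add_smul]
  rw [mem_antidiagonal] at hp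
  rw [← hp]; push_cast; rfl

end Sums

/-! ## The homogeneous parts of the exponential and of its logarithmic derivative -/

section Sequences

variable {A : Type*} [LieRing A] [LieAlgebra ℂ A]

open RootDecomposition (expNeg dexpNeg)

open LieAlgebra (ad)

/-- the term of order `k` of `e^{-ad Z}` -/
def expTerm (Z : A) (k : ℕ) : A →ₗ[ℂ] A := expNeg k • (ad ℂ A Z) ^ k

/-- the term of order `k` of `(1 - e^{-ad Z}) / ad Z` -/
def dexpTerm (Z : A) (k : ℕ) : A →ₗ[ℂ] A := dexpNeg k • (ad ℂ A Z) ^ k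

lemma expNeg_zero : expNeg 0 = 1 := by simp [expNeg]

lemma dexpNeg_zero : dexpNeg 0 = 1 := by simp [dexpNeg]

lemma expNeg_succ (k : ℕ) : ((k + 1 : ℕ) : ℂ) * expNeg (k + 1) = -expNeg k := by
  have h : ((k.factorial : ℕ) : ℂ) ≠ 0 := by exact_mod_cast k.factorial_ne_zero
  have h' : ((k : ℂ) + 1) ≠ 0 := by exact_mod_cast k.succ_ne_zero
  simp only [expNeg, Nat.factorial_succ]
  push_cast
  field_simp
  ring

lemma dexpNeg_succ_mul (k : ℕ) : ((k + 1 : ℕ) : ℂ) * dexpNeg k = expNeg k := by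
  have h : ((k.factorial : ℕ) : ℂ) ≠ 0 := by exact_mod_cast k.factorial_ne_zero
  have h' : ((k : ℂ) + 1) ≠ 0 := by exact_mod_cast k.succ_ne_zero
  simp only [expNeg, dexpNeg, Nat.factorial_succ]
  push_cast
  field_simp

lemma expNeg_succ_eq (k : ℕ) : expNeg (k + 1) = -dexpNeg k := by
  simp only [expNeg, dexpNeg]; ring

@[simp] lemma expTerm_zero (Z F : A) : expTerm Z 0 F = F := by simp [expTerm, expNeg_zero]

@[simp] lemma dexpTerm_zero (Z F : A) : dexpTerm Z 0 F = F := by simp [dexpTerm, dexpNeg_zero]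

lemma expTerm_succ (Z F : A) (k : ℕ) :
    ((k + 1 : ℕ) : ℂ) • expTerm Z (k + 1) F = -⁅Z, expTerm Z k F⁆ := by
  simp only [expTerm, LinearMap.smul_apply, lie_smul, pow_succ', Module.End.mul_apply,
    LieAlgebra.ad_apply, smul_smul, expNeg_succ, neg_smul]

/-- Coefficientwise form of `d/dt (1 - e^{-t}) = e^{-t}`. -/
lemma dexpTerm_smul (Z F : A) (k : ℕ) :
    ((k + 1 : ℕ) : ℂ) • dexpTerm Z k F = expTerm Z k F := by
  simp only [expTerm, dexpTerm, LinearMap.smul_apply, smul_smul, dexpNeg_succ_mul]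

/-- Coefficientwise form of `t · (1 - e^{-t})/t = 1 - e^{-t}`. -/
lemma lie_dexpTerm (Z F : A) (k : ℕ) : ⁅Z, dexpTerm Z k F⁆ = -expTerm Z (k + 1) F := by
  simp only [expTerm, dexpTerm, LinearMap.smul_apply, lie_smul, pow_succ', expNeg_succ_eq,
    neg_smul, neg_neg, LinearMap.neg_apply, Module.End.mul_apply, LieAlgebra.ad_apply]

lemma smul_succ_inj {N : Type*} [AddCommGroup N] [Module ℂ N] (k : ℕ) {x y : N}
    (h : ((k + 1 : ℕ) : ℂ) • x = ((k + 1 : ℕ) : ℂ) • y) : x = y :=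
  smul_right_injective N (r := ((k + 1 : ℕ) : ℂ)) (by exact_mod_cast k.succ_ne_zero) h

/-- That `e^{-ad Z}` is an automorphism, order by order: by the Leibniz rule for `ad Z` both sides
satisfy the recursion `(k + 1) x_{k+1} = -⁅Z, x_k⁆`. No convergence is involved, so the same
identity serves power series and matrix exponentials. -/
lemma expTerm_lie (Z F G : A) (k : ℕ) :
    expTerm Z k ⁅F, G⁆ = ∑ p ∈ antidiagonal k, ⁅expTerm Z p.1 F, expTerm Z p.2 G⁆ := by
  induction k with
  | zero => simp
  | succ k ih =>
    apply smul_succ_inj k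
    rw [expTerm_succ, ih, Finset.smul_sum,
      sum_antidiagonal_succ_smul k (fun i j => ⁅expTerm Z i F, expTerm Z j G⁆)]
    rw [lie_sum, ← Finset.sum_add_distrib, ← Finset.sum_neg_distrib]
    refine Finset.sum_congr rfl fun p _ => ?_
    rw [← smul_lie, ← lie_smul, expTerm_succ, expTerm_succ, leibniz_lie Z]
    simp only [neg_lie, lie_neg]
    abel

/-- The derivative `S` of `k ↦ expTerm Z k F` when `Z` is displaced by `U` and `F` by `S 0`. -/
lemma expTerm_deriv (Z U F : A) (S : ℕ → A)
    (hS : ∀ k, ((k + 1 : ℕ) : ℂ) • S (k + 1) = -⁅U, expTerm Z k F⁆ - ⁅Z, S k⁆) (k : ℕ) :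
    S (k + 1) = expTerm Z (k + 1) (S 0) -
      ∑ p ∈ antidiagonal k, ⁅dexpTerm Z p.1 U, expTerm Z p.2 F⁆ := by
  -- The convolution on the right of the claim obeys the recursion that defines `S`, with the
  -- inhomogeneous term `⁅U, expTerm Z (k + 1) F⁆`.
  have key : ∀ k, ∑ p ∈ antidiagonal (k + 1), ((k + 1 + 1 : ℕ) : ℂ) •
        ⁅dexpTerm Z p.1 U, expTerm Z p.2 F⁆ =
      ⁅U, expTerm Z (k + 1) F⁆ -
        ⁅Z, ∑ p ∈ antidiagonal k, ⁅dexpTerm Z p.1 U, expTerm Z p.2 F⁆⁆ := by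
    intro k
    -- The weight is split as `(p.1 + 1) + p.2`; the first summand turns `dexpTerm` into `expTerm`.
    have e : ∀ p ∈ antidiagonal (k + 1), ((k + 1 + 1 : ℕ) : ℂ) •
        ⁅dexpTerm Z p.1 U, expTerm Z p.2 F⁆ =
        ⁅expTerm Z p.1 U, expTerm Z p.2 F⁆ +
          (p.2 : ℂ) • ⁅dexpTerm Z p.1 U, expTerm Z p.2 F⁆ := by
      intro p hp
      rw [mem_antidiagonal] at hp
      rw [← dexpTerm_smul Z U, smul_lie, ← add_smul, ← hp]
      push_cast
      congr 1
      ring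
    rw [Finset.sum_congr rfl e, Finset.sum_add_distrib, Finset.Nat.sum_antidiagonal_succ,
      Finset.Nat.sum_antidiagonal_succ' (f := fun p => (p.2 : ℂ) •
        ⁅dexpTerm Z p.1 U, expTerm Z p.2 F⁆)]
    simp only [expTerm_zero, Nat.cast_zero, zero_smul, zero_add]
    rw [lie_sum, sub_eq_add_neg, add_assoc, ← Finset.sum_add_distrib, ← Finset.sum_neg_distrib]
    congr 1
    refine Finset.sum_congr rfl fun p _ => ?_
    rw [leibniz_lie Z, lie_dexpTerm, ← lie_smul, expTerm_succ]
    simp only [neg_lie, lie_neg]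
    abel
  induction k with
  | zero =>
    have h := hS 0
    have h1 := expTerm_succ Z (S 0) 0
    simp only [expTerm_zero, zero_add, Nat.cast_one, one_smul] at h h1
    simp only [zero_add, h, h1, antidiagonal_zero, Finset.sum_singleton, dexpTerm_zero,
      expTerm_zero]
    abel
  | succ k ih =>
    apply smul_succ_inj (k + 1)
    rw [hS, smul_sub, expTerm_succ, Finset.smul_sum, key, ih, lie_sub]
    abel

/-- The Maurer–Cartan equation for the logarithmic derivative. -/
lemma dexpTerm_maurerCartan (Z U V UV VU : A) (S T : ℕ → A)
    (hS : ∀ k, ((k + 1 + 1 : ℕ) : ℂ) • S (k + 1) = expTerm Z (k + 1) UV -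
      ∑ p ∈ antidiagonal k, ⁅dexpTerm Z p.1 U, expTerm Z p.2 V⁆)
    (hT : ∀ k, ((k + 1 + 1 : ℕ) : ℂ) • T (k + 1) = expTerm Z (k + 1) VU -
      ∑ p ∈ antidiagonal k, ⁅dexpTerm Z p.1 V, expTerm Z p.2 U⁆) (k : ℕ) :
    S (k + 1) - T (k + 1) = dexpTerm Z (k + 1) (UV - VU) -
      ∑ p ∈ antidiagonal k, ⁅dexpTerm Z p.1 U, dexpTerm Z p.2 V⁆ := by
  apply smul_succ_inj (k + 1)
  rw [smul_sub, smul_sub, hS, hT, dexpTerm_smul, map_sub, Finset.smul_sum,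
    ← Finset.Nat.sum_antidiagonal_swap (f := fun p => ⁅dexpTerm Z p.1 V, expTerm Z p.2 U⁆)]
  -- Here the weight is `(p.1 + 1) + (p.2 + 1)`; each summand turns one of the two `dexpTerm`s into
  -- an `expTerm`, and antisymmetry of the bracket accounts for the swap.
  have e : ∑ p ∈ antidiagonal k, ((k + 1 + 1 : ℕ) : ℂ) •
      ⁅dexpTerm Z p.1 U, dexpTerm Z p.2 V⁆ =
      ∑ p ∈ antidiagonal k, ⁅dexpTerm Z p.1 U, expTerm Z p.2 V⁆ -
      ∑ p ∈ antidiagonal k, ⁅dexpTerm Z p.swap.1 V, expTerm Z p.swap.2 U⁆ := by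
    rw [← Finset.sum_sub_distrib]
    refine Finset.sum_congr rfl fun p hp => ?_
    rw [mem_antidiagonal] at hp
    rw [← dexpTerm_smul, ← dexpTerm_smul Z U]
    simp only [Prod.fst_swap, Prod.snd_swap, lie_smul]
    rw [← lie_skew (dexpTerm Z p.2 V) (dexpTerm Z p.1 U), smul_neg, sub_neg_eq_add,
      ← add_smul, ← hp]
    push_cast
    congr 1
    ring
  rw [e]
  abel

end Sequences

end CoadjointOrbit

end



noncomputable section

namespace CoadjointOrbit

set_option linter.unusedSectionVars false

open Finset hiding antidiagonal mem_antidiagonal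

open Finset.HasAntidiagonal

open LieAlgebra (ad)

/-! ## Formal power series with coefficients in a vector space or a Lie algebra -/

/-- formal power series in the variables `σ` with coefficients in `M` -/
def VecPS (σ M : Type*) := (σ →₀ ℕ) → M

namespace VecPS

variable {σ M M' L : Type*}

instance [AddCommGroup M] : AddCommGroup (VecPS σ M) :=
  inferInstanceAs (AddCommGroup ((σ →₀ ℕ) → M))

instance [AddCommGroup M] [Module ℂ M] : Module ℂ (VecPS σ M) :=
  inferInstanceAs (Module ℂ ((σ →₀ ℕ) → M))

@[ext] lemma ext {F G : VecPS σ M} (h : ∀ m, F m = G m) : F = G := funext h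

section Module

variable [AddCommGroup M] [AddCommGroup M']

@[simp] lemma add_apply (F G : VecPS σ M) (m : σ →₀ ℕ) : (F + G) m = F m + G m := rfl
@[simp] lemma sub_apply (F G : VecPS σ M) (m : σ →₀ ℕ) : (F - G) m = F m - G m := rfl
@[simp] lemma neg_apply (F : VecPS σ M) (m : σ →₀ ℕ) : (-F) m = -F m := rfl
@[simp] lemma zero_apply (m : σ →₀ ℕ) : (0 : VecPS σ M) m = 0 := rfl

variable [Module ℂ M] [Module ℂ M']

@[simp] lemma smul_apply (r : ℂ) (F : VecPS σ M) (m : σ →₀ ℕ) : (r • F) m = r • F m := rfl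

/-- the coefficient of a monomial -/
def coeff (m : σ →₀ ℕ) : VecPS σ M →ₗ[ℂ] M := LinearMap.proj m

lemma coeff_apply (m : σ →₀ ℕ) (F : VecPS σ M) : coeff m F = F m := rfl

@[simp] lemma sum_apply {ι : Type*} (s : Finset ι) (F : ι → VecPS σ M) (m : σ →₀ ℕ) :
    (∑ i ∈ s, F i) m = ∑ i ∈ s, F i m := map_sum (coeff m) F s

/-- apply a linear map to all coefficients -/
def mapCoeff (φ : M →ₗ[ℂ] M') : VecPS σ M →ₗ[ℂ] VecPS σ M' :=
  LinearMap.pi fun m => φ ∘ₗ coeff m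

@[simp] lemma mapCoeff_apply (φ : M →ₗ[ℂ] M') (F : VecPS σ M) (m : σ →₀ ℕ) :
    mapCoeff φ F m = φ (F m) := rfl

open scoped Classical in
/-- constant power series -/
def const : M →ₗ[ℂ] VecPS σ M :=
  LinearMap.pi fun m => if m = 0 then LinearMap.id else 0

@[simp] lemma const_zero_apply (y : M) : (const y : VecPS σ M) 0 = y := by
  classical
  change (if (0 : σ →₀ ℕ) = 0 then (LinearMap.id : M →ₗ[ℂ] M) else 0) y = y
  simp

lemma const_apply_of_ne (y : M) {m : σ →₀ ℕ} (h : m ≠ 0) : (const y : VecPS σ M) m = 0 := by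
  classical
  change (if m = 0 then (LinearMap.id : M →ₗ[ℂ] M) else 0) y = 0
  simp [h]

variable (σ M) in
/-- power series of order at least `K` -/
def orderGE (K : ℕ) : Submodule ℂ (VecPS σ M) where
  carrier := {F | ∀ m, m.degree < K → F m = 0}
  add_mem' h h' m hm := by simp [h m hm, h' m hm]
  zero_mem' m _ := rfl
  smul_mem' r F h m hm := by simp [h m hm]

lemma mem_orderGE_zero (F : VecPS σ M) : F ∈ orderGE σ M 0 := fun _ h => absurd h (by simp)

lemma apply_eq_of_sub_mem {K : ℕ} {F G : VecPS σ M} (h : F - G ∈ orderGE σ M K) {m : σ →₀ ℕ}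
    (hm : m.degree < K) : F m = G m := sub_eq_zero.1 (h m hm)

lemma mapCoeff_mem_orderGE (φ : M →ₗ[ℂ] M') {K : ℕ} {F : VecPS σ M} (h : F ∈ orderGE σ M K) :
    mapCoeff φ F ∈ orderGE σ M' K := fun m hm => by simp [h m hm]

end Module

section Lie

variable [DecidableEq σ] [LieRing L]

instance : Bracket (VecPS σ L) (VecPS σ L) :=
  ⟨fun F G m => ∑ p ∈ antidiagonal m, ⁅F p.1, G p.2⁆⟩

lemma lie_apply (F G : VecPS σ L) (m : σ →₀ ℕ) :
    ⁅F, G⁆ m = ∑ p ∈ antidiagonal m, ⁅F p.1, G p.2⁆ := rfl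

instance : LieRing (VecPS σ L) where
  add_lie F G H := by
    ext m
    change ∑ p ∈ antidiagonal m, ⁅F p.1 + G p.1, H p.2⁆ = (∑ p ∈ antidiagonal m, ⁅F p.1, H p.2⁆)
      + ∑ p ∈ antidiagonal m, ⁅G p.1, H p.2⁆
    simp only [add_lie, Finset.sum_add_distrib]
  lie_add F G H := by
    ext m
    change ∑ p ∈ antidiagonal m, ⁅F p.1, G p.2 + H p.2⁆ = (∑ p ∈ antidiagonal m, ⁅F p.1, G p.2⁆)
      + ∑ p ∈ antidiagonal m, ⁅F p.1, H p.2⁆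
    simp only [lie_add, Finset.sum_add_distrib]
  lie_self F := by
    ext m
    change ∑ p ∈ antidiagonal m, ⁅F p.1, F p.2⁆ = 0
    -- Exchanging the factors pairs off terms of opposite sign; at a fixed point the bracket is that
    -- of an element with itself.
    refine Finset.sum_involution (fun p _ => p.swap) ?_ ?_ ?_ ?_
    · rintro ⟨a, b⟩ _
      simp only [Prod.swap_prod_mk]
      rw [← lie_skew, neg_add_cancel]
    · rintro ⟨a, b⟩ _ h e
      simp only [Prod.swap_prod_mk, Prod.mk.injEq] at e
      rw [e.1] at h
      simp at h
    · rintro ⟨a, b⟩ h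
      simpa [mem_antidiagonal, add_comm] using h
    · rintro ⟨a, b⟩ _; rfl
  leibniz_lie F G H := by
    ext m
    change ∑ p ∈ antidiagonal m, ⁅F p.1, ∑ q ∈ antidiagonal p.2, ⁅G q.1, H q.2⁆⁆ =
      (∑ p ∈ antidiagonal m, ⁅∑ q ∈ antidiagonal p.1, ⁅F q.1, G q.2⁆, H p.2⁆)
      + ∑ p ∈ antidiagonal m, ⁅G p.1, ∑ q ∈ antidiagonal p.2, ⁅F q.1, H q.2⁆⁆
    simp only [lie_sum, sum_lie]
    rw [sum_antidiagonal_assoc m (fun a b c => ⁅⁅F a, G b⁆, H c⁆),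
      sum_antidiagonal_left_comm m (fun a b c => ⁅G a, ⁅F b, H c⁆⁆)]
    simp only [← Finset.sum_add_distrib, ← leibniz_lie]

variable [LieAlgebra ℂ L]

instance : LieAlgebra ℂ (VecPS σ L) where
  lie_smul r F G := by
    ext m
    rw [lie_apply]
    simp only [smul_apply, lie_smul, lie_apply, Finset.smul_sum]

lemma const_lie_apply (y : L) (F : VecPS σ L) (m : σ →₀ ℕ) : ⁅(const y : VecPS σ L), F⁆ m = ⁅y, F m⁆ := by
  rw [lie_apply, Finset.sum_eq_single (0, m)]
  · simp
  · rintro ⟨a, b⟩ h hne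
    rw [const_apply_of_ne, zero_lie]
    rintro rfl
    rw [mem_antidiagonal, zero_add] at h
    exact hne (by rw [← h])
  · intro h; simp [mem_antidiagonal] at h

lemma lie_const_apply (y : L) (F : VecPS σ L) (m : σ →₀ ℕ) : ⁅F, (const y : VecPS σ L)⁆ m = ⁅F m, y⁆ := by
  rw [← lie_skew, neg_apply, const_lie_apply, lie_skew]

lemma const_lie_const (y y' : L) : ⁅(const y : VecPS σ L), (const y' : VecPS σ L)⁆ = const ⁅y, y'⁆ := by
  ext m
  rw [const_lie_apply]
  by_cases h : m = 0
  · subst h; simp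
  · rw [const_apply_of_ne _ h, const_apply_of_ne _ h, lie_zero]

lemma lie_mem_orderGE {K K' : ℕ} {F G : VecPS σ L} (hF : F ∈ orderGE σ L K)
    (hG : G ∈ orderGE σ L K') : ⁅F, G⁆ ∈ orderGE σ L (K + K') := by
  intro m hm
  rw [lie_apply]
  refine Finset.sum_eq_zero fun p hp => ?_
  rw [mem_antidiagonal] at hp
  have hd : p.1.degree + p.2.degree = m.degree := by rw [← hp, map_add]
  by_cases h : p.1.degree < K
  · rw [hF _ h, zero_lie]
  · rw [hG _ (by omega), lie_zero]

lemma ad_pow_mem_orderGE {Z : VecPS σ L} (hZ : Z ∈ orderGE σ L 1) {K : ℕ} {F : VecPS σ L}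
    (hF : F ∈ orderGE σ L K) (k : ℕ) : ((ad ℂ _ Z) ^ k) F ∈ orderGE σ L (K + k) := by
  induction k with
  | zero => simpa using hF
  | succ k ih =>
    rw [pow_succ', Module.End.mul_apply, LieAlgebra.ad_apply]
    have := lie_mem_orderGE hZ ih
    rwa [show K + (k + 1) = 1 + (K + k) by omega]

/-! ### Power series in `ad Z` -/

/-- `(∑ k, q_k (ad Z)^k) F` for a series `Z` without constant term -/
def adSeries (q : ℕ → ℂ) (Z : VecPS σ L) : VecPS σ L →ₗ[ℂ] VecPS σ L :=
  LinearMap.pi fun m => ∑ k ∈ range (m.degree + 1), q k • (coeff m ∘ₗ ((ad ℂ _ Z) ^ k))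

lemma adSeries_apply (q : ℕ → ℂ) (Z F : VecPS σ L) (m : σ →₀ ℕ) :
    adSeries q Z F m = ∑ k ∈ range (m.degree + 1), q k • ((ad ℂ _ Z) ^ k) F m := by
  change (∑ k ∈ range (m.degree + 1), q k • (coeff m ∘ₗ ((ad ℂ _ Z) ^ k))) F = _
  simp [coeff_apply]

/-- Every `ad Z` raises the order, so the additional terms vanish at `m`. One cut-off can therefore
be used for several monomials at once. -/
lemma adSeries_apply_eq (q : ℕ → ℂ) {Z : VecPS σ L} (hZ : Z ∈ orderGE σ L 1) (F : VecPS σ L)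
    {m : σ →₀ ℕ} {K : ℕ} (hK : m.degree < K) :
    adSeries q Z F m = ∑ k ∈ range K, q k • ((ad ℂ _ Z) ^ k) F m := by
  rw [adSeries_apply]
  refine Finset.sum_subset (range_mono hK) fun k _ hk => ?_
  rw [mem_range, not_lt] at hk
  have := ad_pow_mem_orderGE hZ (mem_orderGE_zero F) k m (by omega)
  rw [this, smul_zero]

lemma adSeries_sub_mem (q : ℕ → ℂ) {Z : VecPS σ L} (hZ : Z ∈ orderGE σ L 1) (F : VecPS σ L)
    (K : ℕ) : adSeries q Z F - ∑ k ∈ range K, q k • ((ad ℂ _ Z) ^ k) F ∈ orderGE σ L K := by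
  intro m hm
  simp [adSeries_apply_eq q hZ F hm]

/-- Composition is multiplication of the scalar series: up to order `K` the inner series may be
replaced by a finite sum, and the products with `i + j ≥ K` do not reach the monomial `m`. -/
lemma adSeries_comp (q q' : ℕ → ℂ) {Z : VecPS σ L} (hZ : Z ∈ orderGE σ L 1) (F : VecPS σ L) :
    adSeries q Z (adSeries q' Z F) =
      adSeries (fun k => ∑ p ∈ antidiagonal k, q p.1 * q' p.2) Z F := by
  ext m
  set K := m.degree + 1
  rw [adSeries_apply, adSeries_apply]
  have h1 : ∀ i, ((ad ℂ _ Z) ^ i) (adSeries q' Z F) m =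
      ∑ j ∈ range K, q' j • ((ad ℂ _ Z) ^ (i + j)) F m := by
    intro i
    have h := ad_pow_mem_orderGE hZ (adSeries_sub_mem q' hZ F K) i
    rw [map_sub, map_sum] at h
    rw [apply_eq_of_sub_mem h (m := m) (by omega), sum_apply]
    simp [pow_add]
  simp only [h1, Finset.smul_sum, smul_smul]
  rw [sum_range_mul_eq_sum_antidiagonal K
    (fun i j => (q i * q' j) • ((ad ℂ _ Z) ^ (i + j)) F m)]
  · refine Finset.sum_congr rfl fun k _ => ?_
    rw [Finset.sum_smul]
    refine Finset.sum_congr rfl fun p hp => ?_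
    rw [mem_antidiagonal] at hp
    rw [hp]
  · intro i j hij
    rw [ad_pow_mem_orderGE hZ (mem_orderGE_zero F) (i + j) m (by omega), smul_zero]

lemma adSeries_one (Z F : VecPS σ L) : adSeries (fun k => if k = 0 then 1 else 0) Z F = F := by
  ext m
  rw [adSeries_apply, Finset.sum_eq_single 0]
  · simp
  · intro k _ hk; simp [hk]
  · simp

open RootDecomposition (expNeg dexpNeg)

/-- `e^{-ad Z}` -/
abbrev expAd (Z : VecPS σ L) : VecPS σ L →ₗ[ℂ] VecPS σ L := adSeries expNeg Z

/-- `(1 - e^{-ad Z}) / ad Z` -/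
abbrev dexpAd (Z : VecPS σ L) : VecPS σ L →ₗ[ℂ] VecPS σ L := adSeries dexpNeg Z

/-- the Taylor coefficients of `t / (1 - e^{-t})` -/
def bernoulliNeg (k : ℕ) : ℂ := (-1) ^ k * (bernoulli k : ℂ) / (k.factorial : ℂ)

/-- `ad Z / (1 - e^{-ad Z})` -/
abbrev berAd (Z : VecPS σ L) : VecPS σ L →ₗ[ℂ] VecPS σ L := adSeries bernoulliNeg Z

/-- This is `t/(1 - e^{-t}) · (1 - e^{-t})/t = 1`. With the convention `B_1 = -1/2`, the signs
`(-1)^k` pass from `t/(e^t - 1)` to `t/(1 - e^{-t})`; once `(-1)^n / n!` is taken out, the standard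
recursion of the Bernoulli numbers remains. -/
lemma sum_bernoulliNeg_mul_dexpNeg (n : ℕ) :
    ∑ p ∈ antidiagonal n, bernoulliNeg p.1 * dexpNeg p.2 = if n = 0 then 1 else 0 := by
  have h := bernoulli_spec' n
  have h' : (∑ p ∈ antidiagonal n, (((p.1 + p.2).choose p.2 : ℚ) / (p.2 + 1) *
      bernoulli p.1 : ℚ) : ℂ) = if n = 0 then 1 else 0 := by
    rw [← Rat.cast_sum]
    have : (∑ p ∈ antidiagonal n, (((p.1 + p.2).choose p.2 : ℚ) / (p.2 + 1) *
      bernoulli p.1 : ℚ)) = if n = 0 then 1 else 0 := by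
      rw [← h]
    rw [this]
    split_ifs <;> simp
  have e : ∀ p ∈ antidiagonal n, bernoulliNeg p.1 * dexpNeg p.2 =
      (-1) ^ n / (n.factorial : ℂ) * ((((p.1 + p.2).choose p.2 : ℚ) / (p.2 + 1) *
      bernoulli p.1 : ℚ) : ℂ) := by
    rintro ⟨i, j⟩ hp
    rw [mem_antidiagonal] at hp
    subst hp
    simp only [bernoulliNeg, dexpNeg]
    have hc : (((i + j).choose j : ℕ) : ℂ) * (i.factorial * j.factorial) = (i + j).factorial := by
      have := Nat.add_choose_mul_factorial_mul_factorial i j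
      rw [← this]; push_cast; ring
    have hi : ((i.factorial : ℕ) : ℂ) ≠ 0 := by exact_mod_cast i.factorial_ne_zero
    have hj : ((j.factorial : ℕ) : ℂ) ≠ 0 := by exact_mod_cast j.factorial_ne_zero
    have hij : (((i + j).factorial : ℕ) : ℂ) ≠ 0 := by exact_mod_cast (i + j).factorial_ne_zero
    have hj1 : ((j : ℂ) + 1) ≠ 0 := by exact_mod_cast j.succ_ne_zero
    push_cast [Nat.factorial_succ]
    rw [← hc] at hij ⊢
    have hch := left_ne_zero_of_mul hij
    field_simp
    ring
  rw [Finset.sum_congr rfl e, ← Finset.mul_sum, h']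
  split_ifs with h0
  · subst h0; simp
  · simp

lemma berAd_dexpAd {Z : VecPS σ L} (hZ : Z ∈ orderGE σ L 1) (F : VecPS σ L) :
    berAd Z (dexpAd Z F) = F := by
  rw [adSeries_comp _ _ hZ]
  simp only [sum_bernoulliNeg_mul_dexpNeg, adSeries_one]

lemma dexpAd_berAd {Z : VecPS σ L} (hZ : Z ∈ orderGE σ L 1) (F : VecPS σ L) :
    dexpAd Z (berAd Z F) = F := by
  rw [adSeries_comp _ _ hZ]
  have : ∀ n, ∑ p ∈ antidiagonal n, dexpNeg p.1 * bernoulliNeg p.2 = if n = 0 then 1 else 0 := by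
    intro n
    rw [← sum_bernoulliNeg_mul_dexpNeg, ← Finset.Nat.sum_antidiagonal_swap]
    simp only [Prod.fst_swap, Prod.snd_swap, mul_comm]
  simp only [this, adSeries_one]

lemma dexpAd_injective {Z : VecPS σ L} (hZ : Z ∈ orderGE σ L 1) :
    Function.Injective (dexpAd Z : VecPS σ L → VecPS σ L) :=
  Function.LeftInverse.injective (berAd_dexpAd hZ)

lemma expTerm_mem_orderGE {Z : VecPS σ L} (hZ : Z ∈ orderGE σ L 1) (F : VecPS σ L) (k : ℕ) :
    expTerm Z k F ∈ orderGE σ L k := by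
  have := Submodule.smul_mem _ (expNeg k) (ad_pow_mem_orderGE hZ (mem_orderGE_zero F) k)
  rwa [zero_add] at this

lemma dexpTerm_mem_orderGE {Z : VecPS σ L} (hZ : Z ∈ orderGE σ L 1) (F : VecPS σ L) (k : ℕ) :
    dexpTerm Z k F ∈ orderGE σ L k := by
  have := Submodule.smul_mem _ (dexpNeg k) (ad_pow_mem_orderGE hZ (mem_orderGE_zero F) k)
  rwa [zero_add] at this

lemma expAd_apply_eq {Z : VecPS σ L} (hZ : Z ∈ orderGE σ L 1) (F : VecPS σ L)
    {m : σ →₀ ℕ} {K : ℕ} (hK : m.degree < K) :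
    expAd Z F m = ∑ k ∈ range K, expTerm Z k F m := adSeries_apply_eq _ hZ F hK

lemma dexpAd_apply_eq {Z : VecPS σ L} (hZ : Z ∈ orderGE σ L 1) (F : VecPS σ L)
    {m : σ →₀ ℕ} {K : ℕ} (hK : m.degree < K) :
    dexpAd Z F m = ∑ k ∈ range K, dexpTerm Z k F m := adSeries_apply_eq _ hZ F hK

/-- The bracket of two sums of homogeneous terms. -/
lemma lie_apply_eq_sum {X Y : VecPS σ L} {S T : ℕ → VecPS σ L} {K : ℕ}
    (hX : X - ∑ k ∈ range K, S k ∈ orderGE σ L K) (hY : Y - ∑ k ∈ range K, T k ∈ orderGE σ L K)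
    (hS : ∀ k, S k ∈ orderGE σ L k) (hT : ∀ k, T k ∈ orderGE σ L k) {m : σ →₀ ℕ}
    (hm : m.degree < K) :
    ⁅X, Y⁆ m = ∑ k ∈ range K, ∑ p ∈ antidiagonal k, ⁅S p.1, T p.2⁆ m := by
  have h1 : ⁅X, Y⁆ m = ⁅∑ k ∈ range K, S k, ∑ k ∈ range K, T k⁆ m := by
    have a := lie_mem_orderGE hX (mem_orderGE_zero Y) m (by omega)
    have b := lie_mem_orderGE (mem_orderGE_zero (∑ k ∈ range K, S k)) hY m (by omega)
    rw [sub_lie, sub_apply, sub_eq_zero] at a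
    rw [lie_sub, sub_apply, sub_eq_zero] at b
    rw [a, b]
  rw [h1]
  simp only [sum_lie, lie_sum, sum_apply]
  rw [Finset.sum_comm,
    sum_range_mul_eq_sum_antidiagonal K (fun i j => ⁅S i, T j⁆ m)]
  intro i j hij
  exact lie_mem_orderGE (hS i) (hT j) m (by omega)

lemma expAd_lie {Z : VecPS σ L} (hZ : Z ∈ orderGE σ L 1) (F G : VecPS σ L) :
    expAd Z ⁅F, G⁆ = ⁅expAd Z F, expAd Z G⁆ := by
  ext m
  rw [lie_apply_eq_sum (adSeries_sub_mem _ hZ F (m.degree + 1))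
    (adSeries_sub_mem _ hZ G (m.degree + 1))
    (expTerm_mem_orderGE hZ F) (expTerm_mem_orderGE hZ G) (Nat.lt_succ_self _),
    expAd_apply_eq hZ _ (Nat.lt_succ_self _)]
  refine Finset.sum_congr rfl fun k _ => ?_
  rw [expTerm_lie, sum_apply]
  rfl

/-! ### Derivations -/

/-- a derivation of the Lie algebra of power series that lowers the order at most by one -/
structure IsFieldDerivation (δ : VecPS σ L →ₗ[ℂ] VecPS σ L) : Prop where
  leibniz : ∀ F G, δ ⁅F, G⁆ = ⁅δ F, G⁆ + ⁅F, δ G⁆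
  order : ∀ K F, F ∈ orderGE σ L (K + 1) → δ F ∈ orderGE σ L K

lemma derivation_expTerm {δ : VecPS σ L →ₗ[ℂ] VecPS σ L} (hδ : IsFieldDerivation δ)
    (Z F : VecPS σ L) (k : ℕ) :
    δ (expTerm Z (k + 1) F) = expTerm Z (k + 1) (δ F) -
      ∑ p ∈ antidiagonal k, ⁅dexpTerm Z p.1 (δ Z), expTerm Z p.2 F⁆ := by
  have := expTerm_deriv Z (δ Z) F (fun k => δ (expTerm Z k F)) (fun k => by
    rw [← map_smul, expTerm_succ, map_neg, hδ.leibniz]; abel) k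
  simpa using this

/-- The cut-off is `K + 1` and not `K` because `δ` may lower the order by one. -/
lemma derivation_adSeries_apply {δ : VecPS σ L →ₗ[ℂ] VecPS σ L} (hδ : IsFieldDerivation δ)
    (q : ℕ → ℂ) {Z : VecPS σ L} (hZ : Z ∈ orderGE σ L 1) (F : VecPS σ L) {m : σ →₀ ℕ} {K : ℕ}
    (hK : m.degree < K) :
    δ (adSeries q Z F) m = ∑ k ∈ range (K + 1), δ (q k • ((ad ℂ _ Z) ^ k) F) m := by
  have h := hδ.order K _ (adSeries_sub_mem q hZ F (K + 1))
  rw [map_sub, map_sum] at h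
  rw [apply_eq_of_sub_mem h hK, sum_apply]

/-- The rule `δ(Ad_{g⁻¹} F) = Ad_{g⁻¹} δF - [g⁻¹δg, Ad_{g⁻¹} F]` for `g = e^Z`, where `g⁻¹δg =
dexpAd Z (δ Z)`. -/
lemma derivation_expAd {δ : VecPS σ L →ₗ[ℂ] VecPS σ L} (hδ : IsFieldDerivation δ)
    {Z : VecPS σ L} (hZ : Z ∈ orderGE σ L 1) (F : VecPS σ L) :
    δ (expAd Z F) = expAd Z (δ F) - ⁅dexpAd Z (δ Z), expAd Z F⁆ := by
  ext m
  set K := m.degree + 1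
  have hK : m.degree < K := Nat.lt_succ_self _
  rw [derivation_adSeries_apply hδ _ hZ F hK, sub_apply,
    lie_apply_eq_sum (adSeries_sub_mem _ hZ (δ Z) K) (adSeries_sub_mem _ hZ F K)
    (dexpTerm_mem_orderGE hZ _) (expTerm_mem_orderGE hZ F) hK,
    expAd_apply_eq hZ _ (hK.trans (Nat.lt_succ_self K)), Finset.sum_range_succ',
    Finset.sum_range_succ' _ K]
  have e : ∀ k, δ (expNeg (k + 1) • ((ad ℂ _ Z) ^ (k + 1)) F) m =
      expTerm Z (k + 1) (δ F) m - ∑ p ∈ antidiagonal k,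
        ⁅dexpTerm Z p.1 (δ Z), expTerm Z p.2 F⁆ m := by
    intro k
    have := congrFun (derivation_expTerm hδ Z F k) m
    rw [sub_apply, sum_apply] at this
    exact this
  simp only [e, Finset.sum_sub_distrib, expNeg_zero, pow_zero, one_smul, Module.End.one_apply,
    expTerm_zero]
  rw [sub_add_eq_add_sub]
  rfl

/-- The Maurer–Cartan equation `dθ + [θ, θ]/2 = 0` for `θ = e^{-Z} d e^Z`, evaluated on two
derivations. It will yield the commutators of the vector fields of the action. -/
lemma derivation_dexpAd_maurerCartan {δ δ' : VecPS σ L →ₗ[ℂ] VecPS σ L}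
    (hδ : IsFieldDerivation δ) (hδ' : IsFieldDerivation δ') {Z : VecPS σ L}
    (hZ : Z ∈ orderGE σ L 1) :
    δ (dexpAd Z (δ' Z)) - δ' (dexpAd Z (δ Z)) =
      dexpAd Z (δ (δ' Z) - δ' (δ Z)) - ⁅dexpAd Z (δ Z), dexpAd Z (δ' Z)⁆ := by
  ext m
  set K := m.degree + 1
  have hK : m.degree < K := Nat.lt_succ_self _
  rw [sub_apply, derivation_adSeries_apply hδ _ hZ _ hK, derivation_adSeries_apply hδ' _ hZ _ hK,
    sub_apply, lie_apply_eq_sum (adSeries_sub_mem _ hZ (δ Z) K) (adSeries_sub_mem _ hZ (δ' Z) K)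
    (dexpTerm_mem_orderGE hZ _) (dexpTerm_mem_orderGE hZ _) hK,
    dexpAd_apply_eq hZ _ (hK.trans (Nat.lt_succ_self K)), ← Finset.sum_sub_distrib,
    Finset.sum_range_succ', Finset.sum_range_succ' _ K]
  have aux : ∀ {ε ε' : VecPS σ L →ₗ[ℂ] VecPS σ L}, IsFieldDerivation ε → ∀ k,
      ((k + 1 + 1 : ℕ) : ℂ) • ε (dexpTerm Z (k + 1) (ε' Z)) = expTerm Z (k + 1) (ε (ε' Z)) -
      ∑ p ∈ antidiagonal k, ⁅dexpTerm Z p.1 (ε Z), expTerm Z p.2 (ε' Z)⁆ := by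
    intro ε ε' hε k
    rw [← map_smul, dexpTerm_smul, derivation_expTerm hε]
  have e : ∀ k, δ (dexpNeg (k + 1) • ((ad ℂ _ Z) ^ (k + 1)) (δ' Z)) m -
      δ' (dexpNeg (k + 1) • ((ad ℂ _ Z) ^ (k + 1)) (δ Z)) m =
      dexpTerm Z (k + 1) (δ (δ' Z) - δ' (δ Z)) m - ∑ p ∈ antidiagonal k,
        ⁅dexpTerm Z p.1 (δ Z), dexpTerm Z p.2 (δ' Z)⁆ m := by
    intro k
    have := congrFun (dexpTerm_maurerCartan Z (δ Z) (δ' Z) (δ (δ' Z)) (δ' (δ Z))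
      (fun k => δ (dexpTerm Z k (δ' Z))) (fun k => δ' (dexpTerm Z k (δ Z)))
      (aux hδ) (aux hδ') k) m
    rw [sub_apply, sub_apply, sum_apply] at this
    exact this
  simp only [e, Finset.sum_sub_distrib, dexpNeg_zero, pow_zero, one_smul, Module.End.one_apply,
    dexpTerm_zero]
  rw [sub_apply, sub_add_eq_add_sub]
  rfl

end Lie

end VecPS

end CoadjointOrbit

end



noncomputable section

namespace CoadjointOrbit

set_option linter.unusedSectionVars false

open Finset hiding antidiagonal mem_antidiagonal

open Finset.HasAntidiagonal

open LieAlgebra (ad)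

namespace VecPS

variable {σ M M' M'' L : Type*}

section Module

variable [AddCommGroup M] [Module ℂ M] [AddCommGroup M'] [Module ℂ M']
  [AddCommGroup M''] [Module ℂ M'']

/-! ### Vector fields -/

/-- the partial derivative along the variable `j` -/
def partialDeriv (j : σ) : VecPS σ M →ₗ[ℂ] VecPS σ M :=
  LinearMap.pi fun b => ((b j + 1 : ℕ) : ℂ) • coeff (b + Finsupp.single j 1)

lemma partialDeriv_apply (j : σ) (F : VecPS σ M) (b : σ →₀ ℕ) :
    partialDeriv j F b = ((b j + 1 : ℕ) : ℂ) • F (b + Finsupp.single j 1) := rfl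

/-- the series without terms of order different from one, with the coefficients `g` -/
def linear (g : σ → M) : VecPS σ M :=
  fun m => if m.degree = 1 then ∑ j ∈ m.support, g j else 0

@[simp] lemma linear_single (g : σ → M) (j : σ) : linear g (Finsupp.single j 1) = g j := by
  simp [linear, Finsupp.support_single]

lemma linear_apply_of_ne (g : σ → M) {m : σ →₀ ℕ} (hm : ∀ j, m ≠ Finsupp.single j 1) :
    linear g m = 0 := by
  rw [linear, if_neg]
  intro h
  have hne : m ≠ 0 := by rintro rfl; simp at h
  obtain ⟨j, hj⟩ := Finsupp.support_nonempty_iff.2 hne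
  have hle : Finsupp.single j 1 ≤ m := by
    rw [Finsupp.single_le_iff]
    exact Nat.one_le_iff_ne_zero.2 (Finsupp.mem_support_iff.1 hj)
  have hd : (m - Finsupp.single j 1).degree + 1 = m.degree := by
    conv_rhs => rw [← tsub_add_cancel_of_le hle, map_add, Finsupp.degree_single]
  have h0 : m - Finsupp.single j 1 = 0 := (Finsupp.degree_eq_zero_iff _).1 (by omega)
  exact hm j (le_antisymm (tsub_eq_zero_iff_le.1 h0) hle)

lemma linear_mem_orderGE (g : σ → M) : linear g ∈ orderGE σ M 1 := by
  intro m hm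
  rw [linear, if_neg (by omega)]

variable [DecidableEq σ]

/-- the derivative along the vector field whose `j`-th component is `m ↦ W m j` -/
def fieldDeriv (W : VecPS σ (σ →₀ ℂ)) : VecPS σ M →ₗ[ℂ] VecPS σ M :=
  LinearMap.pi fun m => ∑ p ∈ antidiagonal m,
    (W p.1).sum fun j r => r • (coeff p.2 ∘ₗ partialDeriv j)

lemma fieldDeriv_apply (W : VecPS σ (σ →₀ ℂ)) (F : VecPS σ M) (m : σ →₀ ℕ) :
    fieldDeriv W F m =
      ∑ p ∈ antidiagonal m, (W p.1).sum fun j r => r • partialDeriv j F p.2 := by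
  change (∑ p ∈ antidiagonal m, (W p.1).sum fun j r => r • (coeff p.2 ∘ₗ partialDeriv j)) F = _
  simp only [LinearMap.sum_apply, Finsupp.sum, LinearMap.smul_apply, LinearMap.comp_apply,
    coeff_apply]

lemma mapCoeff_fieldDeriv (φ : M →ₗ[ℂ] M') (W : VecPS σ (σ →₀ ℂ)) (F : VecPS σ M) :
    mapCoeff φ (fieldDeriv W F) = fieldDeriv W (mapCoeff φ F) := by
  ext m
  simp only [mapCoeff_apply, fieldDeriv_apply, map_sum, Finsupp.sum, map_smul, partialDeriv_apply]

lemma fieldDeriv_const (W : VecPS σ (σ →₀ ℂ)) (y : M) : fieldDeriv W (const y) = 0 := by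
  ext m
  rw [fieldDeriv_apply]
  refine Finset.sum_eq_zero fun p _ => Finset.sum_eq_zero fun j _ => ?_
  change W p.1 j • partialDeriv j (const y) p.2 = 0
  rw [partialDeriv_apply, const_apply_of_ne, smul_zero, smul_zero]
  intro h
  have := congrArg (fun q => q j) h
  simp at this

/-- The partial derivatives of a linear series are constant, so differentiating the tautological
series `∑ x_j g_j` along `W` returns the components of `W`. -/
lemma fieldDeriv_linear (W : VecPS σ (σ →₀ ℂ)) (g : σ → M) :
    fieldDeriv W (linear g) = mapCoeff (Finsupp.linearCombination ℂ g) W := by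
  ext m
  rw [fieldDeriv_apply, mapCoeff_apply, Finset.sum_eq_single (m, 0)]
  · rw [Finsupp.linearCombination_apply]
    refine Finset.sum_congr rfl fun j _ => ?_
    simp [partialDeriv_apply]
  · rintro ⟨a, b⟩ h hne
    refine Finset.sum_eq_zero fun j _ => ?_
    change W a j • partialDeriv j (linear g) b = 0
    rw [partialDeriv_apply, linear, if_neg, smul_zero, smul_zero]
    rw [map_add, Finsupp.degree_single]
    intro hd
    have hb : b = 0 := (Finsupp.degree_eq_zero_iff b).1 (by omega)
    subst hb
    rw [mem_antidiagonal, add_zero] at h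
    exact hne (by rw [← h])
  · intro h; simp [mem_antidiagonal] at h

/-! ### Operators that act by a Cauchy product -/

/-- The operator is the Cauchy product with a power series of linear maps. -/
def IsCauchy (T : VecPS σ M →ₗ[ℂ] VecPS σ M') : Prop :=
  ∀ F m, T F m = ∑ p ∈ antidiagonal m, T (const (F p.2)) p.1

lemma isCauchy_mapCoeff (φ : M →ₗ[ℂ] M') :
    IsCauchy (mapCoeff φ : VecPS σ M →ₗ[ℂ] VecPS σ M') := by
  intro F m
  rw [Finset.sum_eq_single (0, m)]
  · simp
  · rintro ⟨a, b⟩ h hne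
    rw [mapCoeff_apply, const_apply_of_ne, map_zero]
    rintro rfl
    rw [mem_antidiagonal, zero_add] at h
    exact hne (by rw [← h])
  · intro h; simp [mem_antidiagonal] at h

lemma IsCauchy.comp {T : VecPS σ M →ₗ[ℂ] VecPS σ M'} {T' : VecPS σ M' →ₗ[ℂ] VecPS σ M''}
    (hT' : IsCauchy T') (hT : IsCauchy T) : IsCauchy (T' ∘ₗ T) := by
  intro F m
  simp only [LinearMap.comp_apply]
  rw [hT']
  have h1 : ∀ p : (σ →₀ ℕ) × (σ →₀ ℕ), T' (const (T F p.2)) p.1 =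
      ∑ q ∈ antidiagonal p.2, T' (const (T (const (F q.2)) q.1)) p.1 := by
    intro p
    rw [hT F p.2, map_sum, map_sum, sum_apply]
  have h2 : ∀ p : (σ →₀ ℕ) × (σ →₀ ℕ), T' (T (const (F p.2))) p.1 =
      ∑ q ∈ antidiagonal p.1, T' (const (T (const (F p.2)) q.2)) q.1 := fun p => hT' _ _
  simp only [h1, h2]
  exact (sum_antidiagonal_assoc m (fun a b c => T' (const (T (const (F c)) b)) a)).symm

end Module

section Lie

variable [DecidableEq σ] [LieRing L] [LieAlgebra ℂ L]

lemma isCauchy_ad (Z : VecPS σ L) : IsCauchy (ad ℂ _ Z : VecPS σ L →ₗ[ℂ] VecPS σ L) := by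
  intro F m
  simp only [LieAlgebra.ad_apply, lie_const_apply]
  rfl

lemma isCauchy_ad_pow (Z : VecPS σ L) (k : ℕ) :
    IsCauchy ((ad ℂ _ Z) ^ k : VecPS σ L →ₗ[ℂ] VecPS σ L) := by
  induction k with
  | zero =>
    have := isCauchy_mapCoeff (σ := σ) (LinearMap.id : L →ₗ[ℂ] L)
    exact this
  | succ k ih =>
    rw [pow_succ']
    exact (isCauchy_ad Z).comp ih

lemma isCauchy_adSeries (q : ℕ → ℂ) {Z : VecPS σ L} (hZ : Z ∈ orderGE σ L 1) :
    IsCauchy (adSeries q Z) := by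
  intro F m
  have h : ∀ p ∈ antidiagonal m, adSeries q Z (const (F p.2)) p.1 =
      ∑ k ∈ range (m.degree + 1), q k • ((ad ℂ _ Z) ^ k) (const (F p.2)) p.1 := by
    intro p hp
    rw [mem_antidiagonal] at hp
    apply adSeries_apply_eq q hZ
    rw [← hp, map_add]; omega
  rw [Finset.sum_congr rfl h, Finset.sum_comm, adSeries_apply]
  refine Finset.sum_congr rfl fun k _ => ?_
  rw [isCauchy_ad_pow Z k F m, Finset.smul_sum]

lemma linear_lie_apply (g : σ → L) (F : VecPS σ L) (m : σ →₀ ℕ) :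
    ⁅linear g, F⁆ m = ∑ j ∈ m.support, ⁅g j, F (m - Finsupp.single j 1)⁆ := by
  rw [lie_apply]
  symm
  have hle : ∀ j ∈ m.support, Finsupp.single j 1 ≤ m := by
    intro j hj
    rw [Finsupp.single_le_iff]
    exact Nat.one_le_iff_ne_zero.2 (Finsupp.mem_support_iff.1 hj)
  refine Finset.sum_of_injOn (fun j => (Finsupp.single j 1, m - Finsupp.single j 1)) ?_ ?_ ?_ ?_
  · intro j _ j' _ e
    exact Finsupp.single_left_injective one_ne_zero (congrArg Prod.fst e)
  · intro j hj
    simp only [mem_coe, mem_antidiagonal]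
    exact add_tsub_cancel_of_le (hle j hj)
  · rintro ⟨a, b⟩ h h2
    rw [mem_antidiagonal] at h
    rw [linear_apply_of_ne, zero_lie]
    rintro j rfl
    apply h2
    refine ⟨j, ?_, ?_⟩
    · simp only at h
      simp [← h]
    · simp only at h
      simp [← h]
  · intro j _
    simp

lemma partialDeriv_lie (j : σ) (F G : VecPS σ L) :
    partialDeriv j ⁅F, G⁆ = ⁅partialDeriv j F, G⁆ + ⁅F, partialDeriv j G⁆ := by
  ext b
  rw [partialDeriv_apply, lie_apply, add_apply, lie_apply, lie_apply, Finset.smul_sum]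
  -- The multiplicity of `j` in the monomial is the sum of its multiplicities in the two factors;
  -- these give the two terms of the Leibniz rule.
  have e : ∀ p ∈ antidiagonal (b + Finsupp.single j 1), ((b j + 1 : ℕ) : ℂ) • ⁅F p.1, G p.2⁆ =
      (p.1 j : ℂ) • ⁅F p.1, G p.2⁆ + (p.2 j : ℂ) • ⁅F p.1, G p.2⁆ := by
    intro p hp
    rw [mem_antidiagonal] at hp
    have := congrArg (fun q => q j) hp
    simp only [Finsupp.add_apply, Finsupp.single_eq_same] at this
    rw [← this, ← add_smul]
    push_cast; rfl
  rw [Finset.sum_congr rfl e, Finset.sum_add_distrib]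
  congr 1
  · rw [sum_antidiagonal_add_single b j (fun c d => (c j : ℂ) • ⁅F c, G d⁆)
      (fun c d h => by simp [h])]
    refine Finset.sum_congr rfl fun p _ => ?_
    simp [partialDeriv_apply]
  · rw [Finsupp.sum_antidiagonal_swap (b + Finsupp.single j 1)
      (fun c d => (d j : ℂ) • ⁅F c, G d⁆),
      sum_antidiagonal_add_single b j (fun c d => (c j : ℂ) • ⁅F d, G c⁆)
      (fun c d h => by simp [h]),
      Finsupp.sum_antidiagonal_swap b (fun c d => ⁅F c, partialDeriv j G d⁆)]
    refine Finset.sum_congr rfl fun p _ => ?_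
    simp [partialDeriv_apply]

lemma isFieldDerivation_fieldDeriv (W : VecPS σ (σ →₀ ℂ)) :
    IsFieldDerivation (fieldDeriv W : VecPS σ L →ₗ[ℂ] VecPS σ L) where
  leibniz F G := by
    ext m
    rw [add_apply, fieldDeriv_apply, lie_apply, lie_apply]
    have h1 : ∀ p : (σ →₀ ℕ) × (σ →₀ ℕ), ((W p.1).sum fun j r => r • partialDeriv j ⁅F, G⁆ p.2) =
        ∑ q ∈ antidiagonal p.2, (⁅(W p.1).sum fun j r => r • partialDeriv j F q.1, G q.2⁆ +
          ⁅F q.1, (W p.1).sum fun j r => r • partialDeriv j G q.2⁆) := by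
      intro p
      simp only [Finsupp.sum, partialDeriv_lie, add_apply, lie_apply, sum_lie, lie_sum, smul_add,
        smul_lie, lie_smul, Finset.sum_add_distrib, Finset.smul_sum]
      congr 1 <;> rw [Finset.sum_comm]
    simp only [h1, Finset.sum_add_distrib]
    congr 1
    · rw [← sum_antidiagonal_assoc m
        (fun a b c => ⁅(W a).sum fun j r => r • partialDeriv j F b, G c⁆)]
      refine Finset.sum_congr rfl fun p _ => ?_
      rw [fieldDeriv_apply, sum_lie]
    · rw [sum_antidiagonal_left_comm m
        (fun a b c => ⁅F b, (W a).sum fun j r => r • partialDeriv j G c⁆)]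
      refine Finset.sum_congr rfl fun p _ => ?_
      rw [fieldDeriv_apply, lie_sum]
  order K F hF m hm := by
    rw [fieldDeriv_apply]
    refine Finset.sum_eq_zero fun p hp => Finset.sum_eq_zero fun j _ => ?_
    rw [mem_antidiagonal] at hp
    change W p.1 j • partialDeriv j F p.2 = 0
    rw [partialDeriv_apply, hF _ _, smul_zero, smul_zero]
    rw [map_add, Finsupp.degree_single]
    have : p.1.degree + p.2.degree = m.degree := by rw [← hp, map_add]
    omega

end Lie

end VecPS

end CoadjointOrbit

end



noncomputable section

namespace CoadjointOrbit

set_option linter.unusedSectionVars false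

open Finset hiding antidiagonal mem_antidiagonal

open Finset.HasAntidiagonal

open LieAlgebra (ad)

open VecPS

namespace RootDecomposition

universe u v w x

variable {L : Type u} [LieRing L] [LieAlgebra ℂ L] {Δ : Type v} [DecidableEq Δ]
  {I : Type w} {Θ : Type x} (D : RootDecomposition L Δ I Θ)

/-! ## Formal functions as power series with coefficients in the Lie algebra -/

lemma psCoeff_eq {σ : Type*} (n : σ →₀ ℕ) (F : MvPowerSeries σ ℂ) :
    MvPowerSeries.coeff n F = F n := rfl

/-- scalar valued power series as elements of the ring of power series -/
def toMv {σ : Type*} : VecPS σ ℂ →ₗ[ℂ] MvPowerSeries σ ℂ where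
  toFun F := F
  map_add' _ _ := rfl
  map_smul' _ _ := rfl

lemma coeff_toMv {σ : Type*} (n : σ →₀ ℕ) (F : VecPS σ ℂ) :
    MvPowerSeries.coeff n (toMv F) = F n := rfl

/-- the components of a Lie algebra valued power series -/
def components (F : VecPS (I ⊕ I) L) : FormalAlg I Θ := fun c m => D.J.repr (F m) c

/-- the element `∑ z_i J_i` -/
def zGen : I ⊕ I → L := Sum.elim (fun i => D.J (Gen.raise i)) (fun _ => 0)

/-- the element `∑ a_i J_{-i}` -/
def aGen : I ⊕ I → L := Sum.elim (fun _ => 0) (fun i => D.J (Gen.lower i))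

/-- `∑ z_i J_i` -/
def zSer : VecPS (I ⊕ I) L := linear D.zGen

/-- `∑ a_i J_{-i}` -/
def aSer : VecPS (I ⊕ I) L := linear D.aGen

lemma zSer_mem : D.zSer ∈ orderGE (I ⊕ I) L 1 := linear_mem_orderGE _

lemma aSer_mem : D.aSer ∈ orderGE (I ⊕ I) L 1 := linear_mem_orderGE _

lemma repr_lie_eq_sum (y u : L) (c : Gen I Θ) {S : Finset (Gen I Θ)}
    (hS : (D.J.repr u).support ⊆ S) :
    D.J.repr ⁅y, u⁆ c = ∑ d ∈ S, D.J.repr u d * D.J.repr ⁅y, D.J d⁆ c := by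
  conv_lhs => rw [← D.J.linearCombination_repr u]
  rw [Finsupp.linearCombination_apply, Finsupp.sum_of_support_subset _ hS _ (by simp), lie_sum,
    map_sum, Finsupp.finsetSum_apply]
  simp

variable [DecidableEq I]

/-- The sum over all generators is finite for each monomial: only variables that divide it occur,
and each coefficient of `F` is a finite combination of generators. Hence the `finsum` has its proper
value, and the formal definitions can be treated by the calculus of Lie algebra valued series. -/
lemma formalAd_components (e : I → Gen I Θ) (x : I → I ⊕ I) (hx : Function.Injective x)
    (g : I ⊕ I → L) (hg : ∀ i, g (x i) = D.J (e i)) (hg' : ∀ j, j ∉ Set.range x → g j = 0)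
    (F : VecPS (I ⊕ I) L) :
    D.formalAd e x (D.components F) = D.components ⁅linear g, F⁆ := by
  classical
  funext c n
  change _ = D.J.repr (⁅linear g, F⁆ n) c
  rw [linear_lie_apply, map_sum, Finsupp.finsetSum_apply]
  set U : Finset (Gen I Θ) := n.support.biUnion fun j =>
    (D.J.repr (F (n - Finsupp.single j 1))).support
  have hU : ∀ j ∈ n.support, (D.J.repr (F (n - Finsupp.single j 1))).support ⊆ U :=
    fun j hj => Finset.subset_biUnion_of_mem
      (fun j => (D.J.repr (F (n - Finsupp.single j 1))).support) hj
  have hcoef : ∀ (i : I) (d : Gen I Θ),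
      MvPowerSeries.coeff n (MvPowerSeries.X (x i) * D.components F d) =
        if x i ∈ n.support then D.J.repr (F (n - Finsupp.single (x i) 1)) d else 0 := by
    intro i d
    rw [MvPowerSeries.X, MvPowerSeries.coeff_monomial_mul, one_mul]
    have : Finsupp.single (x i) 1 ≤ n ↔ x i ∈ n.support := by
      rw [Finsupp.single_le_iff, Finsupp.mem_support_iff, Nat.one_le_iff_ne_zero]
    simp only [this]
    rfl
  have hsup : (Function.support fun p : I × Gen I Θ =>
      MvPowerSeries.coeff n (MvPowerSeries.X (x p.1) * D.components F p.2) *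
        D.J.repr ⁅D.J (e p.1), D.J p.2⁆ c) ⊆
      ((n.support.preimage x hx.injOn ×ˢ U : Finset (I × Gen I Θ)) : Set (I × Gen I Θ)) := by
    rintro ⟨i, d⟩ h
    rw [Function.mem_support] at h
    have h := left_ne_zero_of_mul h
    rw [hcoef] at h
    split_ifs at h with hi
    · simp only [coe_product, Set.mem_prod, mem_coe, mem_preimage]
      exact ⟨hi, hU _ hi (Finsupp.mem_support_iff.2 h)⟩
    · exact absurd rfl h
  unfold formalAd
  rw [finsum_eq_sum_of_support_subset _ hsup, Finset.sum_product]
  refine Finset.sum_of_injOn x hx.injOn ?_ ?_ ?_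
  · intro i hi; simpa using hi
  · intro j hj hj'
    rw [hg', zero_lie, map_zero, Finsupp.zero_apply]
    rintro ⟨i, rfl⟩
    exact hj' ⟨i, by simpa using hj, rfl⟩
  · intro i hi
    rw [mem_preimage] at hi
    rw [hg, D.repr_lie_eq_sum _ _ c (hU _ hi)]
    refine Finset.sum_congr rfl fun d _ => ?_
    rw [hcoef, if_pos hi]

lemma adZ_components (F : VecPS (I ⊕ I) L) :
    D.adZ (D.components F) = D.components ⁅D.zSer, F⁆ := by
  refine D.formalAd_components _ _ Sum.inl_injective _ (fun i => rfl) ?_ F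
  rintro (i | i) h
  · exact absurd ⟨i, rfl⟩ h
  · rfl

lemma adA_components (F : VecPS (I ⊕ I) L) :
    D.adA (D.components F) = D.components ⁅D.aSer, F⁆ := by
  refine D.formalAd_components _ _ Sum.inr_injective _ (fun i => rfl) ?_ F
  rintro (i | i) h
  · rfl
  · exact absurd ⟨i, rfl⟩ h

lemma opSeries_components (q : ℕ → ℂ) (T : FormalAlg I Θ → FormalAlg I Θ) (Z : VecPS (I ⊕ I) L)
    (hT : ∀ F, T (D.components F) = D.components ⁅Z, F⁆) (F : VecPS (I ⊕ I) L) :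
    opSeries q T (D.components F) = D.components (adSeries q Z F) := by
  have hpow : ∀ k, T^[k] (D.components F) = D.components (((ad ℂ _ Z) ^ k) F) := by
    intro k
    induction k with
    | zero => rfl
    | succ k ih =>
      rw [Function.iterate_succ_apply', ih, hT, pow_succ', Module.End.mul_apply,
        LieAlgebra.ad_apply]
  funext c n
  change _ = D.J.repr (adSeries q Z F n) c
  rw [adSeries_apply, map_sum, Finsupp.finsetSum_apply]
  refine Finset.sum_congr rfl fun k _ => ?_
  rw [hpow, map_smul]
  rfl

lemma components_const (y : L) :
    (fun c => MvPowerSeries.C (D.J.repr y c) : FormalAlg I Θ) = D.components (const y) := by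
  funext c n
  change MvPowerSeries.coeff n (MvPowerSeries.C (D.J.repr y c)) = D.J.repr (const y n) c
  rw [MvPowerSeries.coeff_C]
  split_ifs with h
  · subst h; simp
  · rw [const_apply_of_ne _ h]; simp

lemma formalAdInv_eq (y : L) :
    D.formalAdInv y = D.components (expAd D.aSer (expAd D.zSer (const y))) := by
  rw [formalAdInv, components_const, opSeries_components _ _ _ _ D.adZ_components,
    opSeries_components _ _ _ _ D.adA_components]

lemma components_add (F G : VecPS (I ⊕ I) L) :
    D.components (F + G) = D.components F + D.components G := by
  funext c n
  change D.J.repr (F n + G n) c = D.J.repr (F n) c + D.J.repr (G n) c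
  simp

/-- a vector field with finitely supported coefficients, as a formal vector field -/
def toField (W : VecPS (I ⊕ I) (I ⊕ I →₀ ℂ)) : FormalField I := fun j m => W m j

/-- The displacements `δZ` and `δA` are the derivatives of the tautological series along the field,
which makes the rules for derivations applicable to `g⁻¹δg`. -/
lemma formalMaurerCartan_toField (W : VecPS (I ⊕ I) (I ⊕ I →₀ ℂ)) :
    D.formalMaurerCartan (toField W) =
      D.components (expAd D.aSer (dexpAd D.zSer (fieldDeriv W D.zSer)) +
        dexpAd D.aSer (fieldDeriv W D.aSer)) := by
  have hz : (Sum.elim (fun i => toField W (Sum.inl i)) (fun _ => 0) : FormalAlg I Θ) =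
      D.components (fieldDeriv W D.zSer) := by
    funext c n
    change _ = D.J.repr (fieldDeriv W D.zSer n) c
    rw [zSer, fieldDeriv_linear, mapCoeff_apply, Finsupp.linearCombination_apply, Finsupp.sum,
      map_sum, Finsupp.finsetSum_apply]
    rcases c with i | c
    · rw [Finset.sum_eq_single (Sum.inl i)]
      · simp [zGen, toField]
      · rintro (j | j) _ hj
        · have : j ≠ i := fun h => hj (by rw [h])
          simp [zGen, this]
        · simp [zGen]
      · intro h
        simp [Finsupp.notMem_support_iff.1 h]
    · rw [Finset.sum_eq_zero]
      · rfl
      · rintro (j | j) _ <;> simp [zGen]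
  have ha : (Sum.elim (fun _ => 0) (Sum.elim (fun _ => 0) (fun i => toField W (Sum.inr i))) :
      FormalAlg I Θ) = D.components (fieldDeriv W D.aSer) := by
    funext c n
    change _ = D.J.repr (fieldDeriv W D.aSer n) c
    rw [aSer, fieldDeriv_linear, mapCoeff_apply, Finsupp.linearCombination_apply, Finsupp.sum,
      map_sum, Finsupp.finsetSum_apply]
    rcases c with i | h | i
    · rw [Finset.sum_eq_zero]
      · rfl
      · rintro (j | j) _ <;> simp [aGen]
    · rw [Finset.sum_eq_zero]
      · rfl
      · rintro (j | j) _ <;> simp [aGen]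
    · rw [Finset.sum_eq_single (Sum.inr i)]
      · simp [aGen, toField]
      · rintro (j | j) _ hj
        · simp [aGen]
        · have : j ≠ i := fun h => hj (by rw [h])
          simp [aGen, this]
      · intro h
        simp [Finsupp.notMem_support_iff.1 h]
  rw [formalMaurerCartan, hz, ha, opSeries_components _ _ _ _ D.adZ_components,
    opSeries_components _ _ _ _ D.adA_components, opSeries_components _ _ _ _ D.adA_components,
    components_add]

lemma formalDeriv_toField (W : VecPS (I ⊕ I) (I ⊕ I →₀ ℂ)) (F : VecPS (I ⊕ I) ℂ) :
    formalDeriv (toField W) (toMv F) = toMv (fieldDeriv W F) := by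
  classical
  funext n
  -- Even for infinitely many variables, only finitely many components of `W` have a nonzero
  -- coefficient at a divisor of the monomial; outside `S` the summand of the `finsum` vanishes.
  set S : Finset (I ⊕ I) := (antidiagonal n).biUnion fun p => (W p.1).support
  have hS : ∀ p ∈ antidiagonal n, (W p.1).support ⊆ S := fun p hp =>
    Finset.subset_biUnion_of_mem (fun p : (I ⊕ I →₀ ℕ) × (I ⊕ I →₀ ℕ) => (W p.1).support) hp
  have hc : ∀ j, MvPowerSeries.coeff n (toField W j * MvPowerSeries.pderiv ℂ j (toMv F)) =
      ∑ p ∈ antidiagonal n, W p.1 j * partialDeriv j F p.2 := by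
    intro j
    rw [MvPowerSeries.coeff_mul]
    refine Finset.sum_congr rfl fun p _ => ?_
    rw [MvPowerSeries.coeff_pderiv, partialDeriv_apply, smul_eq_mul, mul_comm (_ : ℂ) (_ + 1)]
    push_cast
    rfl
  unfold formalDeriv
  rw [finsum_eq_sum_of_support_subset _ (s := S)]
  · simp only [hc]
    change _ = fieldDeriv W F n
    rw [Finset.sum_comm, fieldDeriv_apply]
    refine Finset.sum_congr rfl fun p hp => ?_
    rw [Finsupp.sum_of_support_subset _ (hS p hp) _ (by simp)]
    rfl
  · intro j hj
    rw [Function.mem_support, hc] at hj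
    obtain ⟨p, hp, h⟩ := Finset.exists_ne_zero_of_sum_ne_zero hj
    exact hS p hp (Finsupp.mem_support_iff.2 (left_ne_zero_of_mul h))

lemma formalContract_toField_apply (W : VecPS (I ⊕ I) (I ⊕ I →₀ ℂ)) (A : I → FormalFun I)
    (n : I ⊕ I →₀ ℕ) :
    formalContract A (toField W) n = ∑ p ∈ antidiagonal n,
      (W p.1).sum fun j r => r * (Sum.elim (fun i => A i p.2) (fun _ => 0) j : ℂ) := by
  classical
  set S : Finset (I ⊕ I) := (antidiagonal n).biUnion fun p => (W p.1).support
  have hS : ∀ p ∈ antidiagonal n, (W p.1).support ⊆ S := fun p hp =>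
    Finset.subset_biUnion_of_mem (fun p : (I ⊕ I →₀ ℕ) × (I ⊕ I →₀ ℕ) => (W p.1).support) hp
  have hc : ∀ i, MvPowerSeries.coeff n (toField W (Sum.inl i) * A i) =
      ∑ p ∈ antidiagonal n, W p.1 (Sum.inl i) * A i p.2 := by
    intro j
    rw [MvPowerSeries.coeff_mul]
    rfl
  unfold formalContract
  rw [finsum_eq_sum_of_support_subset _ (s := S.preimage Sum.inl Sum.inl_injective.injOn)]
  · simp only [hc]
    rw [Finset.sum_comm]
    refine Finset.sum_congr rfl fun p hp => ?_
    rw [Finsupp.sum_of_support_subset _ (hS p hp) _ (by simp)]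
    refine Finset.sum_of_injOn Sum.inl Sum.inl_injective.injOn ?_ ?_ ?_
    · intro i hi; simpa using hi
    · rintro (i | i) hi hi'
      · exact absurd ⟨i, by simpa using hi, rfl⟩ hi'
      · simp
    · intro i _; rfl
  · intro i hi
    rw [Function.mem_support, hc] at hi
    obtain ⟨p, hp, h⟩ := Finset.exists_ne_zero_of_sum_ne_zero hi
    rw [mem_coe, mem_preimage]
    exact hS p hp (Finsupp.mem_support_iff.2 (left_ne_zero_of_mul h))

end RootDecomposition

end CoadjointOrbit

end



/-! ### Coefficient subspaces, the grading by the root lattice, and functionals on the Cartan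
subalgebra -/

noncomputable section

namespace CoadjointOrbit

set_option linter.unusedSectionVars false

open Finset hiding antidiagonal mem_antidiagonal

open Finset.HasAntidiagonal

open LieAlgebra (ad)

namespace VecPS

variable {σ M L : Type*}

/-- power series with coefficients in a subspace -/
def coeffIn [AddCommGroup M] [Module ℂ M] (S : Submodule ℂ M) : Submodule ℂ (VecPS σ M) where
  carrier := {F | ∀ m, F m ∈ S}
  add_mem' h h' m := S.add_mem (h m) (h' m)
  zero_mem' _ := S.zero_mem
  smul_mem' r _ h m := S.smul_mem r (h m)

lemma linear_mem_coeffIn [AddCommGroup M] [Module ℂ M] {S : Submodule ℂ M} {g : σ → M}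
    (hg : ∀ j, g j ∈ S) : linear g ∈ coeffIn S := by
  intro m
  rw [linear]
  split_ifs
  · exact S.sum_mem fun j _ => hg j
  · exact S.zero_mem

variable [DecidableEq σ] [LieRing L] [LieAlgebra ℂ L]

lemma lie_mem_coeffIn {S T R : Submodule ℂ L} (h : ∀ x ∈ S, ∀ y ∈ T, ⁅x, y⁆ ∈ R)
    {F G : VecPS σ L} (hF : F ∈ coeffIn S) (hG : G ∈ coeffIn T) : ⁅F, G⁆ ∈ coeffIn R := by
  intro m
  rw [lie_apply]
  exact R.sum_mem fun p _ => h _ (hF _) _ (hG _)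

lemma adSeries_mem_coeffIn (q : ℕ → ℂ) {K S : Submodule ℂ L} (h : ∀ x ∈ K, ∀ y ∈ S, ⁅x, y⁆ ∈ S)
    {Z F : VecPS σ L} (hZ : Z ∈ coeffIn K) (hF : F ∈ coeffIn S) :
    adSeries q Z F ∈ coeffIn S := by
  have hp : ∀ k, ((ad ℂ _ Z) ^ k) F ∈ coeffIn S := by
    intro k
    induction k with
    | zero => exact hF
    | succ k ih =>
      rw [pow_succ', Module.End.mul_apply, LieAlgebra.ad_apply]
      exact lie_mem_coeffIn h hZ ih
  intro m
  rw [adSeries_apply]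
  exact S.sum_mem fun k _ => S.smul_mem _ (hp k m)

end VecPS

open VecPS

namespace RootDecomposition

universe u v w x

variable {L : Type u} [LieRing L] [LieAlgebra ℂ L] {Δ : Type v} [DecidableEq Δ]
  {I : Type w} {Θ : Type x} (D : RootDecomposition L Δ I Θ)

/-! ## Subspaces given by degrees -/

lemma deg_raise_pos (i : I) : 0 < D.deg (Gen.raise i) := by
  refine lt_of_le_of_ne (fun s => by simp [deg, genDegree]) fun h => D.wt_ne_zero i ?_
  funext s
  have := congrFun h s
  simp only [deg, genDegree, Sum.elim_inl, Pi.zero_apply] at this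
  exact_mod_cast this.symm

lemma deg_cartan (h : Θ) : D.deg (Gen.cartan h) = 0 := rfl

lemma deg_lower (i : I) : D.deg (Gen.lower i) = -D.deg (Gen.raise i) := rfl

lemma deg_lower_neg (i : I) : D.deg (Gen.lower i) < 0 := by
  rw [deg_lower]
  exact neg_lt_zero.2 (D.deg_raise_pos i)

/-- The order of `Δ → ℤ` is only partial; the dichotomy holds because each generator has a positive,
zero or negative degree. -/
lemma not_deg_pos_iff (c : Gen I Θ) : ¬ 0 < D.deg c ↔ D.deg c ≤ 0 := by
  rcases c with i | h | i
  · exact ⟨fun h => absurd (D.deg_raise_pos i) h, fun h => not_lt_of_ge h⟩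
  · simp [D.deg_cartan h]
  · exact ⟨fun _ => (D.deg_lower_neg i).le, fun h => not_lt_of_ge h⟩

lemma deg_le_zero_iff (c : Gen I Θ) : D.deg c ≤ 0 ↔ D.deg c < 0 ∨ D.deg c = 0 :=
  le_iff_lt_or_eq

/-- the elements all of whose components have a degree in `A` -/
def gradedPart (A : Set (Δ → ℤ)) : Submodule ℂ L where
  carrier := {y | ∀ c, D.J.repr y c ≠ 0 → D.deg c ∈ A}
  add_mem' {y y'} h h' c hc := by
    rw [map_add, Finsupp.add_apply] at hc
    by_cases h0 : D.J.repr y c = 0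
    · exact h' c (by rwa [h0, zero_add] at hc)
    · exact h c h0
  zero_mem' c hc := by simp at hc
  smul_mem' r y h c hc := by
    rw [map_smul, Finsupp.smul_apply] at hc
    exact h c (right_ne_zero_of_mul hc)

lemma J_mem_gradedPart {A : Set (Δ → ℤ)} {c : Gen I Θ} (h : D.deg c ∈ A) :
    D.J c ∈ D.gradedPart A := by
  classical
  intro d hd
  rw [D.J.repr_self, Finsupp.single_apply] at hd
  split_ifs at hd with e
  · rwa [← e]
  · exact absurd rfl hd

lemma gradedPart_mono {A B : Set (Δ → ℤ)} (h : A ⊆ B) : D.gradedPart A ≤ D.gradedPart B :=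
  fun _ hy c hc => h (hy c hc)

lemma repr_lie_ne_zero {y y' : L} {c : Gen I Θ} (h : D.J.repr ⁅y, y'⁆ c ≠ 0) :
    ∃ d e, D.J.repr y d ≠ 0 ∧ D.J.repr y' e ≠ 0 ∧ D.deg c = D.deg d + D.deg e := by
  rw [D.repr_lie_eq_sum _ _ c (Finset.Subset.refl _)] at h
  obtain ⟨e, -, he⟩ := Finset.exists_ne_zero_of_sum_ne_zero h
  have h2 := right_ne_zero_of_mul he
  rw [← lie_skew, map_neg, Finsupp.neg_apply, neg_ne_zero,
    D.repr_lie_eq_sum _ _ c (Finset.Subset.refl _)] at h2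
  obtain ⟨d, -, hd⟩ := Finset.exists_ne_zero_of_sum_ne_zero h2
  refine ⟨d, e, left_ne_zero_of_mul hd, left_ne_zero_of_mul he, ?_⟩
  have h3 := D.graded e d c (right_ne_zero_of_mul hd)
  rw [add_comm]
  exact h3

lemma lie_mem_gradedPart {A B C : Set (Δ → ℤ)} (h : ∀ a ∈ A, ∀ b ∈ B, a + b ∈ C) :
    ∀ y ∈ D.gradedPart A, ∀ y' ∈ D.gradedPart B, ⁅y, y'⁆ ∈ D.gradedPart C := by
  intro y hy y' hy' c hc
  obtain ⟨d, e, hd, he, hde⟩ := D.repr_lie_ne_zero hc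
  rw [hde]
  exact h _ (hy d hd) _ (hy' e he)

open scoped Classical in
/-- the projection on the generators whose degree is in `A` -/
def projDeg (A : Set (Δ → ℤ)) : L →ₗ[ℂ] L :=
  D.J.constr ℂ fun c => if D.deg c ∈ A then D.J c else 0

open scoped Classical in
lemma projDeg_J (A : Set (Δ → ℤ)) (c : Gen I Θ) :
    D.projDeg A (D.J c) = if D.deg c ∈ A then D.J c else 0 := by
  rw [projDeg, D.J.constr_basis]

open scoped Classical in
lemma repr_projDeg (A : Set (Δ → ℤ)) (y : L) (c : Gen I Θ) :
    D.J.repr (D.projDeg A y) c = if D.deg c ∈ A then D.J.repr y c else 0 := by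
  have h : (Finsupp.lapply c ∘ₗ D.J.repr.toLinearMap ∘ₗ D.projDeg A : L →ₗ[ℂ] ℂ) =
      if D.deg c ∈ A then Finsupp.lapply c ∘ₗ D.J.repr.toLinearMap else 0 := by
    refine D.J.ext fun d => ?_
    simp only [LinearMap.comp_apply, projDeg_J, LinearEquiv.coe_coe]
    by_cases hcd : d = c
    · subst hcd
      split_ifs <;> simp
    · split_ifs <;> simp [hcd]
  have := LinearMap.congr_fun h y
  split_ifs at this ⊢ <;> exact this

lemma projDeg_mem (A : Set (Δ → ℤ)) (y : L) : D.projDeg A y ∈ D.gradedPart A := by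
  classical
  intro c hc
  rw [repr_projDeg] at hc
  by_contra h
  exact hc (if_neg h)

lemma sub_projDeg_mem {A B : Set (Δ → ℤ)} (h : ∀ c, D.deg c ∉ A → D.deg c ∈ B) (y : L) :
    y - D.projDeg A y ∈ D.gradedPart B := by
  classical
  intro c hc
  apply h
  intro hA
  rw [map_sub, Finsupp.sub_apply, repr_projDeg, if_pos hA, sub_self] at hc
  exact hc rfl

lemma projDeg_eq_self {A : Set (Δ → ℤ)} {y : L} (h : y ∈ D.gradedPart A) :
    D.projDeg A y = y := by
  classical
  apply D.J.repr.injective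
  ext c
  rw [repr_projDeg]
  split_ifs with hA
  · rfl
  · by_contra hne
    exact hA (h c (Ne.symm hne))

lemma projDeg_eq_zero {A B : Set (Δ → ℤ)} (hAB : ∀ a ∈ B, a ∉ A) {y : L}
    (h : y ∈ D.gradedPart B) : D.projDeg A y = 0 := by
  classical
  apply D.J.repr.injective
  ext c
  rw [repr_projDeg, map_zero, Finsupp.zero_apply]
  split_ifs with hA
  · by_contra hne
    exact hAB _ (h c hne) hA
  · rfl

/-- the projection on the span of the raising generators -/
abbrev projPos : L →ₗ[ℂ] L := D.projDeg {d | 0 < d}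

/-- the projection on the span of the lowering generators -/
abbrev projNeg : L →ₗ[ℂ] L := D.projDeg {d | d < 0}

/-- the span of the raising generators -/
abbrev posPart : Submodule ℂ L := D.gradedPart {d | 0 < d}

/-- the span of the lowering generators -/
abbrev negPart : Submodule ℂ L := D.gradedPart {d | d < 0}

/-- the span of the Cartan and the lowering generators -/
abbrev nonposPart : Submodule ℂ L := D.gradedPart {d | d ≤ 0}

/-- the span of the Cartan generators -/
abbrev zeroPart : Submodule ℂ L := D.gradedPart {0}

lemma lie_posPart : ∀ y ∈ D.posPart, ∀ y' ∈ D.posPart, ⁅y, y'⁆ ∈ D.posPart :=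
  D.lie_mem_gradedPart fun _ ha _ hb =>
    Set.mem_ofPred.2 (add_pos (Set.mem_ofPred.1 ha) (Set.mem_ofPred.1 hb))

lemma lie_nonposPart : ∀ y ∈ D.nonposPart, ∀ y' ∈ D.nonposPart, ⁅y, y'⁆ ∈ D.nonposPart :=
  D.lie_mem_gradedPart fun _ ha _ hb =>
    Set.mem_ofPred.2 (add_nonpos (Set.mem_ofPred.1 ha) (Set.mem_ofPred.1 hb))

lemma lie_negPart_nonposPart : ∀ y ∈ D.negPart, ∀ y' ∈ D.nonposPart, ⁅y, y'⁆ ∈ D.negPart :=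
  D.lie_mem_gradedPart fun _ ha _ hb =>
    Set.mem_ofPred.2 (add_neg_of_neg_of_nonpos (Set.mem_ofPred.1 ha) (Set.mem_ofPred.1 hb))

lemma lie_negPart : ∀ y ∈ D.negPart, ∀ y' ∈ D.negPart, ⁅y, y'⁆ ∈ D.negPart :=
  D.lie_mem_gradedPart fun _ ha _ hb =>
    Set.mem_ofPred.2 (add_neg (Set.mem_ofPred.1 ha) (Set.mem_ofPred.1 hb))

lemma negPart_le_nonposPart : D.negPart ≤ D.nonposPart := 
  D.gradedPart_mono fun _ h => Set.mem_ofPred.2 (Set.mem_ofPred.1 h).le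

lemma sub_projPos_mem (y : L) : y - D.projPos y ∈ D.nonposPart :=
  D.sub_projDeg_mem (A := {d | 0 < d}) (B := {d | d ≤ 0})
    (fun c h => Set.mem_ofPred.2 ((D.not_deg_pos_iff c).1 h)) y

lemma projPos_eq_zero {y : L} (h : y ∈ D.nonposPart) : D.projPos y = 0 :=
  D.projDeg_eq_zero (A := {d | 0 < d}) (B := {d | d ≤ 0})
    (fun _ ha ha' => not_lt_of_ge (Set.mem_ofPred.1 ha) (Set.mem_ofPred.1 ha')) h

lemma sub_projNeg_mem {y : L} (h : y ∈ D.nonposPart) : y - D.projNeg y ∈ D.zeroPart := by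
  classical
  intro c hc
  rw [map_sub, Finsupp.sub_apply, repr_projDeg] at hc
  split_ifs at hc with hn
  · simp at hc
  · rw [sub_zero] at hc
    exact ((D.deg_le_zero_iff c).1 (h c hc)).resolve_left hn

/-! ## Functionals on the Cartan subalgebra -/

section Functional

variable {D} {b : L →ₗ[ℂ] ℂ}

lemma IsCartanFunctional.apply_J_eq_zero (hb : D.IsCartanFunctional b) {c : Gen I Θ}
    (h : D.deg c ≠ 0) : b (D.J c) = 0 := by
  rcases c with i | k | i
  · exact (hb i).1
  · exact absurd rfl h
  · exact (hb i).2

lemma IsCartanFunctional.apply_eq_zero (hb : D.IsCartanFunctional b) {A : Set (Δ → ℤ)}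
    (hA : 0 ∉ A) {y : L} (hy : y ∈ D.gradedPart A) : b y = 0 := by
  rw [← D.J.linearCombination_repr y, Finsupp.linearCombination_apply, Finsupp.sum, map_sum]
  refine Finset.sum_eq_zero fun c hc => ?_
  rw [map_smul, hb.apply_J_eq_zero, smul_zero]
  intro h0
  exact hA (h0 ▸ hy c (Finsupp.mem_support_iff.1 hc))

/-- Infinitesimally, the Cartan subgroup stabilizes `b`. A Cartan element preserves degrees, so a
bracket with a generator of nonzero degree is invisible to `b`; a bracket with a Cartan generator is
zero. -/
lemma IsCartanFunctional.apply_lie_zeroPart (hb : D.IsCartanFunctional b) {y : L}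
    (hy : y ∈ D.zeroPart) (y' : L) : b ⁅y, y'⁆ = 0 := by
  have hJ : ∀ c, b ⁅y, D.J c⁆ = 0 := by
    intro c
    by_cases hc : D.deg c = 0
    · have hc' : D.J c ∈ D.zeroPart := D.J_mem_gradedPart hc
      rcases c with i | k | i
      · exact absurd hc (D.deg_raise_pos i).ne'
      · rw [← lie_skew, ← D.J.linearCombination_repr y, Finsupp.linearCombination_apply,
          Finsupp.sum, lie_sum, map_neg, map_sum, Finset.sum_eq_zero, neg_zero]
        intro d hd
        have hd0 := hy d (Finsupp.mem_support_iff.1 hd)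
        rcases d with j | h | j
        · exact absurd hd0 (D.deg_raise_pos j).ne'
        · rw [lie_smul, D.cartan_comm, smul_zero, map_zero]
        · exact absurd hd0 (D.deg_lower_neg j).ne
      · exact absurd hc (D.deg_lower_neg i).ne
    · refine hb.apply_eq_zero (A := {D.deg c}) (fun h => hc h.symm) ?_
      refine D.lie_mem_gradedPart ?_ y hy _ (D.J_mem_gradedPart (A := {D.deg c}) rfl)
      rintro a rfl d rfl
      exact zero_add _
  have : b ∘ₗ (ad ℂ L y : L →ₗ[ℂ] L) = 0 := D.J.ext fun c => by
    simpa using hJ c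
  exact LinearMap.congr_fun this y'

lemma IsCartanFunctional.apply_lie_posPart (hb : D.IsCartanFunctional b) {y y' : L}
    (hy : y ∈ D.posPart) (hy' : y' ∈ D.posPart) : b ⁅y, y'⁆ = 0 :=
  hb.apply_eq_zero (A := {d | 0 < d}) (fun h => lt_irrefl _ (Set.mem_ofPred.1 h)) (D.lie_posPart y hy y' hy')

/-- `b` restricts to a character of the Borel subalgebra: brackets of its elements are of negative
degree, apart from those with Cartan elements, which `b` does not see. -/
lemma IsCartanFunctional.apply_lie_nonposPart (hb : D.IsCartanFunctional b) {y y' : L}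
    (hy : y ∈ D.nonposPart) (hy' : y' ∈ D.nonposPart) : b ⁅y, y'⁆ = 0 := by
  rw [← add_sub_cancel (D.projNeg y) y, add_lie, map_add,
    hb.apply_lie_zeroPart (D.sub_projNeg_mem hy), add_zero]
  exact hb.apply_eq_zero (A := {d | d < 0}) (fun h => lt_irrefl _ (Set.mem_ofPred.1 h))
    (D.lie_negPart_nonposPart _ (D.projDeg_mem _ y) y' hy')

end Functional

end RootDecomposition

end CoadjointOrbit

end



noncomputable section

namespace CoadjointOrbit

set_option linter.unusedSectionVars false

open Finset hiding antidiagonal mem_antidiagonal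

open Finset.HasAntidiagonal

open LieAlgebra (ad)

open VecPS

namespace RootDecomposition

universe u v w x

variable {L : Type u} [LieRing L] [LieAlgebra ℂ L] {Δ : Type v} [DecidableEq Δ]
  {I : Type w} {Θ : Type x} (D : RootDecomposition L Δ I Θ)

/-! ## The vector fields of the action on the formal chart -/

/-- the generators that correspond to the coordinates of the chart -/
def chartGen : I ⊕ I → Gen I Θ := Sum.elim Gen.raise Gen.lower

lemma chartGen_injective : Function.Injective (chartGen : I ⊕ I → Gen I Θ) := by
  rintro (i | i) (j | j) h
  · rw [Sum.inl_injective h]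
  · exact absurd h (by simp [chartGen])
  · exact absurd h (by simp [chartGen])
  · rw [Sum.inr_injective (Sum.inr_injective h)]

/-- the components of an element along the raising and the lowering generators -/
def chartCoord : L →ₗ[ℂ] (I ⊕ I →₀ ℂ) :=
  Finsupp.lcomapDomain chartGen chartGen_injective ∘ₗ D.J.repr.toLinearMap

lemma chartCoord_apply (y : L) (j : I ⊕ I) :
    D.chartCoord y j = D.J.repr y (chartGen j) := rfl

lemma linearCombination_zGen (y : L) :
    Finsupp.linearCombination ℂ D.zGen (D.chartCoord y) = D.projPos y := by
  classical
  have : Finsupp.linearCombination ℂ D.zGen ∘ₗ D.chartCoord = D.projPos := by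
    refine D.J.ext fun c => ?_
    rw [LinearMap.comp_apply, projDeg_J]
    rcases c with i | h | i
    · have : D.chartCoord (D.J (Sum.inl i)) = Finsupp.single (Sum.inl i) 1 := by
        ext (j | j) <;> simp [chartCoord_apply, chartGen, Finsupp.single_apply]
      rw [this, if_pos (Set.mem_ofPred.2 (D.deg_raise_pos i)), Finsupp.linearCombination_single,
        one_smul]
      rfl
    · have : D.chartCoord (D.J (Sum.inr (Sum.inl h))) = 0 := by
        ext (j | j) <;> simp [chartCoord_apply, chartGen]
      rw [this, map_zero, if_neg]
      exact fun h => lt_irrefl _ (Set.mem_ofPred.1 h)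
    · have : D.chartCoord (D.J (Sum.inr (Sum.inr i))) = Finsupp.single (Sum.inr i) 1 := by
        ext (j | j) <;> simp [chartCoord_apply, chartGen, Finsupp.single_apply]
      rw [this, if_neg, Finsupp.linearCombination_single, one_smul]
      · rfl
      · exact fun h => lt_asymm (Set.mem_ofPred.1 h) (D.deg_lower_neg i)
  exact LinearMap.congr_fun this y

lemma linearCombination_aGen (y : L) :
    Finsupp.linearCombination ℂ D.aGen (D.chartCoord y) = D.projNeg y := by
  classical
  have : Finsupp.linearCombination ℂ D.aGen ∘ₗ D.chartCoord = D.projNeg := by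
    refine D.J.ext fun c => ?_
    rw [LinearMap.comp_apply, projDeg_J]
    rcases c with i | h | i
    · have : D.chartCoord (D.J (Sum.inl i)) = Finsupp.single (Sum.inl i) 1 := by
        ext (j | j) <;> simp [chartCoord_apply, chartGen, Finsupp.single_apply]
      rw [this, if_neg, Finsupp.linearCombination_single, one_smul]
      · rfl
      · exact fun h => lt_asymm (Set.mem_ofPred.1 h) (D.deg_raise_pos i)
    · have : D.chartCoord (D.J (Sum.inr (Sum.inl h))) = 0 := by
        ext (j | j) <;> simp [chartCoord_apply, chartGen]
      rw [this, map_zero, if_neg]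
      exact fun h => lt_irrefl _ (Set.mem_ofPred.1 h)
    · have : D.chartCoord (D.J (Sum.inr (Sum.inr i))) = Finsupp.single (Sum.inr i) 1 := by
        ext (j | j) <;> simp [chartCoord_apply, chartGen, Finsupp.single_apply]
      rw [this, if_pos (show D.deg (Gen.lower i) ∈ {d | d < 0} from
        Set.mem_ofPred.2 (D.deg_lower_neg i)), Finsupp.linearCombination_single,
        one_smul]
      rfl
  exact LinearMap.congr_fun this y

lemma zSer_mem_coeffIn : D.zSer ∈ coeffIn D.posPart := by
  refine linear_mem_coeffIn ?_
  rintro (i | i)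
  · exact D.J_mem_gradedPart (Set.mem_ofPred.2 (D.deg_raise_pos i))
  · exact Submodule.zero_mem _

lemma aSer_mem_coeffIn : D.aSer ∈ coeffIn D.negPart := by
  refine linear_mem_coeffIn ?_
  rintro (i | i)
  · exact Submodule.zero_mem _
  · exact D.J_mem_gradedPart (Set.mem_ofPred.2 (D.deg_lower_neg i))

variable [DecidableEq I]

/-- `e^{-ad Z} y` -/
def eSer (y : L) : VecPS (I ⊕ I) L := expAd D.zSer (const y)

/-- the positive part of `e^{-ad Z} y` -/
def nSer (y : L) : VecPS (I ⊕ I) L := mapCoeff D.projPos (D.eSer y)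

/-- the part of `e^{-ad Z} y` in the Borel subalgebra -/
def wSer (y : L) : VecPS (I ⊕ I) L := D.eSer y - D.nSer y

/-- the displacement of `Z` by the action of `y` -/
def vSer (y : L) : VecPS (I ⊕ I) L := berAd D.zSer (D.nSer y)

/-- the displacement of `A` by the action of `y` -/
def uSer (y : L) : VecPS (I ⊕ I) L :=
  berAd D.aSer (mapCoeff D.projNeg (expAd D.aSer (D.wSer y)))

/-- the vector field of the action of `y` on the formal chart -/
def actionField (y : L) : VecPS (I ⊕ I) (I ⊕ I →₀ ℂ) :=
  mapCoeff D.chartCoord (D.vSer y + D.uSer y)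

lemma eSer_lie (y y' : L) : D.eSer ⁅y, y'⁆ = ⁅D.eSer y, D.eSer y'⁆ := by
  rw [eSer, ← const_lie_const, expAd_lie D.zSer_mem]
  rfl

lemma nSer_mem (y : L) : D.nSer y ∈ coeffIn D.posPart := fun _ => D.projDeg_mem _ _

lemma wSer_mem (y : L) : D.wSer y ∈ coeffIn D.nonposPart := fun _ => D.sub_projPos_mem _

lemma vSer_mem (y : L) : D.vSer y ∈ coeffIn D.posPart :=
  adSeries_mem_coeffIn _ D.lie_posPart D.zSer_mem_coeffIn (D.nSer_mem y)

lemma uSer_mem (y : L) : D.uSer y ∈ coeffIn D.negPart :=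
  adSeries_mem_coeffIn _ D.lie_negPart D.aSer_mem_coeffIn fun _ => D.projDeg_mem _ _

lemma expAd_aSer_mem {F : VecPS (I ⊕ I) L} (hF : F ∈ coeffIn D.nonposPart) :
    expAd D.aSer F ∈ coeffIn D.nonposPart :=
  adSeries_mem_coeffIn _
    (fun y hy y' hy' => D.lie_nonposPart y (D.negPart_le_nonposPart hy) y' hy')
    D.aSer_mem_coeffIn hF

lemma mapCoeff_projPos_eq_self {F : VecPS (I ⊕ I) L} (hF : F ∈ coeffIn D.posPart) :
    mapCoeff D.projPos F = F := by
  ext m; exact D.projDeg_eq_self (hF m)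

lemma mapCoeff_projNeg_eq_self {F : VecPS (I ⊕ I) L} (hF : F ∈ coeffIn D.negPart) :
    mapCoeff D.projNeg F = F := by
  ext m; exact D.projDeg_eq_self (hF m)

lemma mapCoeff_projPos_eq_zero {F : VecPS (I ⊕ I) L} (hF : F ∈ coeffIn D.nonposPart) :
    mapCoeff D.projPos F = 0 := by
  ext m; exact D.projPos_eq_zero (hF m)

lemma mapCoeff_projNeg_eq_zero {F : VecPS (I ⊕ I) L} (hF : F ∈ coeffIn D.posPart) :
    mapCoeff D.projNeg F = 0 := by
  ext m
  exact D.projDeg_eq_zero (A := {d | d < 0}) (B := {d | 0 < d})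
    (fun _ ha ha' => lt_asymm (Set.mem_ofPred.1 ha) (Set.mem_ofPred.1 ha')) (hF m)

lemma fieldDeriv_actionField_zSer (y : L) :
    fieldDeriv (D.actionField y) D.zSer = D.vSer y := by
  have h : fieldDeriv (D.actionField y) D.zSer = mapCoeff D.projPos (D.vSer y + D.uSer y) := by
    rw [zSer, fieldDeriv_linear]
    ext m
    exact D.linearCombination_zGen _
  rw [h, map_add, D.mapCoeff_projPos_eq_self (D.vSer_mem y),
    D.mapCoeff_projPos_eq_zero fun m => D.negPart_le_nonposPart (D.uSer_mem y m), add_zero]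

lemma fieldDeriv_actionField_aSer (y : L) :
    fieldDeriv (D.actionField y) D.aSer = D.uSer y := by
  have h : fieldDeriv (D.actionField y) D.aSer = mapCoeff D.projNeg (D.vSer y + D.uSer y) := by
    rw [aSer, fieldDeriv_linear]
    ext m
    exact D.linearCombination_aGen _
  rw [h, map_add, D.mapCoeff_projNeg_eq_self (D.uSer_mem y),
    D.mapCoeff_projNeg_eq_zero (D.vSer_mem y), zero_add]

lemma dexpAd_vSer (y : L) : dexpAd D.zSer (D.vSer y) = D.nSer y := dexpAd_berAd D.zSer_mem _

lemma dexpAd_uSer (y : L) :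
    dexpAd D.aSer (D.uSer y) = mapCoeff D.projNeg (expAd D.aSer (D.wSer y)) :=
  dexpAd_berAd D.aSer_mem _

/-- The part of `y` that moves neither `Z` nor `A`: an infinitesimal right multiplication by the
Cartan subgroup, which fixes `b`. -/
lemma expAd_wSer_sub_mem (y : L) :
    expAd D.aSer (D.wSer y) - mapCoeff D.projNeg (expAd D.aSer (D.wSer y)) ∈
      coeffIn D.zeroPart :=
  fun m => D.sub_projNeg_mem (D.expAd_aSer_mem (D.wSer_mem y) m)

lemma eSer_eq_add (y : L) : D.eSer y = D.nSer y + D.wSer y := by rw [wSer]; abel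

/-- By the choice of `vSer`, the logarithmic derivative of `e^Z` along the action of `y` is `nSer
y`. -/
lemma fieldDeriv_eSer (y y' : L) :
    fieldDeriv (D.actionField y) (D.eSer y') = -⁅D.nSer y, D.eSer y'⁆ := by
  rw [eSer, derivation_expAd (isFieldDerivation_fieldDeriv _) D.zSer_mem, fieldDeriv_const,
    map_zero, zero_sub, fieldDeriv_actionField_zSer, dexpAd_vSer]

/-- the two ways of writing the bracket of `e^{-ad Z} y` and `e^{-ad Z} y'` -/
lemma lie_nSer_add (y y' : L) :
    ⁅D.nSer y, D.eSer y'⁆ - ⁅D.nSer y', D.eSer y⁆ =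
      D.eSer ⁅y, y'⁆ + ⁅D.nSer y, D.nSer y'⁆ - ⁅D.wSer y, D.wSer y'⁆ := by
  rw [eSer_lie, D.eSer_eq_add y, D.eSer_eq_add y']
  simp only [lie_add, add_lie]
  rw [← lie_skew (D.nSer y') (D.nSer y), ← lie_skew (D.nSer y') (D.wSer y)]
  abel

/-- The commutator of the vector fields of the action, on the coordinates `z`. -/
lemma fieldDeriv_vSer (y y' : L) :
    fieldDeriv (D.actionField y) (D.vSer y') - fieldDeriv (D.actionField y') (D.vSer y) =
      -D.vSer ⁅y, y'⁆ := by
  have h := derivation_dexpAd_maurerCartan (isFieldDerivation_fieldDeriv (D.actionField y))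
    (isFieldDerivation_fieldDeriv (D.actionField y')) D.zSer_mem
  rw [fieldDeriv_actionField_zSer, fieldDeriv_actionField_zSer, dexpAd_vSer, dexpAd_vSer] at h
  have hN : ∀ y y', fieldDeriv (D.actionField y) (D.nSer y') =
      -mapCoeff D.projPos ⁅D.nSer y, D.eSer y'⁆ := by
    intro y y'
    rw [nSer, ← mapCoeff_fieldDeriv, fieldDeriv_eSer, map_neg]
  apply dexpAd_injective D.zSer_mem
  -- Under the positive projection the bracket of the Borel parts disappears, since these form a
  -- subalgebra. The bracket of the positive parts cancels against the Maurer–Cartan term.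
  have h2 := congrArg (mapCoeff D.projPos) (D.lie_nSer_add y y')
  rw [map_sub, map_sub, map_add, D.mapCoeff_projPos_eq_self
    (lie_mem_coeffIn D.lie_posPart (D.nSer_mem y) (D.nSer_mem y')),
    D.mapCoeff_projPos_eq_zero (lie_mem_coeffIn D.lie_nonposPart (D.wSer_mem y) (D.wSer_mem y')),
    sub_zero] at h2
  rw [hN, hN, neg_sub_neg, ← neg_sub, h2] at h
  rw [map_neg, dexpAd_vSer, sub_eq_iff_eq_add.1 h.symm, nSer]
  abel

/-! ## The functions `f_y` and `Φ_y` -/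

/-- `⟨b, e^{-ad Z} y⟩` -/
def bSer (b : L →ₗ[ℂ] ℂ) (y : L) : VecPS (I ⊕ I) ℂ := mapCoeff b (D.eSer y)

/-- `⟨b, e^{-ad A} e^{-ad Z} y⟩` -/
def momentSer (b : L →ₗ[ℂ] ℂ) (y : L) : VecPS (I ⊕ I) ℂ :=
  mapCoeff b (expAd D.aSer (D.eSer y))

section Functional

variable {D} {b : L →ₗ[ℂ] ℂ}

/-- The cocycle identity: of the three terms in `lie_nSer_add`, `b` annihilates the bracket of the
positive parts and the bracket of the Borel parts. -/
lemma IsCartanFunctional.fieldDeriv_bSer_sub (hb : D.IsCartanFunctional b) (y y' : L) :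
    fieldDeriv (D.actionField y) (D.bSer b y') - fieldDeriv (D.actionField y') (D.bSer b y) =
      -D.bSer b ⁅y, y'⁆ := by
  have h2 := congrArg (mapCoeff b) (D.lie_nSer_add y y')
  have hn : mapCoeff b ⁅D.nSer y, D.nSer y'⁆ = 0 := by
    ext m
    rw [mapCoeff_apply, lie_apply, map_sum]
    exact Finset.sum_eq_zero fun p _ => hb.apply_lie_posPart (D.nSer_mem y _) (D.nSer_mem y' _)
  have hw : mapCoeff b ⁅D.wSer y, D.wSer y'⁆ = 0 := by
    ext m
    rw [mapCoeff_apply, lie_apply, map_sum]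
    exact Finset.sum_eq_zero fun p _ => hb.apply_lie_nonposPart (D.wSer_mem y _) (D.wSer_mem y' _)
  rw [map_sub, map_sub, map_add, hn, hw, sub_zero, add_zero] at h2
  rw [bSer, bSer, bSer, ← mapCoeff_fieldDeriv, ← mapCoeff_fieldDeriv, fieldDeriv_eSer,
    fieldDeriv_eSer, map_neg, map_neg, neg_sub_neg, ← neg_sub, h2]

/-- Equivariance of the moment map. The logarithmic derivative of `g = e^Z e^A` is `Ad_{g⁻¹} y` up
to a Cartan element, and brackets with the latter are annihilated by `b`. -/
lemma IsCartanFunctional.fieldDeriv_momentSer (hb : D.IsCartanFunctional b) (y y' : L) :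
    fieldDeriv (D.actionField y) (D.momentSer b y') = -D.momentSer b ⁅y, y'⁆ := by
  rw [momentSer, momentSer, ← mapCoeff_fieldDeriv, derivation_expAd
    (isFieldDerivation_fieldDeriv _) D.aSer_mem, fieldDeriv_eSer, fieldDeriv_actionField_aSer,
    dexpAd_uSer, map_neg, expAd_lie D.aSer_mem, eSer_lie, expAd_lie D.aSer_mem]
  set Y := expAd D.aSer (D.eSer y') with hY
  have h0 : mapCoeff b ⁅expAd D.aSer (D.wSer y) -
      mapCoeff D.projNeg (expAd D.aSer (D.wSer y)), Y⁆ = 0 := by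
    ext m
    rw [mapCoeff_apply, lie_apply, map_sum]
    exact Finset.sum_eq_zero fun p _ => hb.apply_lie_zeroPart (D.expAd_wSer_sub_mem y _) _
  rw [sub_lie, map_sub, sub_eq_zero] at h0
  rw [map_sub, map_neg, ← h0, D.eSer_eq_add y, map_add, add_lie, map_add]
  abel

/-- `b` does not see the positive part, and on the Borel part `e^{-ad A}` only adds terms of
negative degree. So the dependence on `A` is spurious, and `f_y` is holomorphic. -/
lemma IsCartanFunctional.bSer_eq (hb : D.IsCartanFunctional b) (y : L) :
    D.bSer b y = mapCoeff b (expAd D.aSer (D.wSer y)) := by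
  have h1 : mapCoeff b (D.nSer y) = 0 := by
    ext m
    exact hb.apply_eq_zero (A := {d | 0 < d}) (fun h => lt_irrefl _ (Set.mem_ofPred.1 h))
      (D.nSer_mem y m)
  have h2 : mapCoeff b (expAd D.aSer (D.wSer y)) = mapCoeff b (D.wSer y) := by
    ext m
    rw [mapCoeff_apply, adSeries_apply, Finset.sum_range_succ', map_add, map_sum,
      Finset.sum_eq_zero, zero_add, expNeg_zero, one_smul, pow_zero, Module.End.one_apply,
      mapCoeff_apply]
    intro k _
    have hk : ((ad ℂ _ D.aSer) ^ k) (D.wSer y) ∈ coeffIn D.nonposPart := by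
      induction k with
      | zero => exact D.wSer_mem y
      | succ k ih =>
        rw [pow_succ', Module.End.mul_apply, LieAlgebra.ad_apply]
        exact lie_mem_coeffIn D.lie_nonposPart
          (fun m => D.negPart_le_nonposPart (D.aSer_mem_coeffIn m)) (ih (by simp_all; omega))
    rw [pow_succ', Module.End.mul_apply, LieAlgebra.ad_apply, map_smul,
      hb.apply_eq_zero (A := {d | d < 0}) (fun h => lt_irrefl _ (Set.mem_ofPred.1 h))
        (lie_mem_coeffIn D.lie_negPart_nonposPart D.aSer_mem_coeffIn hk m), smul_zero]
  rw [h2, bSer, eSer_eq_add, map_add, h1, zero_add]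

end Functional

lemma isFormalActionField_actionField (y : L) :
    D.IsFormalActionField y (toField (D.actionField y)) := by
  have h : ∀ c, D.deg c ≠ 0 → D.formalMaurerCartan (toField (D.actionField y)) c =
      D.formalAdInv y c := by
    intro c hc
    rw [formalMaurerCartan_toField, formalAdInv_eq, fieldDeriv_actionField_zSer,
      fieldDeriv_actionField_aSer, dexpAd_vSer, dexpAd_uSer]
    change D.components _ c = D.components (expAd D.aSer (D.eSer y)) c
    rw [eSer_eq_add, map_add]
    funext m
    have h0 := D.expAd_wSer_sub_mem y m c
    rw [VecPS.sub_apply, map_sub, Finsupp.sub_apply] at h0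
    have h1 := sub_eq_zero.1 (not_not.1 (mt h0 hc))
    change D.J.repr (_ + _) c = D.J.repr (_ + _) c
    rw [map_add, map_add, Finsupp.add_apply, Finsupp.add_apply, h1]
  exact fun i => ⟨h _ (D.deg_raise_pos i).ne', h _ (D.deg_lower_neg i).ne⟩

lemma formalPhi_eq [Finite Θ] {b : L →ₗ[ℂ] ℂ} (hb : D.IsCartanFunctional b) (y : L) :
    D.formalPhi b y = -toMv (D.momentSer b y) := by
  have := Fintype.ofFinite Θ
  rw [formalPhi, finsum_eq_sum_of_fintype, formalAdInv_eq]
  congr 1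
  ext n
  rw [map_sum, coeff_toMv]
  have hx : ∀ x : L, b x = ∑ h : Θ, b (D.J (Gen.cartan h)) * D.J.repr x (Gen.cartan h) := by
    classical
    have : b = ∑ h : Θ, b (D.J (Gen.cartan h)) •
        (Finsupp.lapply (Gen.cartan h) ∘ₗ D.J.repr.toLinearMap) := by
      refine D.J.ext fun c => ?_
      rw [LinearMap.sum_apply]
      simp only [LinearMap.smul_apply, LinearMap.comp_apply, LinearEquiv.coe_coe,
        Module.Basis.repr_self, Finsupp.lapply_apply, smul_eq_mul]
      rcases c with i | k | i
      · rw [(hb i).1, Finset.sum_eq_zero]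
        intro h _; simp
      · rw [Finset.sum_eq_single k]
        · simp
        · intro h _ hk
          rw [Finsupp.single_apply, if_neg, mul_zero]
          simpa using hk.symm
        · simp
      · rw [(hb i).2, Finset.sum_eq_zero]
        intro h _; simp
    intro x
    conv_lhs => rw [this]
    simp
  rw [momentSer, mapCoeff_apply, hx]
  refine Finset.sum_congr rfl fun h _ => ?_
  rw [MvPowerSeries.coeff_C_mul]
  rfl

end RootDecomposition

end CoadjointOrbit

end



noncomputable section

namespace CoadjointOrbit

set_option linter.unusedSectionVars false

open Finset hiding antidiagonal mem_antidiagonal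

open Finset.HasAntidiagonal

open LieAlgebra (ad)

open VecPS

namespace RootDecomposition

universe u v w x

/-! ## Sums over sequences of positive generators -/

section Lists

variable {I : Type w}

/-- the monomial `z_{a_1} ⋯ z_{a_k}` that belongs to a list -/
def listType (l : List I) : I ⊕ I →₀ ℕ := (l.map fun i => Finsupp.single (Sum.inl i) 1).sum

lemma listType_nil : listType ([] : List I) = 0 := rfl

lemma listType_cons (i : I) (l : List I) :
    listType (i :: l) = Finsupp.single (Sum.inl i) 1 + listType l := by simp [listType]

lemma listType_concat (l : List I) (i : I) :
    listType (l ++ [i]) = listType l + Finsupp.single (Sum.inl i) 1 := by simp [listType]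

lemma degree_listType (l : List I) : (listType l).degree = l.length := by
  induction l with
  | nil => simp [listType]
  | cons i l ih => rw [listType_cons, map_add, ih, Finsupp.degree_single, List.length_cons,
      add_comm]

/-- The words that belong to a monomial are the orderings of a single multiset. -/
lemma finite_listType_eq (m : I ⊕ I →₀ ℕ) : {l : List I | listType l = m}.Finite := by
  classical
  have hm : ∀ l : List I, Finsupp.toMultiset (listType l) = ((l.map Sum.inl : List (I ⊕ I)) :
      Multiset (I ⊕ I)) := by
    intro l
    induction l with
    | nil => simp [listType]
    | cons i l ih =>
      rw [listType_cons, map_add, ih, Finsupp.toMultiset_single]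
      simp
  refine Set.Finite.of_finite_image (f := List.map (Sum.inl : I → I ⊕ I)) ?_
    (List.map_injective_iff.2 Sum.inl_injective).injOn
  refine ((Finsupp.toMultiset m).lists.finite_toSet).subset ?_
  rintro _ ⟨l, rfl, rfl⟩
  simp [hm]

/-- the lists that belong to a monomial -/
def listsOf (m : I ⊕ I →₀ ℕ) : Finset (List I) := (finite_listType_eq m).toFinset

lemma mem_listsOf {m : I ⊕ I →₀ ℕ} {l : List I} : l ∈ listsOf m ↔ listType l = m := by
  simp [listsOf]

lemma length_of_mem_listsOf {m : I ⊕ I →₀ ℕ} {l : List I} (h : l ∈ listsOf m) :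
    l.length = m.degree := by
  rw [← mem_listsOf.1 h, degree_listType]

lemma finite_lists_of_mem {S : Set I} (hS : S.Finite) (n : ℕ) :
    {l : List I | l.length ≤ n ∧ ∀ i ∈ l, i ∈ S}.Finite := by
  induction n with
  | zero =>
    refine (Set.finite_singleton []).subset ?_
    rintro l ⟨h, -⟩
    simpa using h
  | succ n ih =>
    refine ((Set.finite_singleton []).union (Set.Finite.image2 List.cons hS ih)).subset ?_
    rintro (_ | ⟨i, l⟩) ⟨h, h'⟩
    · exact Or.inl rfl
    · refine Or.inr ⟨i, h' i (by simp), l, ⟨by simpa using h, fun j hj => h' j (by simp [hj])⟩, rfl⟩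

/-- the polynomial `∑ g(a_1, …, a_k) z_{a_1} ⋯ z_{a_k}` -/
def listPoly (g : List I → ℂ) : MvPolynomial I ℂ :=
  ∑ᶠ l : List I, MvPolynomial.C (g l) * (l.map MvPolynomial.X).prod

/-- `ofPoly` as a homomorphism of algebras -/
def ofPolyHom : MvPolynomial I ℂ →ₐ[ℂ] FormalFun I :=
  (MvPolynomial.coeToMvPowerSeries.algHom ℂ).comp (MvPolynomial.rename Sum.inl)

lemma ofPolyHom_apply (p : MvPolynomial I ℂ) : ofPolyHom p = ofPoly p := by
  change MvPowerSeries.map (algebraMap ℂ ℂ) (ofPoly p) = ofPoly p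
  simp

lemma ofPoly_injective : Function.Injective (ofPoly (I := I)) := fun _ _ h =>
  MvPolynomial.rename_injective _ Sum.inl_injective (MvPolynomial.coe_injective _ _ h)

lemma coeff_ofPoly_list (r : ℂ) (l : List I) (m : I ⊕ I →₀ ℕ) [Decidable (listType l = m)] :
    MvPowerSeries.coeff m (ofPoly (MvPolynomial.C r * (l.map MvPolynomial.X).prod)) =
      if listType l = m then r else 0 := by
  classical
  have : MvPolynomial.rename (Sum.inl : I → I ⊕ I)
      (MvPolynomial.C r * (l.map MvPolynomial.X).prod) = MvPolynomial.monomial (listType l) r := by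
    induction l with
    | nil => rw [List.map_nil, List.prod_nil, mul_one, MvPolynomial.rename_C, listType_nil]; rfl
    | cons i l ih =>
      rw [List.map_cons, List.prod_cons, mul_left_comm, map_mul, ih, MvPolynomial.rename_X,
        MvPolynomial.X, MvPolynomial.monomial_mul, one_mul, listType_cons]
  rw [ofPoly, this, MvPolynomial.coeff_coe, MvPolynomial.coeff_monomial]
  congr

lemma listPoly_eq_sum {g : List I → ℂ} {S : Finset (List I)} (hg : Function.support g ⊆ S) :
    listPoly g = ∑ l ∈ S, MvPolynomial.C (g l) * (l.map MvPolynomial.X).prod := by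
  refine finsum_eq_sum_of_support_subset _ fun l hl => hg fun h => hl ?_
  simp [h]

lemma coeff_ofPoly_listPoly {g : List I → ℂ} (hg : (Function.support g).Finite)
    (m : I ⊕ I →₀ ℕ) :
    MvPowerSeries.coeff m (ofPoly (listPoly g)) = ∑ l ∈ listsOf m, g l := by
  classical
  rw [listPoly_eq_sum (S := hg.toFinset) (by simp), ← ofPolyHom_apply, map_sum, map_sum]
  simp only [ofPolyHom_apply, coeff_ofPoly_list]
  rw [← Finset.sum_filter]
  refine Finset.sum_subset ?_ ?_
  · intro l hl
    exact mem_listsOf.2 (mem_filter.1 hl).2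
  · intro l hl hl'
    by_contra h
    exact hl' (mem_filter.2 ⟨by simpa using h, mem_listsOf.1 hl⟩)

end Lists

variable {L : Type u} [LieRing L] [LieAlgebra ℂ L] {Δ : Type v} [DecidableEq Δ]
  {I : Type w} {Θ : Type x} (D : RootDecomposition L Δ I Θ)

lemma iterAd_concat (l : List I) (i : I) (y : L) :
    D.iterAd (l ++ [i]) y = ⁅D.J (Gen.raise i), D.iterAd l y⁆ := by
  simp [iterAd]

lemma iterAd_append (l l' : List I) (y : L) :
    D.iterAd (l ++ l') y = D.iterAd l' (D.iterAd l y) := by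
  simp [iterAd]

lemma iterAd_mem_gradedPart {d : Δ → ℤ} {y : L} (hy : y ∈ D.gradedPart {d}) (l : List I) :
    D.iterAd l y ∈ D.gradedPart {d + (l.map D.varDeg).sum} := by
  induction l using List.reverseRecOn with
  | nil => simpa [iterAd] using hy
  | append_singleton l i ih =>
    rw [iterAd_concat]
    refine D.lie_mem_gradedPart ?_ _ (D.J_mem_gradedPart (A := {D.varDeg i}) rfl) _ ih
    rintro a rfl b rfl
    simp only [List.map_append, List.sum_append, List.map_cons, List.map_nil, List.sum_cons,
      List.sum_nil, add_zero, Set.mem_singleton_iff]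
    abel

lemma varDeg_nonneg (i : I) : 0 ≤ D.varDeg i := (D.deg_raise_pos i).le

/-- Each letter adds at least one to the height, which bounds the length, and the letters belong to
the finitely many root spaces of degree at most `d`. This is why the coefficients of `ξ_a` and the
functions `f_a` are polynomials even for infinitely many roots. -/
lemma finite_lists_sum_varDeg [Fintype Δ] (d : Δ → ℤ) :
    {l : List I | (l.map D.varDeg).sum = d}.Finite := by
  classical
  set S : Set I := {i | D.wt i ≤ fun s => (d s).toNat}
  have hS : S.Finite := by
    have : S = ⋃ m ∈ Set.Iic (fun s => (d s).toNat), {i | D.wt i = m} := by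
      ext i; simp [S]
    rw [this]
    exact (Set.finite_Iic _).biUnion fun m _ => D.finite_mult m
  refine (finite_lists_of_mem hS (∑ s, d s).toNat).subset ?_
  rintro l rfl
  refine ⟨?_, ?_⟩
  · have : (l.length : ℤ) ≤ ∑ s, (l.map D.varDeg).sum s := by
      clear hS S
      induction l with
      | nil => simp
      | cons i l ih =>
        have h1 : (1 : ℤ) ≤ ∑ s, D.varDeg i s := by
          have h0 : 0 < ∑ s, D.varDeg i s := by
            obtain ⟨hle, s, hs⟩ := Pi.lt_def.1 (D.deg_raise_pos i)
            exact Finset.sum_pos' (fun s _ => hle s) ⟨s, Finset.mem_univ s, hs⟩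
          omega
        simp only [List.map_cons, List.sum_cons, Pi.add_apply, Finset.sum_add_distrib,
          List.length_cons]
        push_cast
        linarith
    omega
  · intro i hi s
    have h1 : D.varDeg i ≤ (l.map D.varDeg).sum := by
      refine List.single_le_sum ?_ _ (List.mem_map.2 ⟨i, hi, rfl⟩)
      intro x hx
      obtain ⟨j, -, rfl⟩ := List.mem_map.1 hx
      exact D.varDeg_nonneg j
    have h2 : (D.wt i s : ℤ) ≤ (l.map D.varDeg).sum s := h1 s
    show D.wt i s ≤ ((l.map D.varDeg).sum s).toNat
    omega

lemma finite_support_iterAd [Fintype Δ] (a c : Gen I Θ) (g : List I → ℂ) :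
    (Function.support fun l => g l * D.J.repr (D.iterAd l (D.J a)) c).Finite := by
  refine (D.finite_lists_sum_varDeg (D.deg c - D.deg a)).subset ?_
  intro l hl
  have h := D.iterAd_mem_gradedPart (D.J_mem_gradedPart (A := {D.deg a}) rfl) l c
    (right_ne_zero_of_mul hl)
  rw [Set.mem_singleton_iff] at h
  change _ = _
  rw [h]
  abel

variable [DecidableEq I]

/-- Bracketing with `∑ z_i J_i` appends a letter to every word. The empty word does not arise in
this way, whence the condition on `G' []`. -/
lemma zSer_lie_eq_sum {G G' : List I → L} (h0 : G' [] = 0)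
    (h1 : ∀ l i, G' (l ++ [i]) = ⁅D.J (Gen.raise i), G l⁆) {F : VecPS (I ⊕ I) L}
    (hF : ∀ m, F m = ∑ l ∈ listsOf m, G l) (m : I ⊕ I →₀ ℕ) :
    ⁅D.zSer, F⁆ m = ∑ l ∈ listsOf m, G' l := by
  have hinj : Function.Injective fun x : I × List I => x.2 ++ [x.1] := by
    rintro ⟨i, l⟩ ⟨j, l'⟩ h
    obtain ⟨h1, h2⟩ := List.append_inj' h rfl
    simp at h1 h2
    rw [h1, h2]
  set T : Finset (I × List I) := (listsOf m).preimage _ hinj.injOn with hT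
  have hTm : ∀ x : I × List I, x ∈ T ↔ listType x.2 + Finsupp.single (Sum.inl x.1) 1 = m := by
    intro x
    rw [hT, mem_preimage, mem_listsOf, listType_concat]
  have e1 : ∑ x ∈ T, ⁅D.J (Gen.raise x.1), G x.2⁆ = ∑ l ∈ listsOf m, G' l := by
    refine Finset.sum_of_injOn (fun x : I × List I => x.2 ++ [x.1]) hinj.injOn ?_ ?_ ?_
    · intro x hx
      simpa [hT] using hx
    · intro l hl hl'
      rcases List.eq_nil_or_concat l with rfl | ⟨l, i, rfl⟩
      · exact h0
      · refine absurd ⟨(i, l), ?_, ?_⟩ hl'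
        · rw [mem_coe, hT, mem_preimage]; simpa using hl
        · simp
    · intro x _
      rw [h1]
  rw [← e1, zSer, linear_lie_apply]
  simp only [hF, lie_sum]
  rw [Finset.sum_sigma']
  symm
  refine Finset.sum_of_injOn (fun x => ⟨Sum.inl x.1, x.2⟩) ?_ ?_ ?_ ?_
  · rintro ⟨i, l⟩ _ ⟨j, l'⟩ _ h
    simpa using h
  · rintro ⟨i, l⟩ hx
    rw [mem_coe, hTm] at hx
    simp only [coe_sigma, Set.mem_sigma_iff, mem_coe, mem_listsOf]
    rw [← hx]
    simp
  · rintro ⟨i | i, l⟩ hx hx'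
    · simp only [mem_sigma, mem_listsOf] at hx
      refine absurd ⟨(i, l), ?_, rfl⟩ hx'
      rw [mem_coe, hTm, hx.2, tsub_add_cancel_of_le]
      rw [Finsupp.single_le_iff]
      exact Nat.one_le_iff_ne_zero.2 (Finsupp.mem_support_iff.1 hx.1)
    · simp [zGen]
  · intro x _
    rfl

lemma ad_zSer_pow_const (y : L) (k : ℕ) (m : I ⊕ I →₀ ℕ) :
    ((ad ℂ _ D.zSer) ^ k) (const y) m =
      ∑ l ∈ listsOf m, if l.length = k then D.iterAd l y else 0 := by
  induction k generalizing m with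
  | zero =>
    rw [pow_zero, Module.End.one_apply]
    rcases eq_or_ne m 0 with rfl | hm
    · rw [Finset.sum_eq_single []]
      · simp [iterAd]
      · intro l _ hl; simp [hl]
      · intro h; exact absurd (mem_listsOf.2 listType_nil) h
    · rw [const_apply_of_ne _ hm, Finset.sum_eq_zero]
      intro l hl
      rw [if_neg]
      intro h
      rw [List.length_eq_zero_iff] at h
      subst h
      exact hm (mem_listsOf.1 hl).symm
  | succ k ih =>
    rw [pow_succ', Module.End.mul_apply, LieAlgebra.ad_apply]
    refine D.zSer_lie_eq_sum (G := fun l => if l.length = k then D.iterAd l y else 0) ?_ ?_ ih m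
    · simp
    · intro l i
      simp only [List.length_append, List.length_singleton, Nat.add_right_cancel_iff,
        iterAd_concat]
      split_ifs <;> simp

/-- The linear map is inserted after the first `j` letters have acted; this is where `take` and
`drop` come from. -/
lemma ad_zSer_pow_mapCoeff (φ : L →ₗ[ℂ] L) (y : L) (i j : ℕ) (m : I ⊕ I →₀ ℕ) :
    ((ad ℂ _ D.zSer) ^ i) (mapCoeff φ (((ad ℂ _ D.zSer) ^ j) (const y))) m =
      ∑ l ∈ listsOf m, if l.length = i + j then
        D.iterAd (l.drop j) (φ (D.iterAd (l.take j) y)) else 0 := by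
  induction i generalizing m with
  | zero =>
    rw [pow_zero, Module.End.one_apply, mapCoeff_apply, ad_zSer_pow_const, map_sum]
    refine Finset.sum_congr rfl fun l _ => ?_
    rw [zero_add]
    split_ifs with h
    · rw [← h, List.drop_length, List.take_length]
      rfl
    · simp
  | succ i ih =>
    rw [pow_succ', Module.End.mul_apply, LieAlgebra.ad_apply]
    refine D.zSer_lie_eq_sum (G := fun l => if l.length = i + j then
      D.iterAd (l.drop j) (φ (D.iterAd (l.take j) y)) else 0) ?_ ?_ ih m
    · rw [if_neg (by simp only [List.length_nil]; omega)]
    · intro l k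
      have : (l ++ [k]).length = i + 1 + j ↔ l.length = i + j := by
        simp only [List.length_append, List.length_singleton]; omega
      simp only [this]
      split_ifs with h
      · rw [List.drop_append_of_le_length (by omega), List.take_append_of_le_length (by omega),
          iterAd_concat]
      · simp

lemma eSer_apply (y : L) (m : I ⊕ I →₀ ℕ) :
    D.eSer y m = ∑ l ∈ listsOf m, expNeg l.length • D.iterAd l y := by
  rw [eSer, adSeries_apply]
  simp only [ad_zSer_pow_const, Finset.smul_sum]
  rw [Finset.sum_comm]
  refine Finset.sum_congr rfl fun l hl => ?_
  rw [Finset.sum_eq_single l.length]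
  · simp
  · intro k _ hk; rw [if_neg hk.symm, smul_zero]
  · intro h
    rw [length_of_mem_listsOf hl] at h
    simp at h

/-- The first `p.2` letters of a word come from `e^{-ad Z}` and the last `p.1` from the Bernoulli
series, with the positive projection in between. -/
lemma vSer_apply (y : L) (m : I ⊕ I →₀ ℕ) :
    D.vSer y m = ∑ l ∈ listsOf m, ∑ p ∈ antidiagonal l.length, (bernoulliNeg p.1 * expNeg p.2) •
      D.iterAd (l.drop p.2) (D.projPos (D.iterAd (l.take p.2) y)) := by
  set K := m.degree + 1 with hK
  have h1 : ∀ i, ((ad ℂ _ D.zSer) ^ i) (D.nSer y) m =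
      ∑ j ∈ range K, expNeg j •
        ((ad ℂ _ D.zSer) ^ i) (mapCoeff D.projPos (((ad ℂ _ D.zSer) ^ j) (const y))) m := by
    intro i
    have h := ad_pow_mem_orderGE D.zSer_mem (mapCoeff_mem_orderGE D.projPos
      (adSeries_sub_mem expNeg D.zSer_mem (const y) K)) i
    rw [map_sub, map_sub, map_sum, map_sum] at h
    rw [nSer, eSer, apply_eq_of_sub_mem h (m := m) (by omega), VecPS.sum_apply]
    simp
  rw [vSer, adSeries_apply]
  simp only [h1, ad_zSer_pow_mapCoeff, Finset.smul_sum]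
  rw [Finset.sum_congr rfl fun i _ => Finset.sum_comm, Finset.sum_comm]
  refine Finset.sum_congr rfl fun l hl => ?_
  have hl' := length_of_mem_listsOf hl
  rw [sum_range_mul_eq_sum_antidiagonal K (fun i j => bernoulliNeg i • expNeg j •
    if l.length = i + j then D.iterAd (l.drop j) (D.projPos (D.iterAd (l.take j) y)) else 0),
    Finset.sum_eq_single l.length]
  · refine Finset.sum_congr rfl fun p hp => ?_
    rw [mem_antidiagonal] at hp
    rw [if_pos hp.symm, smul_smul]
  · intro k _ hk
    refine Finset.sum_eq_zero fun p hp => ?_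
    rw [mem_antidiagonal] at hp
    rw [if_neg (by omega), smul_zero, smul_zero]
  · intro h
    rw [hl'] at h
    simp [hK] at h
  · intro i j hij
    rw [if_neg (by omega), smul_zero, smul_zero]

end RootDecomposition

end CoadjointOrbit

end



/-! ### Comparison of the explicit operators `ξ_a` and functions `f_a` with the series on the formal
chart -/

noncomputable section

namespace CoadjointOrbit

set_option linter.unusedSectionVars false

open Finset hiding antidiagonal mem_antidiagonal

open Finset.HasAntidiagonal

open LieAlgebra (ad)

open VecPS

namespace RootDecomposition

universe u v w x

section Polynomials

variable {I : Type w}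

lemma derivation_sum_apply {J : Type*} (s : Finset J)
    (d : J → Derivation ℂ (MvPolynomial I ℂ) (MvPolynomial I ℂ)) (p : MvPolynomial I ℂ) :
    (∑ j ∈ s, d j) p = ∑ j ∈ s, d j p := by
  rw [← Derivation.coeFnAddMonoidHom_apply, map_sum, Finset.sum_apply]
  rfl

lemma derivation_eq_sum_vars (d : Derivation ℂ (MvPolynomial I ℂ) (MvPolynomial I ℂ))
    (p : MvPolynomial I ℂ) :
    d p = ∑ i ∈ p.vars, d (MvPolynomial.X i) * MvPolynomial.pderiv i p := by
  have h : d p = (∑ i ∈ p.vars, d (MvPolynomial.X i) • MvPolynomial.pderiv i) p := by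
    refine MvPolynomial.derivation_eq_of_forall_mem_vars fun j hj => ?_
    rw [derivation_sum_apply, Finset.sum_eq_single j]
    · rw [Derivation.smul_apply, MvPolynomial.pderiv_X_self, smul_eq_mul, mul_one]
    · intro i _ hi
      rw [Derivation.smul_apply, MvPolynomial.pderiv_X_of_ne hi.symm, smul_zero]
    · exact fun h => absurd hj h
  rw [h, derivation_sum_apply]
  rfl

lemma pderiv_inl_ofPoly (i : I) (p : MvPolynomial I ℂ) :
    MvPowerSeries.pderiv ℂ (Sum.inl i) (ofPoly p) = ofPoly (MvPolynomial.pderiv i p) := by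
  rw [ofPoly, MvPowerSeries.pderiv_coe, MvPolynomial.pderiv_rename Sum.inl_injective]
  rfl

lemma pderiv_inr_ofPoly (i : I) (p : MvPolynomial I ℂ) :
    MvPowerSeries.pderiv ℂ (Sum.inr i) (ofPoly p) = 0 := by
  classical
  rw [ofPoly, MvPowerSeries.pderiv_coe, MvPolynomial.pderiv_eq_zero_of_notMem_vars]
  · simp
  · intro h
    have := MvPolynomial.vars_rename Sum.inl p h
    simp at this

lemma formalDeriv_ofPoly (V : FormalField I) (p : MvPolynomial I ℂ) :
    formalDeriv V (ofPoly p) =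
      ∑ i ∈ p.vars, V (Sum.inl i) * ofPoly (MvPolynomial.pderiv i p) := by
  classical
  ext n
  change ∑ᶠ j : I ⊕ I, MvPowerSeries.coeff n (V j * MvPowerSeries.pderiv ℂ j (ofPoly p)) = _
  rw [finsum_eq_sum_of_support_subset (s := p.vars.map ⟨Sum.inl, Sum.inl_injective⟩), map_sum,
    Finset.sum_map]
  · refine Finset.sum_congr rfl fun i _ => ?_
    rw [Function.Embedding.coeFn_mk, pderiv_inl_ofPoly]
  · rintro (i | i) hi
    · by_contra h
      refine hi ?_
      change MvPowerSeries.coeff n _ = 0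
      rw [pderiv_inl_ofPoly]
      rw [MvPolynomial.pderiv_eq_zero_of_notMem_vars, ← ofPolyHom_apply, map_zero, mul_zero,
        map_zero]
      simpa using h
    · refine absurd ?_ hi
      change MvPowerSeries.coeff n _ = 0
      rw [pderiv_inr_ofPoly, mul_zero, map_zero]

end Polynomials

variable {L : Type u} [LieRing L] [LieAlgebra ℂ L] {Δ : Type v} [DecidableEq Δ]
  {I : Type w} {Θ : Type x} (D : RootDecomposition L Δ I Θ)

lemma isWeightedHomogeneous_listPoly {g : List I → ℂ} {d : Δ → ℤ}
    (hg : (Function.support g).Finite)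
    (h : ∀ l, g l ≠ 0 → (l.map D.varDeg).sum = d) :
    MvPolynomial.IsWeightedHomogeneous D.varDeg (listPoly g) d := by
  rw [listPoly_eq_sum (S := hg.toFinset) (by simp)]
  refine MvPolynomial.IsWeightedHomogeneous.sum _ _ _ fun l hl => ?_
  have hl' : g l ≠ 0 := by simpa using hl
  rw [← h l hl', ← zero_add (l.map D.varDeg).sum]
  refine (MvPolynomial.isWeightedHomogeneous_C _ _).mul ?_
  clear hl hl'
  induction l with
  | nil => exact MvPolynomial.isWeightedHomogeneous_one _ _
  | cons i l ih => exact (MvPolynomial.isWeightedHomogeneous_X _ _ i).mul ih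

lemma iterAd_J_mem (a : Gen I Θ) (l : List I) :
    D.iterAd l (D.J a) ∈ D.gradedPart {D.deg a + (l.map D.varDeg).sum} :=
  D.iterAd_mem_gradedPart (D.J_mem_gradedPart (A := {D.deg a}) rfl) l

lemma sum_take_varDeg_le (l : List I) {m n : ℕ} (h : m ≤ n) :
    ((l.take m).map D.varDeg).sum ≤ ((l.take n).map D.varDeg).sum := by
  have : l.take m = (l.take n).take m := by rw [List.take_take, min_eq_left h]
  rw [this]
  conv_rhs => rw [← List.take_append_drop m (l.take n), List.map_append, List.sum_append]
  refine le_add_of_nonneg_right (List.sum_nonneg ?_)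
  intro x hx
  obtain ⟨j, -, rfl⟩ := List.mem_map.1 hx
  exact D.varDeg_nonneg j

/-- The degree of the iterated bracket grows along the word, so once positive it remains positive.
The projection after `q` letters thus acts as the identity if `q ≥ λ` and as zero otherwise; this is
the only role of `λ`. -/
lemma repr_iterAd_projPos (a : Gen I Θ) (l : List I) (α : I) (q : ℕ) :
    D.J.repr (D.iterAd (l.drop q) (D.projPos (D.iterAd (l.take q) (D.J a)))) (Gen.raise α) =
      if D.lam a l ≤ q then D.Ccoef a l α else 0 := by
  have hsplit : D.iterAd (l.drop q) (D.iterAd (l.take q) (D.J a)) = D.iterAd l (D.J a) := by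
    rw [← iterAd_append, List.take_append_drop]
  have hmem := D.iterAd_J_mem a (l.take q)
  by_cases hpos : 0 < D.deg a + ((l.take q).map D.varDeg).sum
  · have h1 : D.lam a l ≤ q := Nat.sInf_le hpos
    rw [if_pos h1, D.projDeg_eq_self (D.gradedPart_mono (Set.singleton_subset_iff.2 hpos) hmem),
      hsplit, Ccoef]
  · rw [D.projDeg_eq_zero (B := {D.deg a + ((l.take q).map D.varDeg).sum})
      (fun x hx => by rw [Set.mem_singleton_iff.1 hx]; exact hpos) hmem]
    have h0 : D.iterAd (l.drop q) 0 = 0 := by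
      generalize l.drop q = l'
      induction l' using List.reverseRecOn with
      | nil => rfl
      | append_singleton l i ih => rw [iterAd_concat, ih, lie_zero]
    rw [h0, map_zero, Finsupp.zero_apply]
    split_ifs with h
    · by_contra hC
      have hdeg := D.iterAd_J_mem a l (Gen.raise α) (Ne.symm hC)
      rw [Set.mem_singleton_iff] at hdeg
      -- The infimum of the empty set would be the meaningless value `0`. A nonzero coefficient
      -- excludes it, since the whole word then has the degree of the raising generator `α`.
      have hne : {n | 0 < D.deg a + ((l.take n).map D.varDeg).sum}.Nonempty :=
        ⟨l.length, by
          rw [Set.mem_ofPred, List.take_length, ← hdeg]; exact D.deg_raise_pos α⟩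
      have h2 := Nat.sInf_mem hne
      rw [Set.mem_ofPred] at h2
      exact hpos (h2.trans_le (add_le_add_right (D.sum_take_varDeg_le l h) _))
    · rfl

/-- The convolution of the coefficients of `t/(1 - e^{-t})` and of `e^{-t}`, truncated to at least
`n` factors from the exponential. The signs `(-1)^l` and `(-1)^{k-l}` combine to `(-1)^k`, which
leaves the extra sign in the definition of `β`. -/
lemma neg_beta (k n : ℕ) :
    -beta k n = ∑ p ∈ antidiagonal k,
      if n ≤ p.2 then bernoulliNeg p.1 * expNeg p.2 else 0 := by
  rw [Finset.Nat.sum_antidiagonal_eq_sum_range_succ_mk, ← Finset.sum_filter, beta,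
    ← neg_mul, Finset.mul_sum]
  refine Finset.sum_congr ?_ fun j hj => ?_
  · ext j; simp only [mem_filter, mem_range]; omega
  · rw [mem_filter, mem_range] at hj
    have h1 : ((j.factorial : ℕ) : ℂ) ≠ 0 := by exact_mod_cast j.factorial_ne_zero
    have h2 : (((k - j).factorial : ℕ) : ℂ) ≠ 0 := by exact_mod_cast (k - j).factorial_ne_zero
    have h3 : (-1 : ℂ) ^ k = (-1) ^ j * (-1) ^ (k - j) := by rw [← pow_add]; congr 1; omega
    rw [bernoulliNeg, expNeg, pow_succ, h3]
    field_simp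

variable [Fintype Δ]

lemma finite_support_fieldCoef (a : Gen I Θ) (α : I) :
    (Function.support fun l => beta l.length (D.lam a l) * D.Ccoef a l α).Finite :=
  D.finite_support_iterAd a (Gen.raise α) fun l => beta l.length (D.lam a l)

/-- the polynomial `-i ⟨b, e^{-ad Z} J_a⟩` -/
def orbitFun (b : L →ₗ[ℂ] ℂ) (a : Gen I Θ) : MvPolynomial I ℂ :=
  listPoly fun l => -Complex.I * expNeg l.length * b (D.iterAd l (D.J a))

section Functional

variable {D} {b : L →ₗ[ℂ] ℂ}

/-- `b` detects only degree zero. This gives both the finiteness of the sum and the gauge condition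
`f_a ∈ R_{-a}`. -/
lemma IsCartanFunctional.sum_varDeg_eq (hb : D.IsCartanFunctional b) {a : Gen I Θ} {l : List I}
    (h : b (D.iterAd l (D.J a)) ≠ 0) : (l.map D.varDeg).sum = -D.deg a := by
  by_contra h'
  refine h (hb.apply_eq_zero ?_ (D.iterAd_J_mem a l))
  intro h0
  exact h' (neg_eq_of_add_eq_zero_right (Set.mem_singleton_iff.1 h0).symm).symm

lemma IsCartanFunctional.finite_support_orbitFun (hb : D.IsCartanFunctional b) (a : Gen I Θ) :
    (Function.support fun l => -Complex.I * expNeg l.length * b (D.iterAd l (D.J a))).Finite :=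
  (D.finite_lists_sum_varDeg (-D.deg a)).subset fun _ hl =>
    hb.sum_varDeg_eq (right_ne_zero_of_mul hl)

lemma IsCartanFunctional.isHomogeneousFamily_orbitFun (hb : D.IsCartanFunctional b) :
    D.IsHomogeneousFamily (D.orbitFun b) := fun a =>
  D.isWeightedHomogeneous_listPoly (hb.finite_support_orbitFun a) fun _ hl =>
    hb.sum_varDeg_eq (right_ne_zero_of_mul hl)

end Functional

section Series

variable [DecidableEq I]

/-- `vSer` as a linear map -/
def vHom : L →ₗ[ℂ] VecPS (I ⊕ I) L :=
  berAd D.zSer ∘ₗ mapCoeff D.projPos ∘ₗ expAd D.zSer ∘ₗ VecPS.const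

/-- The explicit formula for `ξ_a` is recognized as minus the displacement of `Z`, word by word:
`repr_iterAd_projPos` selects the admissible splittings of the word, and `neg_beta` sums their
weights. -/
lemma ofPoly_fieldCoef (a : Gen I Θ) (α : I) :
    ofPoly (D.fieldCoef a α) =
      -toMv (mapCoeff (D.J.coord (Gen.raise α)) (D.vSer (D.J a))) := by
  ext m
  rw [map_neg, coeff_toMv, mapCoeff_apply, vSer_apply, fieldCoef,
    ← listPoly, coeff_ofPoly_listPoly (D.finite_support_fieldCoef a α), map_sum,
    ← Finset.sum_neg_distrib]
  refine Finset.sum_congr rfl fun l _ => ?_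
  rw [map_sum, ← neg_neg (beta _ _), neg_beta, neg_mul, Finset.sum_mul]
  congr 1
  refine Finset.sum_congr rfl fun p _ => ?_
  rw [map_smul, Module.Basis.coord_apply, repr_iterAd_projPos]
  split_ifs <;> simp

lemma ofPoly_xiLin_X (y : L) (i : I) :
    ofPoly (D.xiLin y (MvPolynomial.X i)) =
      -toMv (mapCoeff (D.J.coord (Gen.raise i)) (D.vSer y)) := by
  let ev : Derivation ℂ (MvPolynomial I ℂ) (MvPolynomial I ℂ) →ₗ[ℂ] MvPolynomial I ℂ :=
    { toFun := fun d => d (MvPolynomial.X i), map_add' := fun _ _ => rfl,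
      map_smul' := fun _ _ => rfl }
  have : ofPolyHom.toLinearMap ∘ₗ ev ∘ₗ D.xiLin =
      -(toMv ∘ₗ mapCoeff (D.J.coord (Gen.raise i)) ∘ₗ D.vHom) := by
    refine D.J.ext fun a => ?_
    change ofPolyHom (D.xiLin (D.J a) (MvPolynomial.X i)) = _
    rw [xiLin, Module.Basis.constr_basis, xi, MvPolynomial.mkDerivation_X, ofPolyHom_apply,
      ofPoly_fieldCoef]
    rfl
  rw [← ofPolyHom_apply]
  exact LinearMap.congr_fun this y

lemma toField_actionField_inl (y : L) (i : I) :
    toField (D.actionField y) (Sum.inl i) = -ofPoly (D.xiLin y (MvPolynomial.X i)) := by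
  rw [ofPoly_xiLin_X, neg_neg]
  ext m
  change D.J.repr (D.vSer y m + D.uSer y m) (Gen.raise i) = D.J.repr (D.vSer y m) (Gen.raise i)
  have h : D.J.repr (D.uSer y m) (Gen.raise i) = 0 := by
    by_contra h
    exact lt_asymm (D.deg_raise_pos i) (Set.mem_ofPred.1 (D.uSer_mem y m _ h))
  rw [map_add, Finsupp.add_apply, h, add_zero]

lemma ofPoly_xiLin (y : L) (p : MvPolynomial I ℂ) :
    ofPoly (D.xiLin y p) = -formalDeriv (toField (D.actionField y)) (ofPoly p) := by
  rw [formalDeriv_ofPoly, derivation_eq_sum_vars, ← ofPolyHom_apply, map_sum,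
    ← Finset.sum_neg_distrib]
  refine Finset.sum_congr rfl fun i _ => ?_
  rw [toField_actionField_inl, map_mul, ofPolyHom_apply, ofPolyHom_apply, neg_mul, neg_neg]

lemma ofPoly_xiLin_toMv (y : L) {p : MvPolynomial I ℂ} {F : VecPS (I ⊕ I) ℂ}
    (h : ofPoly p = toMv F) :
    ofPoly (D.xiLin y p) = -toMv (fieldDeriv (D.actionField y) F) := by
  rw [ofPoly_xiLin, h, formalDeriv_toField]

lemma IsCartanFunctional.ofPoly_famLin_orbitFun {D : RootDecomposition L Δ I Θ}
    {b : L →ₗ[ℂ] ℂ} (hb : D.IsCartanFunctional b) (y : L) :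
    ofPoly (D.famLin (D.orbitFun b) y) = -Complex.I • toMv (D.bSer b y) := by
  have : ofPolyHom.toLinearMap ∘ₗ D.famLin (D.orbitFun b) =
      -Complex.I • (toMv ∘ₗ mapCoeff b ∘ₗ expAd D.zSer ∘ₗ VecPS.const) := by
    refine D.J.ext fun a => ?_
    change ofPolyHom (D.famLin (D.orbitFun b) (D.J a)) = -Complex.I • toMv (D.bSer b (D.J a))
    rw [famLin, Module.Basis.constr_basis, ofPolyHom_apply, orbitFun]
    ext m
    rw [coeff_ofPoly_listPoly (hb.finite_support_orbitFun a), map_smul, coeff_toMv, bSer,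
      mapCoeff_apply, eSer_apply, map_sum, Finset.smul_sum]
    refine Finset.sum_congr rfl fun l _ => ?_
    rw [map_smul, smul_eq_mul, smul_eq_mul, mul_assoc]
  rw [← ofPolyHom_apply]
  exact LinearMap.congr_fun this y

end Series

/-- A derivation of the polynomial ring is determined by its values on the variables, where the
claim is `fieldDeriv_vSer`. The fields of a left action satisfy the bracket relation with a minus
sign, and `ξ_y = -ỹ` removes it. -/
lemma xiLin_lie (y y' : L) : D.xiLin ⁅y, y'⁆ = ⁅D.xiLin y, D.xiLin y'⁆ := by
  classical
  refine MvPolynomial.derivation_ext fun i => ofPoly_injective ?_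
  have h : ∀ y, ofPoly (D.xiLin y (MvPolynomial.X i)) =
      toMv (-mapCoeff (D.J.coord (Gen.raise i)) (D.vSer y)) := fun y => by
    rw [ofPoly_xiLin_X, map_neg]
  rw [Derivation.commutator_apply, ← ofPolyHom_apply (_ - _), map_sub, ofPolyHom_apply,
    ofPolyHom_apply, D.ofPoly_xiLin_toMv y (h y'), D.ofPoly_xiLin_toMv y' (h y), h]
  simp only [map_neg, neg_neg, ← mapCoeff_fieldDeriv, ← map_sub, fieldDeriv_vSer]

/-- The cocycle identity `fieldDeriv_bSer_sub`, carried over to polynomials. Both the recursive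
formula for `f` and the representation property are contained in it. -/
lemma IsCartanFunctional.famLin_orbitFun_lie {D : RootDecomposition L Δ I Θ}
    {b : L →ₗ[ℂ] ℂ} (hb : D.IsCartanFunctional b) (y y' : L) :
    D.famLin (D.orbitFun b) ⁅y, y'⁆ =
      D.xiLin y (D.famLin (D.orbitFun b) y') - D.xiLin y' (D.famLin (D.orbitFun b) y) := by
  classical
  apply ofPoly_injective
  have h : ∀ y, ofPoly (D.famLin (D.orbitFun b) y) = toMv (-Complex.I • D.bSer b y) := fun y => by
    rw [hb.ofPoly_famLin_orbitFun, map_smul]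
  rw [← ofPolyHom_apply (_ - _), map_sub, ofPolyHom_apply, ofPolyHom_apply,
    D.ofPoly_xiLin_toMv y (h y'), D.ofPoly_xiLin_toMv y' (h y), h, map_smul (fieldDeriv _),
    map_smul (fieldDeriv _), neg_sub_neg, ← map_sub, ← smul_sub, ← neg_sub,
    hb.fieldDeriv_bSer_sub, neg_neg]

end RootDecomposition

end CoadjointOrbit

end



/-! ### The recursive family: existence, uniqueness and the representation -/

noncomputable section

namespace CoadjointOrbit

set_option linter.unusedSectionVars false

open Finset hiding antidiagonal mem_antidiagonal

open Finset.HasAntidiagonal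

open LieAlgebra (ad)

open VecPS

namespace RootDecomposition

universe u v w x

lemma notMem_vars_of_pderiv_eq_zero {I : Type w} {p : MvPolynomial I ℂ} {i : I}
    (h : MvPolynomial.pderiv i p = 0) : i ∉ p.vars := by
  intro hi
  obtain ⟨m, hm, hmi⟩ := (MvPolynomial.mem_vars_iff_mem_support i).1 hi
  have hle : Finsupp.single i 1 ≤ m := by
    rw [Finsupp.single_le_iff]
    exact Nat.one_le_iff_ne_zero.2 (Finsupp.mem_support_iff.1 hmi)
  have h2 := congrArg (MvPolynomial.coeff (m - Finsupp.single i 1)) h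
  rw [← MvPolynomial.coeff_coe, ← MvPowerSeries.pderiv_coe, MvPowerSeries.coeff_pderiv,
    tsub_add_cancel_of_le hle, MvPolynomial.coeff_coe, MvPolynomial.coeff_zero] at h2
  refine mul_ne_zero (MvPolynomial.mem_support_iff.1 hm) ?_ h2
  exact Nat.cast_add_one_ne_zero _

variable {L : Type u} [LieRing L] [LieAlgebra ℂ L] {Δ : Type v} [DecidableEq Δ]
  {I : Type w} {Θ : Type x} (D : RootDecomposition L Δ I Θ)

lemma xiLin_J (a : Gen I Θ) : D.xiLin (D.J a) = D.xi a := D.J.constr_basis ℂ _ _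

lemma famLin_J (f : Gen I Θ → MvPolynomial I ℂ) (a : Gen I Θ) : D.famLin f (D.J a) = f a :=
  D.J.constr_basis ℂ _ _

variable [Fintype Δ]

/-- the height of a root -/
def height (i : I) : ℕ := ∑ s, D.wt i s

lemma height_pos (i : I) : 0 < D.height i := by
  refine Nat.pos_of_ne_zero fun h => D.wt_ne_zero i ?_
  funext s
  exact (Finset.sum_eq_zero_iff.1 h) s (Finset.mem_univ s)

lemma sum_varDeg (i : I) : ∑ s, D.varDeg i s = (D.height i : ℤ) := by
  rw [height]; push_cast; rfl

lemma sum_deg_lower (i : I) : ∑ s, D.deg (Gen.lower i) s = -(D.height i : ℤ) := by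
  rw [deg_lower, height]; push_cast; rw [← Finset.sum_neg_distrib]; rfl

lemma list_eq_nil_of_sum_le {l : List I} (h : ∑ s, (l.map D.varDeg).sum s ≤ 0) : l = [] := by
  rcases l with _ | ⟨i, l⟩
  · rfl
  · have h1 : 0 ≤ ∑ s, (l.map D.varDeg).sum s := by
      refine Finset.sum_nonneg fun s _ => ?_
      have : 0 ≤ (l.map D.varDeg).sum := List.sum_nonneg fun x hx => by
        obtain ⟨j, -, rfl⟩ := List.mem_map.1 hx
        exact D.varDeg_nonneg j
      exact this s
    have h2 := D.sum_varDeg i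
    have h3 := D.height_pos i
    simp only [List.map_cons, List.sum_cons, Pi.add_apply, Finset.sum_add_distrib] at h
    omega

/-- Every letter raises the height, so under the assumption only the empty word can contribute; its
coefficient is `β_{0,0} = -1`. -/
lemma fieldCoef_raise_of_height_le {i α : I} (h : D.height i ≤ D.height α) [Decidable (i = α)] :
    D.fieldCoef (Gen.raise α) i = if i = α then -1 else 0 := by
  classical
  have hs : (Function.support fun l : List I => beta l.length (D.lam (Gen.raise α) l) *
      D.Ccoef (Gen.raise α) l i) ⊆ (({[]} : Finset (List I)) : Set (List I)) := by
    intro l hl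
    have h1 := D.iterAd_J_mem (Gen.raise α) l (Gen.raise i) (right_ne_zero_of_mul hl)
    rw [Set.mem_singleton_iff] at h1
    have h2 : ∑ s, (l.map D.varDeg).sum s = D.height i - D.height α := by
      rw [← sum_varDeg, ← sum_varDeg, ← Finset.sum_sub_distrib]
      refine Finset.sum_congr rfl fun s _ => ?_
      have := congrFun h1 s
      change D.varDeg i s = D.varDeg α s + _ at this
      rw [this]; ring
    simpa using D.list_eq_nil_of_sum_le (l := l) (by omega)
  have hlam : D.lam (Gen.raise α) [] = 0 :=
    Nat.sInf_eq_zero.2 (Or.inl (by simpa using D.deg_raise_pos α))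
  rw [fieldCoef, ← listPoly, listPoly_eq_sum hs, Finset.sum_singleton, List.length_nil, hlam]
  have hb : beta 0 0 = -1 := by simp [beta]
  rw [hb, Ccoef, iterAd, List.foldl_nil, Module.Basis.repr_self, Finsupp.single_apply]
  by_cases hi : i = α
  · subst hi; simp
  · rw [if_neg hi, if_neg (fun h => hi (Sum.inl_injective h).symm)]; simp

/-- A polynomial that is annihilated by the raising operators is constant. -/
lemma vars_eq_empty_of_xi_raise_eq_zero {p : MvPolynomial I ℂ}
    (h : ∀ i, D.xi (Gen.raise i) p = 0) : p.vars = ∅ := by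
  classical
  by_contra hne
  -- For a variable of maximal height in `p`, the triangular form of the raising operators reduces
  -- `ξ_α p` to `-∂p/∂z_α`.
  obtain ⟨α, hα, hmax⟩ := Finset.exists_max_image p.vars D.height
    (Finset.nonempty_iff_ne_empty.2 hne)
  refine notMem_vars_of_pderiv_eq_zero (p := p) (i := α) ?_ hα
  have h1 := h α
  rw [derivation_eq_sum_vars, Finset.sum_eq_single α] at h1
  · rw [xi, MvPolynomial.mkDerivation_X, D.fieldCoef_raise_of_height_le le_rfl, if_pos rfl,
      neg_one_mul, neg_eq_zero] at h1
    exact h1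
  · intro i hi hne
    rw [xi, MvPolynomial.mkDerivation_X, D.fieldCoef_raise_of_height_le (hmax i hi), if_neg hne,
      zero_mul]
  · exact fun h => absurd hα h

lemma eq_zero_of_xi_raise_eq_zero {p : MvPolynomial I ℂ} {d : Δ → ℤ} (hd : d ≠ 0)
    (hp : MvPolynomial.IsWeightedHomogeneous D.varDeg p d)
    (h : ∀ i, D.xi (Gen.raise i) p = 0) : p = 0 := by
  obtain ⟨r, rfl⟩ : ∃ r, p = MvPolynomial.C r :=
    ⟨_, MvPolynomial.vars_eq_empty_iff_eq_C.1 (D.vars_eq_empty_of_xi_raise_eq_zero h)⟩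
  by_contra hr
  exact hd ((MvPolynomial.isWeightedHomogeneous_C D.varDeg r).inj_right hr hp).symm

section Functional

variable {D} {b : L →ₗ[ℂ] ℂ}

lemma IsCartanFunctional.orbitFun_eq_zero (hb : D.IsCartanFunctional b) {a : Gen I Θ}
    (h : ∀ l : List I, (l.map D.varDeg).sum ≠ -D.deg a) : D.orbitFun b a = 0 := by
  rw [orbitFun, listPoly_eq_sum (S := ∅), Finset.sum_empty]
  intro l hl
  exact absurd (hb.sum_varDeg_eq (right_ne_zero_of_mul hl)) (h l)

lemma IsCartanFunctional.orbitFun_raise (hb : D.IsCartanFunctional b) (i : I) :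
    D.orbitFun b (Gen.raise i) = 0 := by
  refine hb.orbitFun_eq_zero fun l hl => ?_
  have h1 : 0 ≤ (l.map D.varDeg).sum := List.sum_nonneg fun x hx => by
    obtain ⟨j, -, rfl⟩ := List.mem_map.1 hx
    exact D.varDeg_nonneg j
  rw [hl] at h1
  exact absurd (D.deg_raise_pos i) (not_lt_of_ge (neg_nonneg.1 h1))

lemma IsCartanFunctional.orbitFun_cartan (hb : D.IsCartanFunctional b) (h : Θ) :
    D.orbitFun b (Gen.cartan h) = MvPolynomial.C (-Complex.I * b (D.J (Gen.cartan h))) := by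
  rw [orbitFun, listPoly_eq_sum (S := {[]}), Finset.sum_singleton]
  · simp [iterAd, expNeg_zero]
  · intro l hl
    have h1 := hb.sum_varDeg_eq (right_ne_zero_of_mul hl)
    rw [deg_cartan, neg_zero] at h1
    simpa using D.list_eq_nil_of_sum_le (l := l) (by rw [h1]; simp)

/-- A simple root has height one, which leaves room for one letter only, and its root space is
one-dimensional. -/
lemma sum_map_varDeg_eq_simple {l : List I} {s : Δ}
    (h : (l.map D.varDeg).sum = D.varDeg (D.simple s)) : l = [D.simple s] := by
  have hs : ∑ t, D.varDeg (D.simple s) t = 1 := by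
    rw [sum_varDeg, height, D.wt_simple]; simp
  rcases l with _ | ⟨i, l⟩
  · rw [← h] at hs
    simp at hs
  · have h2 := D.sum_varDeg i
    have h3 := D.height_pos i
    have h4 := congrArg (fun d => ∑ t, d t) h
    simp only [List.map_cons, List.sum_cons, Pi.add_apply, Finset.sum_add_distrib] at h4
    obtain rfl : l = [] := D.list_eq_nil_of_sum_le (by omega)
    simp only [List.map_cons, List.map_nil, List.sum_cons, List.sum_nil, add_zero] at h
    rw [D.simple_unique i s]
    rw [← D.wt_simple s]
    funext t
    exact Int.ofNat.inj (congrFun h t)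

lemma IsCartanFunctional.orbitFun_simple (hb : D.IsCartanFunctional b) (s : Δ) :
    D.orbitFun b (Gen.lower (D.simple s)) = MvPolynomial.C (Complex.I *
      b ⁅D.J (Gen.raise (D.simple s)), D.J (Gen.lower (D.simple s))⁆) *
      MvPolynomial.X (D.simple s) := by
  rw [orbitFun, listPoly_eq_sum (S := {[D.simple s]}), Finset.sum_singleton]
  · simp [iterAd, expNeg]
  · intro l hl
    have h1 := hb.sum_varDeg_eq (right_ne_zero_of_mul hl)
    rw [deg_lower, neg_neg] at h1
    simpa using sum_map_varDeg_eq_simple h1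

/-- Apart from the initial values, all conditions are instances of the cocycle identity; in the
quasi-simple condition one of its terms drops out since `f` vanishes on raising generators. -/
lemma IsCartanFunctional.isRecursiveFamily_orbitFun (hb : D.IsCartanFunctional b) :
    D.IsRecursiveFamily b (D.orbitFun b) where
  raise := hb.orbitFun_raise
  cartan := hb.orbitFun_cartan
  simple := hb.orbitFun_simple
  quasi c _ := by
    refine ⟨?_, fun i => ?_⟩
    · have := hb.isHomogeneousFamily_orbitFun (Gen.lower c)
      rwa [deg_lower, neg_neg] at this
    · rw [hb.famLin_orbitFun_lie, famLin_J, famLin_J, xiLin_J, xiLin_J, hb.orbitFun_raise,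
        map_zero, sub_zero]
  recursive i j _ := by
    rw [hb.famLin_orbitFun_lie, famLin_J, famLin_J, xiLin_J, xiLin_J]

/-- Two recursive families that agree on the lowering generators of height less than `h` agree on
those of height `h`. -/
lemma IsRecursiveFamily.lower_eq_of_height {f f' : Gen I Θ → MvPolynomial I ℂ}
    (hf : D.IsRecursiveFamily b f) (hf' : D.IsRecursiveFamily b f') {h : ℕ}
    (ih : ∀ c, D.height c < h → f (Gen.lower c) = f' (Gen.lower c)) (c : I)
    (hc : D.height c = h) : f (Gen.lower c) = f' (Gen.lower c) := by
  classical
  -- The difference of the two families, cut off to the height `h`, so that its linear extension can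
  -- be shown to vanish on all lowering generators.
  let d : Gen I Θ → MvPolynomial I ℂ :=
    Sum.elim (fun _ => 0) (Sum.elim (fun _ => 0)
      fun i => if D.height i = h then f (Gen.lower i) - f' (Gen.lower i) else 0)
  let dLin : L →ₗ[ℂ] MvPolynomial I ℂ := D.J.constr ℂ d
  have hdJ : ∀ a, dLin (D.J a) = d a := D.J.constr_basis ℂ d
  have hsupp : ∀ (φ φ' : L →ₗ[ℂ] MvPolynomial I ℂ) (y : L),
      (∀ a, D.J.repr y a ≠ 0 → φ (D.J a) = φ' (D.J a)) → φ y = φ' y := by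
    intro φ φ' y H
    rw [← D.J.linearCombination_repr y, Finsupp.linearCombination_apply, Finsupp.sum, map_sum,
      map_sum]
    refine Finset.sum_congr rfl fun a ha => ?_
    rw [map_smul, map_smul, H a (Finsupp.mem_support_iff.1 ha)]
  have hfJ : ∀ a, (D.famLin f - D.famLin f') (D.J a) = f a - f' a := fun a => by
    rw [LinearMap.sub_apply, famLin_J, famLin_J]
  have hpos : ∀ i, f (Gen.raise i) - f' (Gen.raise i) = 0 := fun i => by
    rw [hf.raise, hf'.raise, sub_zero]
  have hcar : ∀ i, f (Gen.cartan i) - f' (Gen.cartan i) = 0 := fun i => by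
    rw [hf.cartan, hf'.cartan, sub_self]
  have hbr : ∀ i j, dLin ⁅D.J (Gen.lower i), D.J (Gen.lower j)⁆ = 0 := by
    intro i j
    by_cases h0 : ⁅D.J (Gen.lower i), D.J (Gen.lower j)⁆ = 0
    · rw [h0, map_zero]
    have hdeg : ∀ a, D.J.repr ⁅D.J (Gen.lower i), D.J (Gen.lower j)⁆ a ≠ 0 →
        ∃ k, a = Gen.lower k ∧ D.height k = D.height i + D.height j := by
      intro a ha
      have h1 : D.deg a = D.deg (Gen.lower i) + D.deg (Gen.lower j) := D.graded _ _ _ ha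
      have h2 : D.deg a < 0 := h1 ▸ add_neg (D.deg_lower_neg i) (D.deg_lower_neg j)
      rcases a with k | k | k
      · exact absurd h2 (lt_asymm (D.deg_raise_pos k))
      · exact absurd h2 (lt_irrefl _)
      · refine ⟨k, rfl, ?_⟩
        have h3 := congrArg (fun d => ∑ t, d t) h1
        simp only [Pi.add_apply, Finset.sum_add_distrib] at h3
        have h4 := D.sum_deg_lower i
        have h5 := D.sum_deg_lower j
        have h6 := D.sum_deg_lower k
        simp only [Gen.lower] at *
        omega
    -- Either both factors have height less than `h`, where the families agree and the recursion
    -- gives the same bracket values, or the bracket has no components of height `h`.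
    by_cases hh : D.height i + D.height j = h
    · rw [hsupp dLin (D.famLin f - D.famLin f')]
      · rw [LinearMap.sub_apply, hf.recursive i j h0, hf'.recursive i j h0,
          ih i (by have := D.height_pos j; omega), ih j (by have := D.height_pos i; omega), sub_self]
      · intro a ha
        obtain ⟨k, rfl, hk⟩ := hdeg a ha
        rw [hdJ, hfJ]
        exact if_pos (hk.trans hh)
    · rw [hsupp dLin 0]
      · rfl
      · intro a ha
        obtain ⟨k, rfl, hk⟩ := hdeg a ha
        rw [hdJ]
        exact if_neg fun h' => hh (hk.symm.trans h')
  have hspan : ∀ y ∈ D.negPart, y ∈ Submodule.span ℂ (Set.range fun i => D.J (Gen.lower i)) := by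
    intro y hy
    rw [← D.J.linearCombination_repr y, Finsupp.linearCombination_apply]
    refine Submodule.sum_mem _ fun a ha => Submodule.smul_mem _ _ ?_
    have h1 := Set.mem_ofPred.1 (hy a (Finsupp.mem_support_iff.1 ha))
    rcases a with k | k | k
    · exact absurd h1 (lt_asymm (D.deg_raise_pos k))
    · exact absurd h1 (lt_irrefl _)
    · exact Submodule.subset_span ⟨k, rfl⟩
  -- By `hbr` the kernel of `dLin` contains all brackets of lowering elements, so its lowering part
  -- is a subalgebra. Only the simple and quasi-simple generators remain to be tested.
  let S : LieSubalgebra ℂ L :=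
    { D.negPart ⊓ LinearMap.ker dLin with
      lie_mem' := by
        rintro y y' ⟨hy, -⟩ ⟨hy', -⟩
        refine ⟨D.lie_negPart y hy y' hy', ?_⟩
        rw [SetLike.mem_coe, LinearMap.mem_ker]
        refine Submodule.span_induction₂ (p := fun y y' _ _ => dLin ⁅y, y'⁆ = 0) ?_ ?_ ?_ ?_ ?_
          ?_ ?_ (hspan y hy) (hspan y' hy')
        · rintro _ _ ⟨i, rfl⟩ ⟨j, rfl⟩; exact hbr i j
        · intro y _; rw [zero_lie, map_zero]
        · intro y _; rw [lie_zero, map_zero]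
        · intro y y' y'' _ _ _ h1 h2; rw [add_lie, map_add, h1, h2, add_zero]
        · intro y y' y'' _ _ _ h1 h2; rw [lie_add, map_add, h1, h2, add_zero]
        · intro r y y' _ _ h1; rw [smul_lie, map_smul, h1, smul_zero]
        · intro r y y' _ _ h1; rw [lie_smul, map_smul, h1, smul_zero] }
  have hS : D.J (Gen.lower c) ∈ S := by
    refine (LieSubalgebra.lieSpan_le (K := S)).2 ?_ (D.lower_generate c)
    rintro _ ⟨j, hj, rfl⟩
    refine ⟨D.J_mem_gradedPart (Set.mem_ofPred.2 (D.deg_lower_neg j)), ?_⟩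
    rw [SetLike.mem_coe, LinearMap.mem_ker, hdJ]
    change (if D.height j = h then f (Gen.lower j) - f' (Gen.lower j) else 0) = 0
    split_ifs with hjh
    swap
    · rfl
    rcases hj with ⟨s, rfl⟩ | hj
    · rw [hf.simple, hf'.simple, sub_self]
    · obtain ⟨h1, h2⟩ := hf.quasi j hj
      obtain ⟨h1', h2'⟩ := hf'.quasi j hj
      -- The difference at a quasi-simple root is annihilated by every raising operator: the bracket
      -- of `J_i` with `J_{-j}` has components only along raising, Cartan and lower-height lowering
      -- generators, where the families agree.
      refine D.eq_zero_of_xi_raise_eq_zero (D.deg_raise_pos j).ne'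
        (d := D.varDeg j) (Submodule.sub_mem (MvPolynomial.weightedHomogeneousSubmodule ℂ _ _)
          h1 h1') fun i => ?_
      rw [map_sub, h2, h2', ← LinearMap.sub_apply, hsupp _ 0]
      · rfl
      · intro a ha
        rw [hfJ, LinearMap.zero_apply]
        rcases a with k | k | k
        · exact hpos k
        · exact hcar k
        · rw [ih k, sub_self]
          have h3 : D.deg (Gen.lower k) = D.deg (Gen.raise i) + D.deg (Gen.lower j) :=
            D.graded _ _ _ ha
          have h4 := congrArg (fun d => ∑ t, d t) h3
          simp only [Pi.add_apply, Finset.sum_add_distrib] at h4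
          rw [sum_deg_lower, sum_deg_lower] at h4
          have h5 : ∑ t, D.deg (Gen.raise i) t = D.height i := D.sum_varDeg i
          have h6 := D.height_pos i
          omega
  have := hS.2
  rw [SetLike.mem_coe, LinearMap.mem_ker, hdJ] at this
  change (if D.height c = h then f (Gen.lower c) - f' (Gen.lower c) else 0) = 0 at this
  rw [if_pos hc, sub_eq_zero] at this
  exact this

lemma IsRecursiveFamily.unique {f f' : Gen I Θ → MvPolynomial I ℂ}
    (hf : D.IsRecursiveFamily b f) (hf' : D.IsRecursiveFamily b f') : f = f' := by
  have h : ∀ (h : ℕ) (c : I), D.height c = h → f (Gen.lower c) = f' (Gen.lower c) := by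
    intro h
    induction h using Nat.strong_induction_on with
    | _ h ih => exact hf.lower_eq_of_height hf' fun c hc => ih _ hc c rfl
  funext a
  rcases a with i | i | i
  · exact (hf.raise i).trans (hf'.raise i).symm
  · exact (hf.cartan i).trans (hf'.cartan i).symm
  · exact h _ i rfl

end Functional

/-- the operators `ξ_y + f_y`, as a linear function of `y` -/
def operators (f : Gen I Θ → MvPolynomial I ℂ) : L →ₗ[ℂ] Module.End ℂ (MvPolynomial I ℂ) where
  toFun y := (D.xiLin y).toLinearMap + LinearMap.mulLeft ℂ (D.famLin f y)
  map_add' y y' := by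
    refine LinearMap.ext fun p => ?_
    change D.xiLin (y + y') p + D.famLin f (y + y') * p =
      (D.xiLin y p + D.famLin f y * p) + (D.xiLin y' p + D.famLin f y' * p)
    rw [map_add, map_add, Derivation.add_apply, add_mul]
    abel
  map_smul' r y := by
    refine LinearMap.ext fun p => ?_
    change D.xiLin (r • y) p + D.famLin f (r • y) * p = r • (D.xiLin y p + D.famLin f y * p)
    rw [map_smul, map_smul, Derivation.smul_apply, smul_mul_assoc, smul_add]

lemma operators_apply (f : Gen I Θ → MvPolynomial I ℂ) (y : L) (p : MvPolynomial I ℂ) :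
    D.operators f y p = D.xiLin y p + D.famLin f y * p := rfl

lemma operators_J (f : Gen I Θ → MvPolynomial I ℂ) (a : Gen I Θ) :
    D.operators f (D.J a) = D.Jhat f a := by
  refine LinearMap.ext fun p => ?_
  rw [operators_apply, xiLin_J, famLin_J]
  rfl

/-- For first-order operators `[ξ + f, ξ' + f'] = [ξ, ξ'] + (ξ f' - ξ' f)`; the second-order terms
and the products `f f'` cancel. -/
lemma operators_lie {f : Gen I Θ → MvPolynomial I ℂ}
    (hf : ∀ y y', D.famLin f ⁅y, y'⁆ = D.xiLin y (D.famLin f y') - D.xiLin y' (D.famLin f y))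
    (y y' : L) :
    D.operators f ⁅y, y'⁆ =
      D.operators f y * D.operators f y' - D.operators f y' * D.operators f y := by
  refine LinearMap.ext fun p => ?_
  rw [LinearMap.sub_apply, Module.End.mul_apply, Module.End.mul_apply]
  simp only [operators_apply, xiLin_lie, hf, Derivation.commutator_apply, map_add,
    Derivation.leibniz, smul_eq_mul]
  ring

end RootDecomposition

end CoadjointOrbit

end



noncomputable section

namespace CoadjointOrbit

set_option linter.unusedSectionVars false

open Finset hiding antidiagonal mem_antidiagonal

open Finset.HasAntidiagonal

open LieAlgebra (ad)

open VecPS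

namespace RootDecomposition

universe u v w x

variable {L : Type u} [LieRing L] [LieAlgebra ℂ L] {Δ : Type v} [DecidableEq Δ]
  {I : Type w} {Θ : Type x} (D : RootDecomposition L Δ I Θ)

/-! ## Uniqueness of the vector fields of the action -/

/-- `F` and `F'` have the same coefficients below the order `N` -/
def AgreeBelow (N : ℕ) (F F' : FormalAlg I Θ) : Prop :=
  ∀ c (m : I ⊕ I →₀ ℕ), m.degree < N → F c m = F' c m

variable {D} in
lemma AgreeBelow.formalAd {N : ℕ} {F F' : FormalAlg I Θ} (h : AgreeBelow N F F')
    (e : I → Gen I Θ) (x : I → I ⊕ I) :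
    AgreeBelow (N + 1) (D.formalAd e x F) (D.formalAd e x F') := by
  classical
  intro c m hm
  refine finsum_congr fun p => ?_
  congr 1
  rw [MvPowerSeries.X, MvPowerSeries.coeff_monomial_mul, MvPowerSeries.coeff_monomial_mul,
    one_mul, one_mul]
  split_ifs with h1
  · refine h _ _ ?_
    have h2 : (m - Finsupp.single (x p.1) 1 + Finsupp.single (x p.1) 1).degree = m.degree := by
      rw [tsub_add_cancel_of_le h1]
    rw [map_add, Finsupp.degree_single] at h2
    omega
  · rfl

lemma AgreeBelow.iterate {T : FormalAlg I Θ → FormalAlg I Θ}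
    (hT : ∀ N F F', AgreeBelow N F F' → AgreeBelow (N + 1) (T F) (T F')) {N : ℕ}
    {F F' : FormalAlg I Θ} (h : AgreeBelow N F F') (k : ℕ) :
    AgreeBelow (N + k) (T^[k] F) (T^[k] F') := by
  induction k with
  | zero => exact h
  | succ k ih =>
    rw [Function.iterate_succ_apply', Function.iterate_succ_apply']
    exact hT _ _ _ ih

/-- As `q 0 = 1`, the operator is the identity plus terms that raise the order; after the identity
is subtracted, a coefficient depends on coefficients of strictly lower order only. -/
lemma AgreeBelow.opSeries_sub {T : FormalAlg I Θ → FormalAlg I Θ}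
    (hT : ∀ N F F', AgreeBelow N F F' → AgreeBelow (N + 1) (T F) (T F')) {q : ℕ → ℂ}
    (hq : q 0 = 1) {F F' : FormalAlg I Θ} {m : I ⊕ I →₀ ℕ} (h : AgreeBelow m.degree F F')
    (c : Gen I Θ) : opSeries q T F c m - F c m = opSeries q T F' c m - F' c m := by
  have e : ∀ G : FormalAlg I Θ, opSeries q T G c m - G c m =
      ∑ k ∈ range m.degree, q (k + 1) * MvPowerSeries.coeff m (T^[k + 1] G c) := by
    intro G
    change (∑ k ∈ range (m.degree + 1), q k * MvPowerSeries.coeff m (T^[k] G c)) - G c m = _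
    rw [Finset.sum_range_succ', hq, one_mul]
    exact add_sub_cancel_right _ _
  rw [e, e]
  refine Finset.sum_congr rfl fun k _ => ?_
  congr 1
  exact h.iterate hT (k + 1) c m (by omega)

lemma AgreeBelow.opSeries {T : FormalAlg I Θ → FormalAlg I Θ}
    (hT : ∀ N F F', AgreeBelow N F F' → AgreeBelow (N + 1) (T F) (T F')) {q : ℕ → ℂ}
    (hq : q 0 = 1) {F F' : FormalAlg I Θ} {N : ℕ} (h : AgreeBelow N F F') :
    AgreeBelow N (opSeries q T F) (opSeries q T F') := by
  intro c m hm
  have h1 := AgreeBelow.opSeries_sub hT hq (m := m) (F := F) (F' := F')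
    (fun c m' hm' => h c m' (hm'.trans hm)) c
  rwa [h c m hm, sub_left_inj] at h1

lemma dexpNeg_zero' : dexpNeg 0 = 1 := by simp [dexpNeg]

/-- The form `g⁻¹δg` is the displacement itself plus corrections from lower-order coefficients, so
the raising and lowering components of the equation determine the field order by order. -/
lemma IsFormalActionField.unique {D : RootDecomposition L Δ I Θ} {y : L} {V V' : FormalField I}
    (h : D.IsFormalActionField y V) (h' : D.IsFormalActionField y V') : V = V' := by
  have hZ : ∀ N F F', AgreeBelow N F F' → AgreeBelow (N + 1) (D.adZ F) (D.adZ F') :=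
    fun N F F' h => h.formalAd (D := D) _ _
  have hA : ∀ N F F', AgreeBelow N F F' → AgreeBelow (N + 1) (D.adA F) (D.adA F') :=
    fun N F F' h => h.formalAd (D := D) _ _
  have key : ∀ (N : ℕ) (m : I ⊕ I →₀ ℕ), m.degree = N → ∀ j, V j m = V' j m := by
    intro N
    induction N using Nat.strong_induction_on with
    | _ N ih =>
      intro m hm
      let F : FormalField I → FormalAlg I Θ := fun V =>
        Sum.elim (fun i => V (Sum.inl i)) (fun _ => 0)
      let G : FormalField I → FormalAlg I Θ := fun V =>
        Sum.elim (fun _ => 0) (Sum.elim (fun _ => 0) (fun i => V (Sum.inr i)))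
      have hF : AgreeBelow m.degree (F V) (F V') := by
        rintro (i | i) m' hm'
        · exact ih _ (hm ▸ hm') m' rfl _
        · rfl
      have hG : AgreeBelow m.degree (G V) (G V') := by
        rintro (i | i | i) m' hm'
        · rfl
        · rfl
        · exact ih _ (hm ▸ hm') m' rfl _
      have hmc : ∀ c, D.formalMaurerCartan V c m - (F V c m + G V c m) =
          D.formalMaurerCartan V' c m - (F V' c m + G V' c m) := by
        intro c
        have h1 := AgreeBelow.opSeries_sub hZ dexpNeg_zero' hF c
        have h2 := AgreeBelow.opSeries_sub hA expNeg_zero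
          (hF.opSeries hZ dexpNeg_zero') c
        have h3 := AgreeBelow.opSeries_sub hA dexpNeg_zero' hG c
        change opSeries expNeg D.adA (opSeries dexpNeg D.adZ (F V)) c m +
            opSeries dexpNeg D.adA (G V) c m - _ =
          opSeries expNeg D.adA (opSeries dexpNeg D.adZ (F V')) c m +
            opSeries dexpNeg D.adA (G V') c m - _
        linear_combination h1 + h2 + h3
      rintro (i | i)
      · have h1 := hmc (Gen.raise i)
        rw [(h i).1, (h' i).1, sub_right_inj] at h1
        change V (Sum.inl i) m + 0 = V' (Sum.inl i) m + 0 at h1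
        rwa [add_zero, add_zero] at h1
      · have h1 := hmc (Gen.lower i)
        rw [(h i).2, (h' i).2, sub_right_inj] at h1
        change 0 + V (Sum.inr i) m = 0 + V' (Sum.inr i) m at h1
        rwa [zero_add, zero_add] at h1
  funext j m
  exact key _ m rfl j

/-! ## The connection on the formal chart -/

section Series

variable [DecidableEq I]

/-- An operator of Cauchy type is linear over functions; a form whose components are its values on
the raising generators is therefore contracted with a field by applying the operator to `δZ`. -/
lemma formalContract_eq_of_isCauchy {T : VecPS (I ⊕ I) L →ₗ[ℂ] VecPS (I ⊕ I) ℂ}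
    (hT : IsCauchy T) (W : VecPS (I ⊕ I) (I ⊕ I →₀ ℂ)) :
    formalContract (fun i => toMv (T (VecPS.const (D.J (Gen.raise i))))) (toField W) =
      toMv (T (fieldDeriv W D.zSer)) := by
  ext n
  rw [psCoeff_eq, formalContract_toField_apply, coeff_toMv, hT, zSer, fieldDeriv_linear]
  refine Eq.trans ?_ (Finsupp.sum_antidiagonal_swap n fun p q =>
    T (VecPS.const (mapCoeff (Finsupp.linearCombination ℂ D.zGen) W p)) q)
  refine Finset.sum_congr rfl fun p _ => ?_
  rw [mapCoeff_apply, Finsupp.linearCombination_apply, Finsupp.sum, Finsupp.sum, map_sum, map_sum,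
    VecPS.sum_apply]
  refine Finset.sum_congr rfl fun j _ => ?_
  rw [map_smul, map_smul]
  change _ = W p.1 j * _
  rcases j with i | i
  · rfl
  · simp [zGen]

/-- the operator whose values on the raising generators are the components of the connection form -/
def connOp (b : L →ₗ[ℂ] ℂ) : VecPS (I ⊕ I) L →ₗ[ℂ] VecPS (I ⊕ I) ℂ :=
  -Complex.I • (mapCoeff b ∘ₗ expAd D.aSer ∘ₗ dexpAd D.zSer)

lemma isCauchy_connOp (b : L →ₗ[ℂ] ℂ) : IsCauchy (D.connOp b) := by
  have h : IsCauchy (mapCoeff b ∘ₗ expAd D.aSer ∘ₗ dexpAd D.zSer) :=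
    (isCauchy_mapCoeff b).comp ((isCauchy_adSeries _ D.aSer_mem).comp
      (isCauchy_adSeries _ D.zSer_mem))
  intro F m
  rw [connOp, LinearMap.smul_apply]
  change -Complex.I • (mapCoeff b ∘ₗ expAd D.aSer ∘ₗ dexpAd D.zSer) F m = _
  rw [h F m, Finset.smul_sum]
  rfl

/-- the components of the connection form -/
def connForm (b : L →ₗ[ℂ] ℂ) (i : I) : FormalFun I :=
  toMv (D.connOp b (VecPS.const (D.J (Gen.raise i))))

variable {D} {b : L →ₗ[ℂ] ℂ}

/-- Along the action of `y`, the logarithmic derivative of `e^Z` is `n(y) = e^{-ad Z} y - w(y)`, and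
`b` evaluates `e^{-ad A} w(y)` to `bSer` by `bSer_eq`. -/
lemma IsCartanFunctional.formalContract_connForm (hb : D.IsCartanFunctional b) (y : L) :
    formalContract (D.connForm b) (toField (D.actionField y)) =
      toMv (-Complex.I • (D.momentSer b y - D.bSer b y)) := by
  unfold connForm
  rw [D.formalContract_eq_of_isCauchy (D.isCauchy_connOp b), fieldDeriv_actionField_zSer, connOp,
    LinearMap.smul_apply, LinearMap.comp_apply, LinearMap.comp_apply, dexpAd_vSer, hb.bSer_eq,
    momentSer, eSer_eq_add, map_add, map_add, add_sub_cancel_right]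

variable [Fintype Δ] [Finite Θ]

lemma C_mul_toMv (r : ℂ) (F : VecPS (I ⊕ I) ℂ) :
    MvPowerSeries.C r * toMv F = toMv (r • F) := by
  ext n
  rw [MvPowerSeries.coeff_C_mul]
  rfl

/-- The moment map cancels between `-A_y` and `iΦ_y`. What is left is `-i⟨b, e^{-ad Z} y⟩`, a
function of `z` alone. -/
lemma IsCartanFunctional.formalContract_add_ofPoly (hb : D.IsCartanFunctional b) (y : L) :
    ofPoly (D.famLin (D.orbitFun b) y) =
      -formalContract (D.connForm b) (toField (D.actionField y)) +
        MvPowerSeries.C Complex.I * D.formalPhi b y := by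
  rw [hb.formalContract_connForm, hb.ofPoly_famLin_orbitFun, D.formalPhi_eq hb, mul_neg, C_mul_toMv,
    ← map_neg, ← map_neg, ← map_smul, ← map_add]
  congr 1
  simp only [neg_smul, smul_sub]
  abel

lemma formalDeriv_one (V : FormalField I) : formalDeriv V (ofPoly 1) = 0 := by
  rw [formalDeriv_ofPoly, ← map_one MvPolynomial.C, MvPolynomial.vars_C, Finset.sum_empty]

end Series

variable [Fintype Δ] [Finite Θ] {b : L →ₗ[ℂ] ℂ}

variable {D} in
lemma IsCartanFunctional.isFormalOrbitGauge_orbitFun (hb : D.IsCartanFunctional b) :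
    D.IsFormalOrbitGauge b (D.orbitFun b) := by
  classical
  refine ⟨fun y => toField (D.actionField y), D.isFormalActionField_actionField, D.connForm b,
    fun y y' => ?_, fun y ψ => ?_⟩
  · rw [hb.formalContract_connForm, hb.formalContract_connForm, hb.formalContract_connForm,
      formalDeriv_toField, formalDeriv_toField, D.formalPhi_eq hb, mul_neg, C_mul_toMv,
      ← map_neg toMv, ← map_neg toMv, ← map_add toMv, ← map_add toMv]
    congr 1
    rw [map_smul, map_smul, map_sub, map_sub, hb.fieldDeriv_momentSer, hb.fieldDeriv_momentSer]
    -- The two derivatives of the moment map add up to twice the same term, one for `A_{[y,y']}` and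
    -- one for `iΦ_{[y,y']}`; the rest is the cocycle identity multiplied by `-i`.
    have h1 := hb.fieldDeriv_bSer_sub y y'
    have h2 : D.momentSer b ⁅y', y⁆ = -D.momentSer b ⁅y, y'⁆ := by
      rw [← lie_skew]
      change mapCoeff b (expAd D.aSer (expAd D.zSer (VecPS.const (-_)))) = _
      simp only [map_neg]
      rfl
    rw [h2]
    linear_combination (norm := skip) (-Complex.I) • h1
    simp only [smul_sub, smul_neg, neg_smul, neg_neg]
    abel
  · have h1 := D.ofPoly_xiLin y ψ
    have h2 := hb.formalContract_add_ofPoly y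
    rw [← ofPolyHom_apply, map_add, map_mul, ofPolyHom_apply, ofPolyHom_apply, ofPolyHom_apply,
      h1, h2]
    ring

lemma eq_zero_of_isWeightedHomogeneous {p : MvPolynomial I ℂ} {d : Δ → ℤ} (hd : ¬ 0 ≤ d)
    (hp : MvPolynomial.IsWeightedHomogeneous D.varDeg p d) : p = 0 := by
  by_contra h
  obtain ⟨m, hm⟩ := MvPolynomial.exists_coeff_ne_zero h
  refine hd ?_
  rw [← hp hm, Finsupp.weight_apply]
  exact Finset.sum_nonneg fun i _ => nsmul_nonneg (D.varDeg_nonneg i) _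

/-- At the base point the field of `J_i` is `∂/∂z_i`, so the contraction is `A_i` plus terms in
which `A` enters with coefficients of lower order. -/
lemma formalContract_actionField_raise [DecidableEq I] (A : I → FormalFun I) (i : I)
    (n : I ⊕ I →₀ ℕ) :
    formalContract A (toField (D.actionField (D.J (Gen.raise i)))) n = A i n +
      ∑ p ∈ (antidiagonal n).erase (0, n), (D.actionField (D.J (Gen.raise i)) p.1).sum fun j r =>
        r * (Sum.elim (fun i => A i p.2) (fun _ => 0) j : ℂ) := by
  rw [formalContract_toField_apply, ← Finset.add_sum_erase _ _
    (mem_antidiagonal.2 (zero_add n) : ((0, n) : (I ⊕ I →₀ ℕ) × (I ⊕ I →₀ ℕ)) ∈ antidiagonal n)]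
  congr 1
  have hE : D.eSer (D.J (Gen.raise i)) 0 = D.J (Gen.raise i) := by
    rw [eSer, adSeries_apply]
    simp [expNeg_zero]
  have h1 : D.vSer (D.J (Gen.raise i)) 0 = D.J (Gen.raise i) := by
    rw [vSer, adSeries_apply]
    have hN : D.nSer (D.J (Gen.raise i)) 0 = D.J (Gen.raise i) := by
      rw [nSer, mapCoeff_apply, hE]
      exact D.projDeg_eq_self (D.J_mem_gradedPart (Set.mem_ofPred.2 (D.deg_raise_pos i)))
    simp [hN, bernoulliNeg]
  have h2 : D.uSer (D.J (Gen.raise i)) 0 = 0 := by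
    rw [uSer, adSeries_apply]
    have hw : D.wSer (D.J (Gen.raise i)) 0 = 0 := by
      rw [wSer, nSer, VecPS.sub_apply, mapCoeff_apply, hE,
        D.projDeg_eq_self (D.J_mem_gradedPart (Set.mem_ofPred.2 (D.deg_raise_pos i))), sub_self]
    have hw' : expAd D.aSer (D.wSer (D.J (Gen.raise i))) 0 = 0 := by
      rw [adSeries_apply]; simp [hw]
    simp [hw']
  have h3 : D.actionField (D.J (Gen.raise i)) 0 = Finsupp.single (Sum.inl i) 1 := by
    rw [actionField, mapCoeff_apply, VecPS.add_apply, h1, h2, add_zero]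
    classical
    ext j
    rw [chartCoord_apply, Module.Basis.repr_self, Finsupp.single_apply, Finsupp.single_apply]
    rcases j with j | j
    · simp [chartGen]
    · simp [chartGen]
  rw [h3, Finsupp.sum_single_index] <;> simp

/-- A form of type `(1,0)` is determined by its contractions with the vector fields of the raising
generators. -/
lemma eq_of_formalContract_raise_eq [DecidableEq I] {A A' : I → FormalFun I}
    (h : ∀ i, formalContract A (toField (D.actionField (D.J (Gen.raise i)))) =
      formalContract A' (toField (D.actionField (D.J (Gen.raise i))))) : A = A' := by
  have key : ∀ (N : ℕ) (n : I ⊕ I →₀ ℕ), n.degree = N → ∀ i, A i n = A' i n := by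
    intro N
    induction N using Nat.strong_induction_on with
    | _ N ih =>
      intro n hn i
      have h1 := congrFun (h i) n
      rw [formalContract_actionField_raise, formalContract_actionField_raise] at h1
      refine add_right_cancel (h1.trans (congrArg _ ?_))
      refine Finset.sum_congr rfl fun p hp => Finset.sum_congr rfl fun j _ => ?_
      rw [mem_erase, mem_antidiagonal] at hp
      have hlt : p.2.degree < N := by
        have h2 : p.1.degree + p.2.degree = N := by rw [← map_add, hp.2, hn]
        have h3 : p.1.degree ≠ 0 := fun h0 => by
          have h4 := (Finsupp.degree_eq_zero_iff _).1 h0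
          refine hp.1 (Prod.ext h4 ?_)
          rw [← hp.2, h4, zero_add]
        omega
      rcases j with j | j
      · simp only [Sum.elim_inl, ih _ hlt p.2 rfl j]
      · rfl
  funext i n
  exact key _ n rfl i

variable {D} in
-- There are no nonzero polynomials of negative degree, so homogeneity forces `f` to vanish on
-- raising generators. This prescribes the connection on their fields, hence the connection, and
-- then `f` by applying the operators to the constant function.
lemma IsCartanFunctional.eq_orbitFun (hb : D.IsCartanFunctional b)
    {f : Gen I Θ → MvPolynomial I ℂ} (hf : D.IsHomogeneousFamily f)
    (hg : D.IsFormalOrbitGauge b f) : f = D.orbitFun b := by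
  classical
  obtain ⟨V, hV, A, -, hA⟩ := hg
  obtain rfl : V = fun y => toField (D.actionField y) :=
    funext fun y => (hV y).unique (D.isFormalActionField_actionField y)
  have h1 : ∀ y, ofPoly (D.famLin f y) =
      -formalContract A (toField (D.actionField y)) +
        MvPowerSeries.C Complex.I * D.formalPhi b y := by
    intro y
    have h := hA y 1
    have hone : ofPoly (1 : MvPolynomial I ℂ) = 1 := by rw [← ofPolyHom_apply, map_one]
    have hder : D.xiLin y 1 = 0 := Derivation.map_one_eq_zero _
    rwa [formalDeriv_one, hone, hder, zero_add, mul_one, mul_one, mul_one, neg_zero, zero_sub] at h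
  obtain rfl : A = D.connForm b := by
    refine D.eq_of_formalContract_raise_eq fun i => ?_
    have h2 := h1 (D.J (Gen.raise i))
    have h3 := hb.formalContract_add_ofPoly (D.J (Gen.raise i))
    have hz : f (Gen.raise i) = 0 := by
      refine D.eq_zero_of_isWeightedHomogeneous (fun h => ?_) (hf (Gen.raise i))
      exact absurd (D.deg_raise_pos i) (not_lt_of_ge (neg_nonneg.1 h))
    rw [famLin_J, hz] at h2
    rw [famLin_J, hb.orbitFun_raise] at h3
    exact neg_injective (add_right_cancel (h2.symm.trans h3))
  funext a
  apply ofPoly_injective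
  rw [← D.famLin_J f, ← D.famLin_J (D.orbitFun b), h1, hb.formalContract_add_ofPoly]

end RootDecomposition

end CoadjointOrbit

end



noncomputable section

namespace CoadjointOrbit

set_option linter.unusedSectionVars false

open Finset hiding antidiagonal mem_antidiagonal

open Finset.HasAntidiagonal

open LieAlgebra (ad)

open VecPS (bernoulliNeg sum_bernoulliNeg_mul_dexpNeg)

namespace RootDecomposition

universe u v w x

section Lists

variable {I : Type w} [Fintype I]

/-- the lists of length `k` -/
def listsLen (I : Type w) [Fintype I] (k : ℕ) : Finset (List I) :=
  (List.finite_length_eq I k).toFinset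

lemma mem_listsLen {k : ℕ} {l : List I} : l ∈ listsLen I k ↔ l.length = k := by
  simp [listsLen]

lemma listsLen_zero : listsLen I 0 = {[]} := by
  ext l; simp [mem_listsLen]

lemma sum_listsLen_succ {M : Type*} [AddCommMonoid M] (k : ℕ) (G : List I → M) :
    ∑ l ∈ listsLen I (k + 1), G l = ∑ l ∈ listsLen I k, ∑ i, G (l ++ [i]) := by
  rw [← Finset.sum_product']
  symm
  refine Finset.sum_of_injOn (fun x => x.1 ++ [x.2]) ?_ ?_ ?_ ?_
  · rintro ⟨l, i⟩ _ ⟨l', i'⟩ _ h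
    obtain ⟨h1, h2⟩ := List.append_inj' h rfl
    simp at h1 h2
    rw [h1, h2]
  · rintro ⟨l, i⟩ h
    simp only [coe_product, Set.mem_prod, mem_coe, mem_listsLen] at h
    simp [mem_listsLen, h.1]
  · intro l hl hl'
    rcases List.eq_nil_or_concat l with rfl | ⟨l, i, rfl⟩
    · simp [mem_listsLen] at hl
    · refine absurd ⟨(l, i), ?_, ?_⟩ hl'
      · simpa [mem_listsLen] using hl
      · simp
  · intros; rfl

lemma eval_listPoly {g : List I → ℂ} {K : ℕ} (hg : ∀ l, K ≤ l.length → g l = 0) (z : I → ℂ) :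
    MvPolynomial.eval z (listPoly g) =
      ∑ k ∈ range K, ∑ l ∈ listsLen I k, g l * (l.map z).prod := by
  classical
  rw [listPoly_eq_sum (S := (range K).biUnion (listsLen I)), Finset.sum_biUnion, map_sum]
  · refine Finset.sum_congr rfl fun k _ => ?_
    rw [map_sum]
    refine Finset.sum_congr rfl fun l _ => ?_
    rw [map_mul, MvPolynomial.eval_C, map_list_prod, List.map_map]
    congr 3
    funext i
    simp
  · intro k _ k' _ hne
    refine Finset.disjoint_left.2 fun l hl hl' => hne ?_
    rw [← mem_listsLen.1 hl, mem_listsLen.1 hl']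
  · intro l hl
    simp only [coe_biUnion, Set.mem_iUnion, mem_coe, mem_range, mem_listsLen]
    exact ⟨l.length, not_le.1 fun h => hl (hg l h), rfl⟩

end Lists

variable {L : Type u} [LieRing L] [LieAlgebra ℂ L] {Δ : Type v} [DecidableEq Δ]
  {I : Type w} {Θ : Type x} (D : RootDecomposition L Δ I Θ)

variable [Fintype Δ] [Fintype I]

/-! ## Nilpotency of the positive part -/

/-- the elements all of whose components have height at least `h` -/
abbrev level (h : ℤ) : Submodule ℂ L := D.gradedPart {d | h ≤ ∑ s, d s}

/-- the element `∑ z_i J_i` -/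
def zElt (z : I → ℂ) : L := ∑ i, z i • D.J (Gen.raise i)

/-- a bound for the order of nilpotency of `ad (∑ z_i J_i)` -/
def nilIndex : ℕ := 2 * ∑ i, D.height i + 1

lemma raise_mem_level (i : I) : D.J (Gen.raise i) ∈ D.level 1 := by
  refine D.J_mem_gradedPart (Set.mem_ofPred.2 ?_)
  have h1 : ∑ t, D.deg (Gen.raise i) t = D.height i := D.sum_varDeg i
  have h2 := D.height_pos i
  omega

lemma zElt_mem_level (z : I → ℂ) : D.zElt z ∈ D.level 1 :=
  Submodule.sum_mem _ fun i _ => Submodule.smul_mem _ _ (D.raise_mem_level i)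

lemma zElt_mem_posPart (z : I → ℂ) : D.zElt z ∈ D.posPart :=
  Submodule.sum_mem _ fun i _ => Submodule.smul_mem _ _
    (D.J_mem_gradedPart (Set.mem_ofPred.2 (D.deg_raise_pos i)))

lemma lie_mem_level {h h' h'' : ℤ} (hh : h'' ≤ h + h') {y y' : L} (hy : y ∈ D.level h)
    (hy' : y' ∈ D.level h') : ⁅y, y'⁆ ∈ D.level h'' := by
  refine D.lie_mem_gradedPart (fun a ha b hb => Set.mem_ofPred.2 ?_) y hy y' hy'
  rw [Set.mem_ofPred] at ha hb
  simp only [Pi.add_apply, Finset.sum_add_distrib]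
  omega

lemma mem_level_bot (y : L) : y ∈ D.level (-(∑ i, D.height i : ℕ)) := by
  intro c _
  rw [Set.mem_ofPred]
  rcases c with i | h | i
  · have h1 : ∑ t, D.deg (Gen.raise i) t = D.height i := D.sum_varDeg i
    change _ ≤ ∑ t, D.deg (Gen.raise i) t
    omega
  · change _ ≤ ∑ t, D.deg (Gen.cartan h) t
    rw [deg_cartan]
    simp only [Pi.zero_apply, Finset.sum_const_zero]
    omega
  · have h1 := D.sum_deg_lower i
    have h2 : D.height i ≤ ∑ i, D.height i :=
      Finset.single_le_sum (f := D.height) (fun _ _ => Nat.zero_le _) (Finset.mem_univ i)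
    change _ ≤ ∑ t, D.deg (Gen.lower i) t
    omega

lemma eq_zero_of_mem_level {h : ℤ} (hh : (∑ i, D.height i : ℕ) < h) {y : L}
    (hy : y ∈ D.level h) : y = 0 := by
  apply D.J.repr.injective
  ext c
  rw [map_zero, Finsupp.zero_apply]
  by_contra hc
  have h1 := Set.mem_ofPred.1 (hy c hc)
  rcases c with i | k | i
  · have h2 : D.height i ≤ ∑ i, D.height i :=
      Finset.single_le_sum (f := D.height) (fun _ _ => Nat.zero_le _) (Finset.mem_univ i)
    have h3 : ∑ t, D.deg (Gen.raise i) t = D.height i := D.sum_varDeg i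
    change h ≤ ∑ t, D.deg (Gen.raise i) t at h1
    omega
  · change h ≤ ∑ t, D.deg (Gen.cartan k) t at h1
    rw [deg_cartan] at h1
    simp only [Pi.zero_apply, Finset.sum_const_zero] at h1
    omega
  · have h3 := D.sum_deg_lower i
    change h ≤ ∑ t, D.deg (Gen.lower i) t at h1
    omega

lemma ad_pow_mem_level (z : I → ℂ) {h : ℤ} {y : L} (hy : y ∈ D.level h) (k : ℕ) :
    ((ad ℂ L (D.zElt z)) ^ k) y ∈ D.level (h + k) := by
  induction k with
  | zero => simpa using hy
  | succ k ih =>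
    rw [pow_succ', Module.End.mul_apply, LieAlgebra.ad_apply]
    exact D.lie_mem_level (by push_cast; omega) (D.zElt_mem_level z) ih

/-- The heights of all generators lie between `-H` and `H`, with `H` the sum of the heights of the
positive generators; `2H + 1` steps upwards leave this range. -/
lemma ad_zElt_pow_eq_zero (z : I → ℂ) {k : ℕ} (hk : D.nilIndex ≤ k) :
    (ad ℂ L (D.zElt z)) ^ k = 0 := by
  refine LinearMap.ext fun y => D.eq_zero_of_mem_level ?_ (D.ad_pow_mem_level z (D.mem_level_bot y) k)
  rw [nilIndex] at hk
  omega

lemma iterAd_eq_zero {l : List I} (hl : D.nilIndex ≤ l.length) (y : L) : D.iterAd l y = 0 := by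
  have h : ∀ l : List I, D.iterAd l y ∈ D.level (-(∑ i, D.height i : ℕ) + l.length) := by
    intro l
    induction l using List.reverseRecOn with
    | nil => simpa [iterAd] using D.mem_level_bot y
    | append_singleton l i ih =>
      rw [iterAd_concat]
      refine D.lie_mem_level ?_ (D.raise_mem_level i) ih
      rw [List.length_append, List.length_singleton]
      push_cast
      omega
  refine D.eq_zero_of_mem_level ?_ (h l)
  rw [nilIndex] at hl
  omega

/-! ## Power series in `ad (∑ z_i J_i)` -/

/-- `∑ q_k (ad Z)^k` for `Z = ∑ z_i J_i` -/
def adPoly (q : ℕ → ℂ) (z : I → ℂ) : L →ₗ[ℂ] L :=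
  ∑ k ∈ range D.nilIndex, q k • (ad ℂ L (D.zElt z)) ^ k

lemma adPoly_eq (q : ℕ → ℂ) (z : I → ℂ) {K : ℕ} (hK : D.nilIndex ≤ K) :
    D.adPoly q z = ∑ k ∈ range K, q k • (ad ℂ L (D.zElt z)) ^ k := by
  rw [adPoly]
  refine Finset.sum_subset (range_mono hK) fun k _ hk => ?_
  rw [mem_range, not_lt] at hk
  rw [D.ad_zElt_pow_eq_zero z hk, smul_zero]

lemma adPoly_apply (q : ℕ → ℂ) (z : I → ℂ) (y : L) {K : ℕ} (hK : D.nilIndex ≤ K) :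
    D.adPoly q z y = ∑ k ∈ range K, q k • ((ad ℂ L (D.zElt z)) ^ k) y := by
  rw [D.adPoly_eq q z hK, LinearMap.sum_apply]
  rfl

/-- If `i + j ≥ 2 * nilIndex`, one of the two powers already vanishes by nilpotency; this explains
the range of summation. The map `T` in between will be the positive projection or the identity. -/
lemma adPoly_comp_eq_sum (q q' : ℕ → ℂ) (z : I → ℂ) (T : L →ₗ[ℂ] L) (y : L) :
    D.adPoly q z (T (D.adPoly q' z y)) = ∑ k ∈ range (2 * D.nilIndex),
      ∑ p ∈ antidiagonal k, (q p.1 * q' p.2) •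
        ((ad ℂ L (D.zElt z)) ^ p.1) (T (((ad ℂ L (D.zElt z)) ^ p.2) y)) := by
  have h : D.nilIndex ≤ 2 * D.nilIndex := by omega
  rw [D.adPoly_apply q z _ h, D.adPoly_apply q' z y h]
  simp only [map_sum, map_smul, Finset.smul_sum, smul_smul]
  refine sum_range_mul_eq_sum_antidiagonal _ (fun i j => (q i * q' j) •
    ((ad ℂ L (D.zElt z)) ^ i) (T (((ad ℂ L (D.zElt z)) ^ j) y))) fun i j hij => ?_
  rcases le_or_gt D.nilIndex i with hi | hi
  · rw [D.ad_zElt_pow_eq_zero z hi, LinearMap.zero_apply, smul_zero]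
  · rw [D.ad_zElt_pow_eq_zero z (k := j) (by omega), LinearMap.zero_apply, map_zero, map_zero,
      smul_zero]

lemma adPoly_dexpNeg_bernoulliNeg (z : I → ℂ) (y : L) :
    D.adPoly dexpNeg z (D.adPoly bernoulliNeg z y) = y := by
  have h := D.adPoly_comp_eq_sum dexpNeg bernoulliNeg z LinearMap.id y
  simp only [LinearMap.id_apply] at h
  rw [h, Finset.sum_eq_single 0]
  · simp [dexpNeg, bernoulliNeg]
  · intro k _ hk
    have h1 : ∀ p ∈ antidiagonal k, (dexpNeg p.1 * bernoulliNeg p.2) •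
        ((ad ℂ L (D.zElt z)) ^ p.1) (((ad ℂ L (D.zElt z)) ^ p.2) y) =
        (dexpNeg p.1 * bernoulliNeg p.2) • ((ad ℂ L (D.zElt z)) ^ k) y := by
      intro p hp
      rw [mem_antidiagonal] at hp
      rw [← Module.End.mul_apply, ← pow_add, hp]
    rw [Finset.sum_congr rfl h1, ← Finset.sum_smul]
    have h2 := sum_bernoulliNeg_mul_dexpNeg k
    rw [if_neg hk, ← Finset.Nat.sum_antidiagonal_swap] at h2
    rw [Finset.sum_congr rfl fun p _ => mul_comm (dexpNeg p.1) (bernoulliNeg p.2)]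
    erw [h2]
    rw [zero_smul]
  · intro h
    exact absurd (mem_range.2 (by rw [nilIndex]; omega)) h

/-- The counterpart for numerical `z` of the expansion over words on the formal chart. -/
lemma ad_zElt_pow_map (φ : L →ₗ[ℂ] L) (z : I → ℂ) (y : L) (i j : ℕ) :
    ((ad ℂ L (D.zElt z)) ^ i) (φ (((ad ℂ L (D.zElt z)) ^ j) y)) =
      ∑ l ∈ listsLen I (i + j), (l.map z).prod • D.iterAd (l.drop j) (φ (D.iterAd (l.take j) y)) := by
  have key : ∀ (k : ℕ) (G : List I → L), ⁅D.zElt z, ∑ l ∈ listsLen I k, (l.map z).prod • G l⁆ =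
      ∑ l ∈ listsLen I k, ∑ i, ((l ++ [i]).map z).prod • ⁅D.J (Gen.raise i), G l⁆ := by
    intro k G
    rw [zElt, lie_sum]
    refine Finset.sum_congr rfl fun l _ => ?_
    rw [sum_lie]
    refine Finset.sum_congr rfl fun i _ => ?_
    rw [smul_lie, lie_smul, smul_smul, List.map_append, List.prod_append, List.map_singleton,
      List.prod_singleton, mul_comm]
  induction i with
  | zero =>
    rw [pow_zero, Module.End.one_apply, zero_add]
    have h0 : ((ad ℂ L (D.zElt z)) ^ j) y =
        ∑ l ∈ listsLen I j, (l.map z).prod • D.iterAd l y := by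
      induction j with
      | zero => simp [listsLen_zero, iterAd]
      | succ j ih =>
        rw [pow_succ', Module.End.mul_apply, LieAlgebra.ad_apply, ih, key, sum_listsLen_succ]
        simp only [iterAd_concat]
    rw [h0, map_sum]
    refine Finset.sum_congr rfl fun l hl => ?_
    rw [mem_listsLen] at hl
    rw [map_smul, ← hl, List.drop_length, List.take_length]
    rfl
  | succ i ih =>
    rw [pow_succ', Module.End.mul_apply, LieAlgebra.ad_apply, ih, key, add_right_comm,
      sum_listsLen_succ]
    refine Finset.sum_congr rfl fun l hl => Finset.sum_congr rfl fun i' _ => ?_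
    rw [mem_listsLen] at hl
    rw [List.drop_append_of_le_length (by omega), List.take_append_of_le_length (by omega),
      iterAd_concat]

lemma ad_zElt_pow (z : I → ℂ) (y : L) (k : ℕ) : ((ad ℂ L (D.zElt z)) ^ k) y =
    ∑ l ∈ listsLen I k, (l.map z).prod • D.iterAd l y := by
  have h := D.ad_zElt_pow_map LinearMap.id z y 0 k
  rw [pow_zero, Module.End.one_apply, zero_add, LinearMap.id_apply] at h
  rw [h]
  refine Finset.sum_congr rfl fun l hl => ?_
  rw [mem_listsLen] at hl
  rw [← hl, List.drop_length, List.take_length]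
  rfl

/-- evaluation of polynomials as a linear map -/
def evalLin (z : I → ℂ) : MvPolynomial I ℂ →ₗ[ℂ] ℂ := (MvPolynomial.aeval z).toLinearMap

lemma evalLin_apply (z : I → ℂ) (p : MvPolynomial I ℂ) : evalLin z p = MvPolynomial.eval z p := by
  rw [evalLin, AlgHom.toLinearMap_apply, MvPolynomial.aeval_eq_eval]

lemma eval_famLin_orbitFun (b : L →ₗ[ℂ] ℂ) (z : I → ℂ) (y : L) :
    MvPolynomial.eval z (D.famLin (D.orbitFun b) y) = -Complex.I * b (D.adPoly expNeg z y) := by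
  have : evalLin z ∘ₗ D.famLin (D.orbitFun b) = -Complex.I • (b ∘ₗ D.adPoly expNeg z) := by
    refine D.J.ext fun a => ?_
    rw [LinearMap.comp_apply, evalLin_apply, famLin_J, orbitFun,
      eval_listPoly (K := D.nilIndex) fun l hl => by rw [D.iterAd_eq_zero hl, map_zero, mul_zero]]
    change _ = -Complex.I • b (D.adPoly expNeg z (D.J a))
    rw [D.adPoly_apply _ _ _ le_rfl, map_sum, Finset.smul_sum]
    refine Finset.sum_congr rfl fun k _ => ?_
    rw [map_smul, ad_zElt_pow, map_sum, Finset.smul_sum, Finset.smul_sum]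
    refine Finset.sum_congr rfl fun l hl => ?_
    rw [mem_listsLen] at hl
    rw [map_smul, hl]
    simp only [smul_eq_mul]
    ring
  rw [← evalLin_apply]
  exact LinearMap.congr_fun this y

/-- the displacement of `∑ z_i J_i` by the action of `y` -/
def dispZ (z : I → ℂ) : L →ₗ[ℂ] L :=
  D.adPoly bernoulliNeg z ∘ₗ D.projPos ∘ₗ D.adPoly expNeg z

/-- The same comparison of weights as in `ofPoly_fieldCoef`, with nilpotency in the place of the
grading by monomials. -/
lemma eval_xiLin_X (z : I → ℂ) (y : L) (i : I) :
    MvPolynomial.eval z (D.xiLin y (MvPolynomial.X i)) =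
      -D.J.repr (D.dispZ z y) (Gen.raise i) := by
  let ev : Derivation ℂ (MvPolynomial I ℂ) (MvPolynomial I ℂ) →ₗ[ℂ] MvPolynomial I ℂ :=
    { toFun := fun d => d (MvPolynomial.X i), map_add' := fun _ _ => rfl,
      map_smul' := fun _ _ => rfl }
  have : evalLin z ∘ₗ ev ∘ₗ D.xiLin = -(D.J.coord (Gen.raise i) ∘ₗ D.dispZ z) := by
    refine D.J.ext fun a => ?_
    change evalLin z (D.xiLin (D.J a) (MvPolynomial.X i)) = -D.J.coord _ (D.adPoly bernoulliNeg z
      (D.projPos (D.adPoly expNeg z (D.J a))))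
    rw [evalLin_apply, xiLin_J, xi, MvPolynomial.mkDerivation_X, fieldCoef, ← listPoly,
      eval_listPoly (K := 2 * D.nilIndex) fun l hl => by
        rw [Ccoef, D.iterAd_eq_zero (by omega), map_zero, Finsupp.zero_apply, mul_zero],
      adPoly_comp_eq_sum, map_sum, ← Finset.sum_neg_distrib]
    refine Finset.sum_congr rfl fun k _ => ?_
    have h1 : ∀ p ∈ antidiagonal k, (bernoulliNeg p.1 * expNeg p.2) •
        ((ad ℂ L (D.zElt z)) ^ p.1) (D.projPos (((ad ℂ L (D.zElt z)) ^ p.2) (D.J a))) =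
        ∑ l ∈ listsLen I k, (bernoulliNeg p.1 * expNeg p.2) • (l.map z).prod •
          D.iterAd (l.drop p.2) (D.projPos (D.iterAd (l.take p.2) (D.J a))) := by
      intro p hp
      rw [mem_antidiagonal] at hp
      rw [ad_zElt_pow_map, hp, Finset.smul_sum]
    rw [Finset.sum_congr rfl h1, Finset.sum_comm, map_sum, ← Finset.sum_neg_distrib]
    refine Finset.sum_congr rfl fun l hl => ?_
    rw [mem_listsLen] at hl
    rw [map_sum, ← neg_neg (beta _ _), neg_beta, hl, neg_mul, neg_mul, Finset.sum_mul,
      Finset.sum_mul]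
    congr 1
    refine Finset.sum_congr rfl fun p _ => ?_
    rw [map_smul, map_smul, Module.Basis.coord_apply, repr_iterAd_projPos]
    simp only [smul_eq_mul]
    split_ifs <;> ring
  rw [← evalLin_apply]
  exact LinearMap.congr_fun this y

end RootDecomposition

end CoadjointOrbit

end



noncomputable section

namespace CoadjointOrbit

set_option linter.unusedSectionVars false

open Finset hiding antidiagonal mem_antidiagonal

open Finset.HasAntidiagonal

open LieAlgebra (ad)

/-! ## Exponentials of matrices -/

section Matrices

variable {n : Type*} [Fintype n] [DecidableEq n]

lemma matrix_hasSum_exp (M : Matrix n n ℂ) :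
    HasSum (fun k : ℕ => ((k.factorial : ℂ)⁻¹) • M ^ k) (NormedSpace.exp M) := by
  -- An auxiliary submultiplicative norm; it induces the entrywise topology to which the statement
  -- refers.
  let _ : NormedRing (Matrix n n ℂ) := Matrix.linftyOpNormedRing
  let _ : NormedAlgebra ℂ (Matrix n n ℂ) := Matrix.linftyOpNormedAlgebra
  exact NormedSpace.exp_series_hasSum_exp' (𝕂 := ℂ) M

lemma matrix_hasDerivAt_exp_smul (M : Matrix n n ℂ) :
    HasDerivAt (fun ε : ℝ => NormedSpace.exp (ε • M)) M 0 := by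
  let _ : NormedRing (Matrix n n ℂ) := Matrix.linftyOpNormedRing
  let _ : NormedAlgebra ℝ (Matrix n n ℂ) := Matrix.linftyOpNormedAlgebra
  have h := hasDerivAt_exp_smul_const (𝕂 := ℝ) M (0 : ℝ)
  rw [zero_smul, NormedSpace.exp_zero, one_mul] at h
  exact h

lemma matrix_hasDerivAt_mul {F G : ℝ → Matrix n n ℂ} {F' G' : Matrix n n ℂ} {t : ℝ}
    (hF : HasDerivAt F F' t) (hG : HasDerivAt G G' t) :
    HasDerivAt (fun ε : ℝ => F ε * G ε) (F' * G t + F t * G') t := by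
  let _ : NormedRing (Matrix n n ℂ) := Matrix.linftyOpNormedRing
  let _ : NormedAlgebra ℝ (Matrix n n ℂ) := Matrix.linftyOpNormedAlgebra
  exact HasDerivAt.mul hF hG

lemma matrix_hasDerivAt_iff {F : ℝ → Matrix n n ℂ} {F' : Matrix n n ℂ} {t : ℝ} :
    HasDerivAt F F' t ↔ ∀ c d, HasDerivAt (fun ε => F ε c d) (F' c d) t := by
  have h1 : HasDerivAt F F' t ↔ @HasDerivAt ℝ _ (n → n → ℂ) _ _ _ _ F F' t := Iff.rfl
  exact h1.trans (hasDerivAt_pi.trans (forall_congr' fun c => hasDerivAt_pi))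

lemma matrix_hasDerivAt_unique {F : ℝ → Matrix n n ℂ} {F' G' : Matrix n n ℂ} {t : ℝ}
    (hF : HasDerivAt F F' t) (hG : HasDerivAt F G' t) : F' = G' := by
  ext c d
  exact (matrix_hasDerivAt_iff.1 hF c d).unique (matrix_hasDerivAt_iff.1 hG c d)

lemma matrix_hasDerivAt_congr {F : ℝ → Matrix n n ℂ} {F' G' : Matrix n n ℂ} {t : ℝ}
    (hF : HasDerivAt F F' t) (h : F' = G') : HasDerivAt F G' t := h ▸ hF

end Matrices

namespace RootDecomposition

universe u v w x

variable {L : Type u} [LieRing L] [LieAlgebra ℂ L] {Δ : Type v} [DecidableEq Δ]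
  {I : Type w} {Θ : Type x} (D : RootDecomposition L Δ I Θ)

variable [Fintype I] [Fintype Θ] [DecidableEq I] [DecidableEq Θ]

/-- the endomorphism with the given matrix -/
def op : Matrix (Gen I Θ) (Gen I Θ) ℂ ≃ₐ[ℂ] (L →ₗ[ℂ] L) := Matrix.toLinAlgEquiv D.J

lemma repr_op (M : Matrix (Gen I Θ) (Gen I Θ) ℂ) (x : L) (c : Gen I Θ) :
    D.J.repr (D.op M x) c = ∑ d, M c d * D.J.repr x d := by
  have h := Matrix.repr_toLin D.J D.J M x
  exact congrFun h c

lemma op_adMat (y : L) : D.op (D.adMat y) = ad ℂ L y :=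
  Matrix.toLinAlgEquiv_toMatrixAlgEquiv D.J (ad ℂ L y)

lemma adMat_neg (y : L) : D.adMat (-y) = -D.adMat y := by
  rw [adMat, adMat, map_neg, map_neg]

lemma op_mul_apply (M N : Matrix (Gen I Θ) (Gen I Θ) ℂ) (x : L) :
    D.op (M * N) x = D.op M (D.op N x) := by rw [map_mul, Module.End.mul_apply]

lemma op_inv_op {M : Matrix (Gen I Θ) (Gen I Θ) ℂ} (hM : IsUnit M) (x : L) :
    D.op M⁻¹ (D.op M x) = x := by
  rw [← op_mul_apply, Matrix.nonsing_inv_mul _ ((Matrix.isUnit_iff_isUnit_det M).1 hM), map_one,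
    Module.End.one_apply]

lemma op_op_inv {M : Matrix (Gen I Θ) (Gen I Θ) ℂ} (hM : IsUnit M) (x : L) :
    D.op M (D.op M⁻¹ x) = x := by
  rw [← op_mul_apply, Matrix.mul_nonsing_inv _ ((Matrix.isUnit_iff_isUnit_det M).1 hM), map_one,
    Module.End.one_apply]

/-- `L` carries no topology, so convergence and derivatives are tested on linear functionals, which
separate points. -/
lemma eq_of_forall_apply {x x' : L} (h : ∀ φ : L →ₗ[ℂ] ℂ, φ x = φ x') : x = x' := by
  rw [← sub_eq_zero, ← Module.forall_dual_apply_eq_zero_iff ℂ]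
  exact fun φ => by rw [map_sub, h, sub_self]

lemma apply_eq_sum {M : Type*} [AddCommGroup M] [Module ℂ M] (φ : L →ₗ[ℂ] M) (x : L) :
    φ x = ∑ c, D.J.repr x c • φ (D.J c) := by
  conv_lhs => rw [← D.J.sum_repr x]
  rw [map_sum]
  simp only [map_smul]

/-- Since `expTerm` is adapted to `e^{-ad}`, the series of `e^{ad y}` is taken at `-y`, and the
algebraic identity `expTerm_lie` applies to it. -/
lemma expTerm_neg_apply (y x : L) (k : ℕ) :
    expTerm (-y) k x = ((k.factorial : ℂ)⁻¹) • ((ad ℂ L y) ^ k) x := by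
  have h : (ad ℂ L (-y)) ^ k = (-1 : ℂ) ^ k • (ad ℂ L y) ^ k := by
    rw [map_neg, ← smul_pow, neg_one_smul]
  rw [expTerm, LinearMap.smul_apply, h, LinearMap.smul_apply, smul_smul, expNeg, div_mul_eq_mul_div,
    ← mul_pow, neg_one_mul, neg_neg, one_pow, one_div]

/-- the exponential series of `ad y`, weakly -/
lemma hasSum_op_exp (y x : L) (φ : L →ₗ[ℂ] ℂ) :
    HasSum (fun k => φ (expTerm (-y) k x)) (φ (D.op (NormedSpace.exp (D.adMat y)) x)) := by
  let Φ : Matrix (Gen I Θ) (Gen I Θ) ℂ →ₗ[ℂ] ℂ :=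
    φ ∘ₗ LinearMap.applyₗ x ∘ₗ D.op.toLinearMap
  have hΦ : Continuous Φ := LinearMap.continuous_of_finiteDimensional Φ
  have h := (matrix_hasSum_exp (D.adMat y)).map Φ.toAddMonoidHom hΦ
  refine h.congr_fun ?_
  intro k
  change φ _ = φ (D.op (((k.factorial : ℂ)⁻¹) • D.adMat y ^ k) x)
  rw [map_smul, map_pow, op_adMat, expTerm_neg_apply, LinearMap.smul_apply]

lemma hasSum_mul_antidiagonal {a b : ℕ → ℂ} {A B : ℂ} (ha : HasSum a A) (hb : HasSum b B) :
    HasSum (fun k => ∑ p ∈ antidiagonal k, a p.1 * b p.2) (A * B) := by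
  have ha' := summable_norm_iff.2 ha.summable
  have hb' := summable_norm_iff.2 hb.summable
  have h := (summable_norm_sum_mul_antidiagonal_of_summable_norm ha' hb').of_norm.hasSum
  rwa [← tsum_mul_tsum_eq_tsum_sum_antidiagonal_of_summable_norm ha' hb', ha.tsum_eq,
    hb.tsum_eq] at h

lemma apply_lie_eq_sum (φ : L →ₗ[ℂ] ℂ) (x x' : L) :
    φ ⁅x, x'⁆ = ∑ c, ∑ d, D.J.repr x c * D.J.repr x' d * φ ⁅D.J c, D.J d⁆ := by
  have h1 := D.apply_eq_sum (φ ∘ₗ (LieModule.toEnd ℂ L L : L →ₗ[ℂ] L →ₗ[ℂ] L).flip x') x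
  refine h1.trans (Finset.sum_congr rfl fun c _ => ?_)
  have h2 := D.apply_eq_sum (φ ∘ₗ ad ℂ L (D.J c)) x'
  refine (congrArg _ h2).trans ?_
  rw [Finset.smul_sum]
  refine Finset.sum_congr rfl fun d _ => ?_
  simp only [smul_eq_mul, LinearMap.comp_apply, LieAlgebra.ad_apply, mul_assoc]

/-- the operators `e^{ad y}` are automorphisms of the Lie algebra -/
lemma op_exp_lie (y x x' : L) :
    D.op (NormedSpace.exp (D.adMat y)) ⁅x, x'⁆ =
      ⁅D.op (NormedSpace.exp (D.adMat y)) x, D.op (NormedSpace.exp (D.adMat y)) x'⁆ := by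
  refine eq_of_forall_apply fun φ => ?_
  refine (D.hasSum_op_exp y ⁅x, x'⁆ φ).unique ?_
  rw [D.apply_lie_eq_sum]
  -- The automorphism property holds order by order; written in components it is a Cauchy product of
  -- absolutely convergent scalar series.
  have h : ∀ k, φ (expTerm (-y) k ⁅x, x'⁆) = ∑ c, ∑ d, (∑ p ∈ antidiagonal k,
      D.J.coord c (expTerm (-y) p.1 x) * D.J.coord d (expTerm (-y) p.2 x')) *
        φ ⁅D.J c, D.J d⁆ := by
    intro k
    rw [expTerm_lie, map_sum, Finset.sum_congr rfl fun p _ => D.apply_lie_eq_sum φ _ _,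
      Finset.sum_comm]
    refine Finset.sum_congr rfl fun c _ => ?_
    rw [Finset.sum_comm]
    refine Finset.sum_congr rfl fun d _ => ?_
    rw [Finset.sum_mul]
    rfl
  simp only [h]
  exact hasSum_sum fun c _ => hasSum_sum fun d _ =>
    (hasSum_mul_antidiagonal (D.hasSum_op_exp y x _) (D.hasSum_op_exp y x' _)).mul_right _

/-! ## The groups -/

/-- The submonoids generated by exponentials are groups because the sets of exponents are stable
under negation. -/
lemma isUnit_and_inv_mem_closure {P : L → Prop} (hP : ∀ y, P y → P (-y))
    {g : Matrix (Gen I Θ) (Gen I Θ) ℂ}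
    (hg : g ∈ Submonoid.closure {M | ∃ y, P y ∧ M = NormedSpace.exp (D.adMat y)}) :
    IsUnit g ∧ g⁻¹ ∈ Submonoid.closure {M | ∃ y, P y ∧ M = NormedSpace.exp (D.adMat y)} := by
  induction hg using Submonoid.closure_induction with
  | mem g hg =>
    obtain ⟨y, hy, rfl⟩ := hg
    refine ⟨Matrix.isUnit_exp _, Submonoid.subset_closure ⟨-y, hP y hy, ?_⟩⟩
    rw [adMat_neg, Matrix.exp_neg]
  | one => exact ⟨isUnit_one, by rw [inv_one]; exact Submonoid.one_mem _⟩
  | mul g h _ _ ihg ihh =>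
    refine ⟨ihg.1.mul ihh.1, ?_⟩
    rw [Matrix.mul_inv_rev]
    exact Submonoid.mul_mem _ ihh.2 ihg.2

lemma op_lie_of_mem_closure {P : L → Prop} {g : Matrix (Gen I Θ) (Gen I Θ) ℂ}
    (hg : g ∈ Submonoid.closure {M | ∃ y, P y ∧ M = NormedSpace.exp (D.adMat y)}) (x x' : L) :
    D.op g ⁅x, x'⁆ = ⁅D.op g x, D.op g x'⁆ := by
  induction hg using Submonoid.closure_induction generalizing x x' with
  | mem g hg =>
    obtain ⟨y, -, rfl⟩ := hg
    exact D.op_exp_lie y x x'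
  | one => simp
  | mul g h _ _ ihg ihh => rw [op_mul_apply, op_mul_apply, op_mul_apply, ihh, ihg]

/-- the real form is preserved by the compact group -/
lemma sigma_op {σ : L →ₛₗ[starRingEnd ℂ] L} (hσ : ∀ y y', σ ⁅y, y'⁆ = ⁅σ y, σ y'⁆)
    {g : Matrix (Gen I Θ) (Gen I Θ) ℂ} (hg : g ∈ D.compactGroup σ) (x : L) :
    σ (D.op g x) = D.op g (σ x) := by
  induction hg using Submonoid.closure_induction generalizing x with
  | mem g hg =>
    obtain ⟨y, hy, rfl⟩ := hg
    refine eq_of_forall_apply fun φ => ?_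
    -- `φ ∘ σ` is conjugate-linear; its complex conjugate is a linear functional, to which the weak
    -- exponential series applies.
    let ψ : L →ₗ[ℂ] ℂ :=
      { toFun := fun x => starRingEnd ℂ (φ (σ x))
        map_add' := fun x x' => by rw [map_add, map_add, map_add]
        map_smul' := fun r x => by
          rw [LinearMap.map_smulₛₗ, map_smul, smul_eq_mul, map_mul, Complex.conj_conj]; rfl }
    have hψ : ∀ x, starRingEnd ℂ (ψ x) = φ (σ x) := fun x => Complex.conj_conj _
    have h1 := (D.hasSum_op_exp y x ψ).map (starRingEnd ℂ).toAddMonoidHom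
      Complex.continuous_conj
    have h2 : HasSum (fun k => φ (σ (expTerm (-y) k x)))
        (φ (σ (D.op (NormedSpace.exp (D.adMat y)) x))) := by
      rw [← hψ]
      refine h1.congr_fun fun k => ?_
      rw [← hψ]
      rfl
    refine h2.unique ((D.hasSum_op_exp y (σ x) φ).congr_fun fun k => ?_)
    have hpow : ∀ k, σ (((ad ℂ L y) ^ k) x) = ((ad ℂ L y) ^ k) (σ x) := by
      intro k
      induction k with
      | zero => rfl
      | succ k ih =>
        rw [pow_succ', Module.End.mul_apply, Module.End.mul_apply, LieAlgebra.ad_apply,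
          LieAlgebra.ad_apply, hσ, ih, hy]
    rw [expTerm_neg_apply, expTerm_neg_apply, LinearMap.map_smulₛₗ, hpow, map_inv₀, map_natCast]
  | one => simp
  | mul g h _ _ ihg ihh => rw [op_mul_apply, ihg, ihh, op_mul_apply]

/-! ## The Borel subalgebra -/

lemma mem_nonposPart_iff {y : L} : y ∈ D.nonposPart ↔ ∀ i, D.J.repr y (Gen.raise i) = 0 := by
  refine ⟨fun h i => ?_, fun h c hc => ?_⟩
  · by_contra hi
    exact absurd (D.deg_raise_pos i) (not_lt_of_ge (Set.mem_ofPred.1 (h _ hi)))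
  · rcases c with i | k | i
    · exact absurd (h i) hc
    · exact Set.mem_ofPred.2 le_rfl
    · exact Set.mem_ofPred.2 (D.deg_lower_neg i).le

lemma borel_eq : D.borel = D.nonposPart := by
  apply le_antisymm
  · refine Submodule.span_le.2 ?_
    rintro _ ⟨c, rfl⟩
    refine D.J_mem_gradedPart (Set.mem_ofPred.2 ?_)
    rcases c with h | i
    · exact le_rfl
    · exact (D.deg_lower_neg i).le
  · intro y hy
    rw [← D.J.sum_repr y]
    refine Submodule.sum_mem _ fun c _ => ?_
    rcases c with i | c
    · have h := D.mem_nonposPart_iff.1 hy i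
      rw [Gen.raise] at h
      rw [h, zero_smul]
      exact Submodule.zero_mem _
    · exact Submodule.smul_mem _ _ (Submodule.subset_span ⟨c, rfl⟩)

lemma ad_pow_mem_nonposPart {y x : L} (hy : y ∈ D.nonposPart) (hx : x ∈ D.nonposPart) (k : ℕ) :
    ((ad ℂ L y) ^ k) x ∈ D.nonposPart := by
  induction k with
  | zero => exact hx
  | succ k ih =>
    rw [pow_succ', Module.End.mul_apply, LieAlgebra.ad_apply]
    exact D.lie_nonposPart y hy _ ih

lemma op_mem_nonposPart {g : Matrix (Gen I Θ) (Gen I Θ) ℂ} (hg : g ∈ D.borelGroup) {x : L}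
    (hx : x ∈ D.nonposPart) : D.op g x ∈ D.nonposPart := by
  induction hg using Submonoid.closure_induction generalizing x with
  | mem g hg =>
    obtain ⟨y, hy, rfl⟩ := hg
    rw [borel_eq] at hy
    refine D.mem_nonposPart_iff.2 fun i => ?_
    refine (D.hasSum_op_exp y x (D.J.coord (Gen.raise i))).unique ?_
    refine hasSum_zero.congr_fun fun k => ?_
    rw [expTerm_neg_apply, map_smul, Module.Basis.coord_apply,
      D.mem_nonposPart_iff.1 (D.ad_pow_mem_nonposPart hy hx k) i, smul_zero]
  | one => simpa using hx
  | mul g h _ _ ihg ihh => rw [op_mul_apply]; exact ihg (ihh hx)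

variable {D} in
-- As `b` is a character of the Borel subalgebra, all terms of the exponential series but the zeroth
-- are annihilated. This invariance lets an arbitrary element of `B⁻` take over the role of
-- `e^{-A}`.
lemma IsCartanFunctional.apply_op {b : L →ₗ[ℂ] ℂ} (hb : D.IsCartanFunctional b)
    {g : Matrix (Gen I Θ) (Gen I Θ) ℂ} (hg : g ∈ D.borelGroup) {x : L}
    (hx : x ∈ D.nonposPart) : b (D.op g x) = b x := by
  induction hg using Submonoid.closure_induction generalizing x with
  | mem g hg =>
    obtain ⟨y, hy, rfl⟩ := hg
    rw [borel_eq] at hy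
    refine (D.hasSum_op_exp y x b).unique ?_
    have h := hasSum_single (f := fun k => b (expTerm (-y) k x)) 0 fun k hk => by
      obtain ⟨k, rfl⟩ := Nat.exists_eq_succ_of_ne_zero hk
      rw [expTerm_neg_apply, pow_succ', Module.End.mul_apply, LieAlgebra.ad_apply, map_smul,
        hb.apply_lie_nonposPart hy (D.ad_pow_mem_nonposPart hy hx k), smul_zero]
    simpa using h
  | one => simp
  | mul g h hg hh ihg ihh =>
    rw [op_mul_apply, ihg (D.op_mem_nonposPart hh hx), ihh hx]

/-! ## The matrices `exp (∑ z_i J_i)` -/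

variable [Fintype Δ]

lemma zElt_neg (z : I → ℂ) : D.zElt (-z) = -D.zElt z := by
  simp [zElt]

lemma expZ_eq (z : I → ℂ) : D.expZ z = NormedSpace.exp (D.adMat (D.zElt z)) := rfl

lemma isUnit_expZ (z : I → ℂ) : IsUnit (D.expZ z) := Matrix.isUnit_exp _

lemma expZ_neg (z : I → ℂ) : D.expZ (-z) = (D.expZ z)⁻¹ := by
  rw [expZ_eq, expZ_eq, zElt_neg, adMat_neg, Matrix.exp_neg]

lemma op_expZ (z : I → ℂ) : D.op (D.expZ z) = D.adPoly expNeg (-z) := by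
  refine LinearMap.ext fun x => eq_of_forall_apply fun φ => ?_
  refine (D.hasSum_op_exp (D.zElt z) x φ).unique ?_
  rw [D.adPoly_apply _ _ _ le_rfl, map_sum, zElt_neg]
  refine hasSum_sum_of_ne_finset_zero fun k hk => ?_
  rw [mem_range, not_lt] at hk
  rw [expTerm, ← zElt_neg, D.ad_zElt_pow_eq_zero _ hk, smul_zero, LinearMap.zero_apply, map_zero]

lemma op_expZ_inv (z : I → ℂ) : D.op (D.expZ z)⁻¹ = D.adPoly expNeg z := by
  rw [← expZ_neg, op_expZ, neg_neg]

lemma op_expZ_lie (z : I → ℂ) (x x' : L) :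
    D.op (D.expZ z) ⁅x, x'⁆ = ⁅D.op (D.expZ z) x, D.op (D.expZ z) x'⁆ := D.op_exp_lie _ x x'

end RootDecomposition

end CoadjointOrbit

end



noncomputable section

namespace CoadjointOrbit

set_option linter.unusedSectionVars false

open Finset hiding antidiagonal mem_antidiagonal

open Finset.HasAntidiagonal

open LieAlgebra (ad)

open VecPS (bernoulliNeg)

/-! ## Derivatives of curves in the Lie algebra -/

/-- the curve `F` in a finite-dimensional space has the derivative `F'` at `0` -/
def HasWeakDeriv {V : Type*} [AddCommGroup V] [Module ℂ V] (F : ℝ → V) (F' : V) : Prop :=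
  ∀ φ : V →ₗ[ℂ] ℂ, HasDerivAt (fun t => φ (F t)) (φ F') 0

namespace HasWeakDeriv

section Module

variable {V W : Type*} [AddCommGroup V] [Module ℂ V] [AddCommGroup W] [Module ℂ W]
  {F G : ℝ → V} {F' G' : V}

lemma unique (hF : HasWeakDeriv F F') (hG : HasWeakDeriv G G')
    (h : ∀ᶠ t in nhds (0 : ℝ), F t = G t) : F' = G' := by
  rw [← sub_eq_zero, ← Module.forall_dual_apply_eq_zero_iff ℂ]
  intro φ
  rw [map_sub, sub_eq_zero]
  refine (hF φ).unique ((hG φ).congr_of_eventuallyEq ?_)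
  filter_upwards [h] with t ht
  rw [ht]

lemma congr_deriv (hF : HasWeakDeriv F F') (h : F' = G') : HasWeakDeriv F G' := h ▸ hF

protected lemma const (y : V) : HasWeakDeriv (fun _ => y) 0 := fun φ => by
  rw [map_zero]; exact hasDerivAt_const _ _

lemma map (hF : HasWeakDeriv F F') (T : V →ₗ[ℂ] W) : HasWeakDeriv (fun t => T (F t)) (T F') :=
  fun φ => hF (φ ∘ₗ T)

lemma add (hF : HasWeakDeriv F F') (hG : HasWeakDeriv G G') :
    HasWeakDeriv (fun t => F t + G t) (F' + G') := fun φ => by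
  simp only [map_add]; exact (hF φ).add (hG φ)

lemma neg (hF : HasWeakDeriv F F') : HasWeakDeriv (fun t => -F t) (-F') := fun φ => by
  simp only [map_neg]; exact (hF φ).neg

lemma const_smul (hF : HasWeakDeriv F F') (r : ℂ) :
    HasWeakDeriv (fun t => r • F t) (r • F') := fun φ => by
  simp only [map_smul, smul_eq_mul]; exact (hF φ).const_mul r

lemma sum {J : Type*} {s : Finset J} {F : J → ℝ → V} {F' : J → V}
    (hF : ∀ j ∈ s, HasWeakDeriv (F j) (F' j)) :
    HasWeakDeriv (fun t => ∑ j ∈ s, F j t) (∑ j ∈ s, F' j) := fun φ => by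
  simp only [map_sum]; exact HasDerivAt.fun_sum fun j hj => hF j hj φ

lemma ofReal_smul (y : V) : HasWeakDeriv (fun t => (t : ℂ) • y) y := fun φ => by
  simp only [map_smul, smul_eq_mul]
  have h := ((hasDerivAt_id (0 : ℝ)).ofReal_comp).mul_const (φ y)
  simpa using h

lemma apply {ι : Type*} [Fintype ι] (B : Module.Basis ι ℂ V) {T : ℝ → V →ₗ[ℂ] W}
    {T' : V →ₗ[ℂ] W} (hT : ∀ y, HasWeakDeriv (fun t => T t y) (T' y)) (hF : HasWeakDeriv F F') :
    HasWeakDeriv (fun t => T t (F t)) (T' (F 0) + T 0 F') := fun φ => by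
  have e : ∀ (S : V →ₗ[ℂ] W) (y : V), φ (S y) = ∑ c, B.coord c y * φ (S (B c)) := by
    intro S y
    conv_lhs => rw [← B.sum_repr y]
    simp only [map_sum, map_smul, smul_eq_mul]
    rfl
  rw [map_add, e T', e (T 0), ← Finset.sum_add_distrib]
  have h : (fun t => φ (T t (F t))) = fun t => ∑ c, B.coord c (F t) * φ (T t (B c)) := by
    funext t; exact e (T t) (F t)
  rw [h]
  refine HasDerivAt.fun_sum fun c _ => ?_
  rw [add_comm]
  exact (hF (B.coord c)).mul (hT (B c) φ)

end Module

lemma lie {L : Type*} [LieRing L] [LieAlgebra ℂ L] {ι : Type*} [Fintype ι]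
    (B : Module.Basis ι ℂ L) {F G : ℝ → L} {F' G' : L} (hF : HasWeakDeriv F F')
    (hG : HasWeakDeriv G G') :
    HasWeakDeriv (fun t => ⁅F t, G t⁆) (⁅F', G 0⁆ + ⁅F 0, G'⁆) :=
  apply B (T := fun t => ad ℂ L (F t)) (T' := ad ℂ L F')
    (fun y => hF.map ((LieModule.toEnd ℂ L L : L →ₗ[ℂ] L →ₗ[ℂ] L).flip y)) hG

end HasWeakDeriv

namespace RootDecomposition

universe u v w x

variable {L : Type u} [LieRing L] [LieAlgebra ℂ L] {Δ : Type v} [DecidableEq Δ]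
  {I : Type w} {Θ : Type x} (D : RootDecomposition L Δ I Θ)

variable [Fintype I] [Fintype Θ] [DecidableEq I] [DecidableEq Θ]

lemma coord_op_J (M : Matrix (Gen I Θ) (Gen I Θ) ℂ) (c d : Gen I Θ) :
    D.J.coord c (D.op M (D.J d)) = M c d := by
  rw [Module.Basis.coord_apply, repr_op, Module.Basis.repr_self, Finset.sum_eq_single d]
  · simp
  · intro e _ he
    rw [Finsupp.single_apply, if_neg he.symm, mul_zero]
  · simp

lemma matrix_eq_of_op_eq {M N : Matrix (Gen I Θ) (Gen I Θ) ℂ}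
    (h : ∀ x, D.op M x = D.op N x) : M = N := D.op.injective (LinearMap.ext h)

lemma hasDerivAt_of_hasWeakDeriv {F : ℝ → Matrix (Gen I Θ) (Gen I Θ) ℂ}
    {F' : Matrix (Gen I Θ) (Gen I Θ) ℂ}
    (h : ∀ x, HasWeakDeriv (fun t => D.op (F t) x) (D.op F' x)) : HasDerivAt F F' 0 := by
  rw [matrix_hasDerivAt_iff]
  intro c d
  have := h (D.J d) (D.J.coord c)
  simpa only [coord_op_J] using this

lemma hasWeakDeriv_of_hasDerivAt {F : ℝ → Matrix (Gen I Θ) (Gen I Θ) ℂ}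
    {F' : Matrix (Gen I Θ) (Gen I Θ) ℂ} (h : ∀ c d, HasDerivAt (fun t => F t c d) (F' c d) 0)
    (x : L) : HasWeakDeriv (fun t => D.op (F t) x) (D.op F' x) := fun φ => by
  have e : ∀ M, φ (D.op M x) = ∑ c, (∑ d, M c d * D.J.repr x d) * φ (D.J c) := by
    intro M
    rw [D.apply_eq_sum φ]
    simp only [repr_op, smul_eq_mul]
  simp only [e]
  exact HasDerivAt.fun_sum fun c _ => (HasDerivAt.fun_sum fun d _ =>
    (h c d).mul_const _).mul_const _

variable [Fintype Δ]

lemma zElt_add_smul (z U : I → ℂ) (t : ℝ) :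
    D.zElt (z + t • U) = D.zElt z + (t : ℂ) • D.zElt U := by
  simp only [zElt, Pi.add_apply, Pi.smul_apply, add_smul, Finset.sum_add_distrib, Finset.smul_sum,
    smul_smul, Complex.real_smul]

lemma hasWeakDeriv_zElt (z U : I → ℂ) :
    HasWeakDeriv (fun t : ℝ => D.zElt (z + t • U)) (D.zElt U) := by
  simp only [zElt_add_smul]
  exact ((HasWeakDeriv.const _).add (HasWeakDeriv.ofReal_smul _)).congr_deriv (zero_add _)

/-- the derivative of the terms of `e^{-ad Z} F` in the direction `U` -/
def expTermDeriv (Z U F : L) : ℕ → L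
  | 0 => 0
  | k + 1 => ((k + 1 : ℕ) : ℂ)⁻¹ • (-⁅U, expTerm Z k F⁆ - ⁅Z, expTermDeriv Z U F k⁆)

lemma expTerm_succ_eq (Z F : L) (k : ℕ) :
    expTerm Z (k + 1) F = ((k + 1 : ℕ) : ℂ)⁻¹ • -⁅Z, expTerm Z k F⁆ := by
  rw [← expTerm_succ, inv_smul_smul₀]
  exact_mod_cast k.succ_ne_zero

lemma hasWeakDeriv_expTerm (z U : I → ℂ) (x : L) (k : ℕ) :
    HasWeakDeriv (fun t : ℝ => expTerm (D.zElt (z + t • U)) k x)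
      (expTermDeriv (D.zElt z) (D.zElt U) x k) := by
  induction k with
  | zero =>
    simp only [expTerm_zero]
    exact HasWeakDeriv.const _
  | succ k ih =>
    simp only [expTerm_succ_eq]
    refine (((D.hasWeakDeriv_zElt z U).lie D.J ih).neg.const_smul _).congr_deriv ?_
    simp only [expTermDeriv, zero_smul, add_zero]
    rw [neg_add, sub_eq_add_neg]

/-- the derivative of `e^{-ad Z} x` -/
lemma hasWeakDeriv_adPoly_expNeg (z U : I → ℂ) (x : L) :
    HasWeakDeriv (fun t : ℝ => D.adPoly expNeg (z + t • U) x)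
      (-⁅D.adPoly dexpNeg z (D.zElt U), D.adPoly expNeg z x⁆) := by
  have hK : D.nilIndex ≤ 2 * D.nilIndex := by omega
  -- One term more than `2 * nilIndex`: the zeroth has derivative zero, and the others match the
  -- convolution of two nilpotent series.
  have h1 : ∀ z, D.adPoly expNeg z x =
      ∑ k ∈ range (2 * D.nilIndex + 1), expTerm (D.zElt z) k x := fun z =>
    D.adPoly_apply expNeg z x (by omega)
  have h2 : HasWeakDeriv (fun t : ℝ => D.adPoly expNeg (z + t • U) x)
      (∑ k ∈ range (2 * D.nilIndex + 1), expTermDeriv (D.zElt z) (D.zElt U) x k) := by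
    simp only [h1]
    exact HasWeakDeriv.sum fun k _ => D.hasWeakDeriv_expTerm z U x k
  refine h2.congr_deriv ?_
  have h3 : ∀ k, expTermDeriv (D.zElt z) (D.zElt U) x (k + 1) =
      -∑ p ∈ antidiagonal k, ⁅dexpTerm (D.zElt z) p.1 (D.zElt U), expTerm (D.zElt z) p.2 x⁆ := by
    intro k
    rw [expTerm_deriv (D.zElt z) (D.zElt U) x (expTermDeriv (D.zElt z) (D.zElt U) x) fun k => by
      rw [expTermDeriv, smul_inv_smul₀]; exact_mod_cast k.succ_ne_zero]
    rw [expTermDeriv, map_zero, zero_sub]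
  rw [Finset.sum_range_succ', expTermDeriv, add_zero, Finset.sum_congr rfl fun k _ => h3 k,
    Finset.sum_neg_distrib, D.adPoly_apply dexpNeg z _ hK, D.adPoly_apply expNeg z _ hK,
    sum_lie]
  congr 1
  symm
  rw [Finset.sum_congr rfl fun i _ => lie_sum _ _ _]
  refine sum_range_mul_eq_sum_antidiagonal _ (fun i j =>
    ⁅dexpTerm (D.zElt z) i (D.zElt U), expTerm (D.zElt z) j x⁆) fun i j hij => ?_
  rcases le_or_gt D.nilIndex i with hi | hi
  · rw [dexpTerm, D.ad_zElt_pow_eq_zero z hi, smul_zero, LinearMap.zero_apply, zero_lie]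
  · rw [expTerm, D.ad_zElt_pow_eq_zero z (k := j) (by omega), smul_zero, LinearMap.zero_apply,
      lie_zero]

lemma dispZ_mem (z : I → ℂ) (y : L) : D.dispZ z y ∈ D.posPart := by
  rw [dispZ, LinearMap.comp_apply, D.adPoly_apply _ _ _ le_rfl]
  refine Submodule.sum_mem _ fun k hk => Submodule.smul_mem _ _ ?_
  clear hk
  induction k with
  | zero => exact D.projDeg_mem _ _
  | succ k ih =>
    rw [pow_succ', Module.End.mul_apply, LieAlgebra.ad_apply]
    exact D.lie_posPart _ (D.zElt_mem_posPart z) _ ih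

/-- the vector field of the action of `y` -/
def actionVec (y : L) (z : I → ℂ) : I → ℂ := fun i => D.J.repr (D.dispZ z y) (Gen.raise i)

lemma actionVec_eq_neg_eval (y : L) (z : I → ℂ) (i : I) :
    D.actionVec y z i = -MvPolynomial.eval z (D.xiLin y (MvPolynomial.X i)) := by
  rw [eval_xiLin_X, neg_neg]
  rfl

lemma zElt_actionVec (y : L) (z : I → ℂ) : D.zElt (D.actionVec y z) = D.dispZ z y := by
  conv_rhs => rw [← D.J.sum_repr (D.dispZ z y)]
  rw [Fintype.sum_sum_type, zElt]
  refine (add_eq_left.2 (Finset.sum_eq_zero fun c _ => ?_)).symm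
  have h : D.J.repr (D.dispZ z y) (Sum.inr c) = 0 := by
    by_contra h
    have h1 := Set.mem_ofPred.1 (D.dispZ_mem z y _ h)
    rcases c with k | i
    · exact lt_irrefl _ h1
    · exact lt_asymm (D.deg_lower_neg i) h1
  rw [h, zero_smul]

lemma adPoly_dexpNeg_actionVec (y : L) (z : I → ℂ) :
    D.adPoly dexpNeg z (D.zElt (D.actionVec y z)) = D.projPos (D.adPoly expNeg z y) := by
  rw [zElt_actionVec, dispZ, LinearMap.comp_apply, adPoly_dexpNeg_bernoulliNeg,
    LinearMap.comp_apply]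

/-- The formula for `e^{-ad Z}` at `z` and at `-z` gives the derivatives of the inverse and of
`expZ` itself, the latter with the logarithmic derivative on the left. Differentiating the product
of the two, which is `1`, moves it to the right. -/
lemma hasDerivAt_expZ (z U : I → ℂ) :
    HasDerivAt (fun t : ℝ => D.expZ (z + t • U))
      (D.expZ z * D.adMat (D.adPoly dexpNeg z (D.zElt U))) 0 := by
  set F := fun t : ℝ => D.expZ (z + t • U) with hF
  set G := fun t : ℝ => (D.expZ (z + t • U))⁻¹ with hG
  set N := D.adPoly dexpNeg z (D.zElt U) with hN
  have hGd : HasDerivAt G (-(D.adMat N * (D.expZ z)⁻¹)) 0 := by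
    refine D.hasDerivAt_of_hasWeakDeriv fun x => ?_
    rw [map_neg, LinearMap.neg_apply, op_mul_apply, op_adMat, op_expZ_inv]
    simp only [hG, op_expZ_inv]
    exact D.hasWeakDeriv_adPoly_expNeg z U x
  have hFd : HasDerivAt F (-(D.adMat (D.adPoly dexpNeg (-z) (D.zElt (-U))) * D.expZ z)) 0 := by
    refine D.hasDerivAt_of_hasWeakDeriv fun x => ?_
    rw [map_neg, LinearMap.neg_apply, op_mul_apply, op_adMat, op_expZ]
    have h : ∀ t : ℝ, -(z + t • U) = -z + t • (-U) := fun t => by rw [neg_add, smul_neg]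
    simp only [hF, op_expZ, h]
    exact D.hasWeakDeriv_adPoly_expNeg (-z) (-U) x
  refine matrix_hasDerivAt_congr hFd ?_
  have h0 : F 0 = D.expZ z := by simp [hF]
  have h0' : G 0 = (D.expZ z)⁻¹ := by simp [hG]
  have hdet := fun z => (Matrix.isUnit_iff_isUnit_det _).1 (D.isUnit_expZ z)
  have hone : (fun t => F t * G t) = fun _ => 1 :=
    funext fun t => Matrix.mul_nonsing_inv _ (hdet _)
  have h1 := matrix_hasDerivAt_mul hFd hGd
  rw [hone] at h1
  replace h1 := matrix_hasDerivAt_unique h1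
    (G' := 0) (matrix_hasDerivAt_iff.2 fun c d => hasDerivAt_const _ _)
  rw [h0, h0', ← eq_neg_iff_add_eq_zero] at h1
  have h2 := congrArg (· * D.expZ z) h1
  simp only [neg_mul, mul_neg, neg_neg, mul_assoc, Matrix.nonsing_inv_mul _ (hdet z), mul_one] at h2
  rw [← h2]

/-- `y e^Z = e^Z (e^{-ad Z} y)`; the positive part of `e^{-ad Z} y` is absorbed by the displacement
of `z`, and the rest is the element `w` of the Borel subalgebra. -/
lemma isActionVector_actionVec (y : L) (z : I → ℂ) : D.IsActionVector y z (D.actionVec y z) := by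
  set E := D.adPoly expNeg z y with hE
  refine ⟨E - D.projPos E, ?_, ?_⟩
  · rw [borel_eq]
    exact D.sub_projPos_mem E
  set w := E - D.projPos E with hw
  have h1 : ∀ ε : ℝ, D.adMat (ε • w) = ε • D.adMat w := by
    intro ε
    rw [← Complex.coe_smul, adMat, adMat, map_smul, map_smul, Complex.coe_smul]
  simp only [h1]
  refine matrix_hasDerivAt_congr (matrix_hasDerivAt_mul
    (D.hasDerivAt_expZ z (D.actionVec y z)) (matrix_hasDerivAt_exp_smul (D.adMat w))) ?_
  rw [adPoly_dexpNeg_actionVec, ← hE, zero_smul, zero_smul, NormedSpace.exp_zero, mul_one, add_zero,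
    ← mul_add]
  have h2 : D.adMat (D.projPos E) + D.adMat w = D.adMat E := by
    rw [adMat, adMat, adMat, ← map_add, ← map_add, hw, add_sub_cancel]
  rw [h2]
  refine D.matrix_eq_of_op_eq fun x => ?_
  rw [op_mul_apply, op_mul_apply, op_adMat, op_adMat, LieAlgebra.ad_apply, LieAlgebra.ad_apply,
    op_expZ_lie, hE, ← op_expZ_inv, D.op_op_inv (D.isUnit_expZ z)]

end RootDecomposition

end CoadjointOrbit

end



noncomputable section

namespace CoadjointOrbit

set_option linter.unusedSectionVars false

open Finset hiding antidiagonal mem_antidiagonal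

open LieAlgebra (ad)

namespace RootDecomposition

universe u v w x

variable {L : Type u} [LieRing L] [LieAlgebra ℂ L] {Δ : Type v} [DecidableEq Δ]
  {I : Type w} {Θ : Type x} {D : RootDecomposition L Δ I Θ}

variable [Fintype I] [Fintype Θ] [DecidableEq I] [DecidableEq Θ]
  {σ : L →ₛₗ[starRingEnd ℂ] L}

/-! ## Consequences of the existence of a compact real form -/

namespace IsCompactRealForm

/-- For `x` in the radical of the Killing form let `2x = p - iq` with `p`, `q` real. Then the form
takes opposite values on `(p, p)` and `(q, q)`; both are nonpositive, so definiteness gives `p = q =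
0`. -/
lemma isKilling (hσ : D.IsCompactRealForm σ) : LieAlgebra.IsKilling ℂ L := by
  refine ⟨?_⟩
  rw [LieSubmodule.eq_bot_iff]
  intro x hx
  have hx0 : ∀ y, killingForm ℂ L x y = 0 := fun y => by
    have h := (LieIdeal.mem_killingCompl ℂ L ⊤).1 hx y (LieSubmodule.mem_top y)
    rwa [LieModule.traceForm_comm] at h
  set p := x + σ x with hp
  set q := Complex.I • (x - σ x) with hq
  have hpσ : σ p = p := by rw [hp, map_add, hσ.invol, add_comm]
  have hqσ : σ q = q := by
    rw [hq, LinearMap.map_smulₛₗ, map_sub, hσ.invol, Complex.conj_I, neg_smul, ← smul_neg, neg_sub]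
  have h2x : (2 : ℂ) • x = p - Complex.I • q := by
    rw [hp, hq, smul_smul, Complex.I_mul_I, neg_one_smul, two_smul]
    abel
  have h1 : ∀ y, killingForm ℂ L p y = Complex.I * killingForm ℂ L q y := fun y => by
    have h := hx0 y
    have h' : killingForm ℂ L ((2 : ℂ) • x) y = 0 := by
      rw [map_smul, LinearMap.smul_apply, h, smul_zero]
    rw [h2x, map_sub, map_smul, LinearMap.sub_apply, LinearMap.smul_apply, smul_eq_mul,
      sub_eq_zero] at h'
    exact h'
  have h3 : killingForm ℂ L p p = -killingForm ℂ L q q := by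
    rw [h1, LieModule.traceForm_comm ℂ L L q p, h1, ← mul_assoc, Complex.I_mul_I, neg_one_mul]
  have hneg : ∀ y, σ y = y → (killingForm ℂ L y y).re ≤ 0 := fun y hy => by
    by_cases h0 : y = 0
    · rw [h0, map_zero]; simp
    · exact (hσ.negDef y hy h0).le
  have h4 : (killingForm ℂ L p p).re = -(killingForm ℂ L q q).re := by rw [h3, Complex.neg_re]
  have hp0 : p = 0 := by
    by_contra h
    have := hσ.negDef p hpσ h
    have := hneg q hqσ
    linarith
  have hq0 : q = 0 := by
    by_contra h
    have := hσ.negDef q hqσ h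
    have := hneg p hpσ
    linarith
  rw [hp0, hq0, smul_zero, sub_zero] at h2x
  exact (smul_eq_zero.1 h2x).resolve_left two_ne_zero

lemma exists_eq_ad (hσ : D.IsCompactRealForm σ) (T : L →ₗ[ℂ] L)
    (hT : ∀ y y', T ⁅y, y'⁆ = ⁅T y, y'⁆ + ⁅y, T y'⁆) : ∃ x : L, ∀ y : L, T y = ⁅x, y⁆ := by
  have := hσ.isKilling
  have : Module.Finite ℂ L := Module.Finite.of_basis D.J
  let d : LieDerivation ℂ L L :=
    { T with
      leibniz' := fun a b => by
        change T ⁅a, b⁆ = ⁅a, T b⁆ - ⁅b, T a⁆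
        rw [hT, ← lie_skew b (T a)]
        abel }
  obtain ⟨x, hx⟩ := LieDerivation.IsKilling.exists_eq_ad d
  refine ⟨x, fun y => ?_⟩
  have h := DFunLike.congr_fun hx y
  rw [LieDerivation.ad_apply_apply] at h
  exact h.symm

lemma eq_of_lie_eq (hσ : D.IsCompactRealForm σ) {x x' : L} (h : ∀ y : L, ⁅x, y⁆ = ⁅x', y⁆) :
    x = x' := by
  have := hσ.isKilling
  have : Module.Finite ℂ L := Module.Finite.of_basis D.J
  rw [← sub_eq_zero, ← LieDerivation.IsKilling.ad_apply_eq_zero_iff ℂ L]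
  ext y
  rw [LieDerivation.ad_apply_apply, sub_lie, h, sub_self]
  rfl

variable [Fintype Δ]

variable (D) in
/-- the height of a generator -/
def genHeight (c : Gen I Θ) : ℤ := ∑ s, D.deg c s

lemma genHeight_pos_iff (c : Gen I Θ) : 0 < genHeight D c ↔ 0 < D.deg c := by
  rcases c with i | k | i
  · have h1 : genHeight D (Gen.raise i) = D.height i := D.sum_varDeg i
    have h2 := D.height_pos i
    exact iff_of_true (by change 0 < genHeight D (Gen.raise i); omega) (D.deg_raise_pos i)
  · refine iff_of_false ?_ (lt_irrefl _)
    change ¬ 0 < ∑ s, D.deg (Gen.cartan k) s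
    rw [deg_cartan]
    simp
  · have h1 : genHeight D (Gen.lower i) = -D.height i := D.sum_deg_lower i
    refine iff_of_false ?_ (lt_asymm (D.deg_lower_neg i))
    change ¬ 0 < genHeight D (Gen.lower i)
    omega

lemma genHeight_ne_zero {c : Gen I Θ} (h : D.deg c ≠ 0) : genHeight D c ≠ 0 := by
  rcases c with i | k | i
  · exact ((genHeight_pos_iff (D := D) _).2 (D.deg_raise_pos i)).ne'
  · exact absurd rfl h
  · have h1 : genHeight D (Gen.lower i) = -D.height i := D.sum_deg_lower i
    have h2 := D.height_pos i
    change genHeight D (Gen.lower i) ≠ 0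
    omega

variable (D) in
/-- `x` acts on the generators by multiplication with the height -/
def IsHeightElt (x : L) : Prop :=
  ∀ y c, D.J.repr ⁅x, y⁆ c = genHeight D c * D.J.repr y c

/-- The grading by height defines a derivation, and all derivations are inner. The resulting element
distinguishes raising, Cartan and lowering generators by the sign of an eigenvalue. -/
lemma exists_isHeightElt (hσ : D.IsCompactRealForm σ) : ∃ x, IsHeightElt D x := by
  let T : L →ₗ[ℂ] L := D.J.constr ℂ fun c => (genHeight D c : ℂ) • D.J c
  have hTJ : ∀ c, T (D.J c) = (genHeight D c : ℂ) • D.J c := D.J.constr_basis ℂ _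
  have hT : ∀ y c, D.J.repr (T y) c = genHeight D c * D.J.repr y c := by
    intro y c
    have : D.J.coord c ∘ₗ T = (genHeight D c : ℂ) • D.J.coord c := by
      refine D.J.ext fun d => ?_
      rw [LinearMap.comp_apply, hTJ, map_smul, LinearMap.smul_apply, Module.Basis.coord_apply,
        Module.Basis.repr_self, Finsupp.single_apply]
      split_ifs with h
      · rw [h]
      · simp
    exact LinearMap.congr_fun this y
  have hder : ∀ y y', T ⁅y, y'⁆ = ⁅T y, y'⁆ + ⁅y, T y'⁆ := by
    intro y y'
    refine eq_of_forall_apply fun φ => ?_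
    rw [map_add, D.apply_lie_eq_sum φ (T y), D.apply_lie_eq_sum φ y (T y'),
      ← LinearMap.comp_apply φ T, D.apply_lie_eq_sum (φ ∘ₗ T), ← Finset.sum_add_distrib]
    refine Finset.sum_congr rfl fun c _ => ?_
    rw [← Finset.sum_add_distrib]
    refine Finset.sum_congr rfl fun d _ => ?_
    have h1 : T ⁅D.J c, D.J d⁆ = ((genHeight D c : ℂ) + genHeight D d) • ⁅D.J c, D.J d⁆ := by
      apply D.J.repr.injective
      ext e
      rw [hT, map_smul, Finsupp.smul_apply, smul_eq_mul]
      by_cases h : D.J.repr ⁅D.J c, D.J d⁆ e = 0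
      · rw [h, mul_zero, mul_zero]
      · have h2 : genHeight D e = genHeight D c + genHeight D d := by
          have h3 : D.deg e = D.deg c + D.deg d := D.graded _ _ _ h
          simp only [genHeight, h3, Pi.add_apply, Finset.sum_add_distrib]
        rw [h2]
        push_cast
        rfl
    rw [hT, hT, LinearMap.comp_apply, h1, map_smul, smul_eq_mul]
    ring
  obtain ⟨x, hx⟩ := hσ.exists_eq_ad T hder
  exact ⟨x, fun y c => by rw [← hx, hT]⟩

/-- The element commutes with itself, so it has no components of nonzero height. -/
lemma IsHeightElt.mem_zeroPart {x : L} (hx : IsHeightElt D x) : x ∈ D.zeroPart := by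
  intro c hc
  by_contra h
  have h1 := hx x c
  rw [lie_self, map_zero, Finsupp.zero_apply] at h1
  exact mul_ne_zero (Int.cast_ne_zero.2 (genHeight_ne_zero h)) hc h1.symm

lemma sigma_mem_zeroPart (hσ : D.IsCompactRealForm σ) {x : L} (hx : x ∈ D.zeroPart) :
    σ x ∈ D.zeroPart := by
  rw [← D.J.sum_repr x, map_sum]
  refine Submodule.sum_mem _ fun c _ => ?_
  rw [LinearMap.map_smulₛₗ]
  by_cases hc : D.J.repr x c = 0
  · rw [hc, map_zero, zero_smul]; exact Submodule.zero_mem _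
  refine Submodule.smul_mem _ _ ?_
  have hdeg := hx c hc
  rcases c with i | h | i
  · exact absurd hdeg (D.deg_raise_pos i).ne'
  · refine (Submodule.span_le.2 ?_ : _ ≤ D.zeroPart) (hσ.cartan h)
    rintro _ ⟨k, rfl⟩
    exact D.J_mem_gradedPart rfl
  · exact absurd hdeg (D.deg_lower_neg i).ne

lemma exists_lie_J_eq_smul {x : L} (hx : x ∈ D.zeroPart) (c : Gen I Θ) :
    ∃ r : ℂ, ⁅x, D.J c⁆ = r • D.J c := by
  rw [← D.J.sum_repr x, sum_lie]
  refine ⟨∑ d, D.J.repr x d * (Sum.elim (fun _ => 0) (Sum.elim (fun h =>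
    (Sum.elim (fun i => D.root i h) (Sum.elim (fun _ => 0) (fun i => -D.root i h)) c : ℂ))
      fun _ => 0) d : ℂ), ?_⟩
  rw [Finset.sum_smul]
  refine Finset.sum_congr rfl fun d _ => ?_
  rw [smul_lie, mul_smul]
  by_cases hd : D.J.repr x d = 0
  · rw [hd, zero_smul, zero_smul]
  congr 1
  have hdeg := hx d hd
  rcases d with i | h | i
  · exact absurd hdeg (D.deg_raise_pos i).ne'
  · rcases c with i | k | i
    · exact D.cartan_raise h i
    · simpa using D.cartan_comm h k
    · exact D.cartan_lower h i
  · exact absurd hdeg (D.deg_lower_neg i).ne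

/-- an eigenvector of the height element has a real eigenvalue, the height of its components -/
lemma IsHeightElt.eq_genHeight {x : L} (hx : IsHeightElt D x) {y : L} {r : ℂ}
    (hy : ⁅x, y⁆ = r • y) {c : Gen I Θ} (hc : D.J.repr y c ≠ 0) : r = genHeight D c := by
  have h := hx y c
  rw [hy, map_smul, Finsupp.smul_apply, smul_eq_mul] at h
  exact mul_right_cancel₀ hc h

lemma exists_repr_ne_zero {y : L} (hy : y ≠ 0) : ∃ c, D.J.repr y c ≠ 0 := by
  by_contra! h
  exact hy (D.J.repr.injective (by ext c; rw [h c, map_zero, Finsupp.zero_apply]))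

lemma sigma_injective (hσ : D.IsCompactRealForm σ) : Function.Injective σ :=
  (show Function.Involutive σ from hσ.invol).injective

/-- The element `σ x + x` is real and acts diagonally with real eigenvalues, so the Killing form on
it is a sum of squares. By negative definiteness it is zero. -/
lemma sigma_heightElt (hσ : D.IsCompactRealForm σ) {x : L} (hx : IsHeightElt D x) :
    σ x = -x := by
  rw [eq_neg_iff_add_eq_zero]
  by_contra hne
  set r := σ x + x with hr
  have hrσ : σ r = r := by rw [hr, map_add, hσ.invol, add_comm]
  have hr0 : r ∈ D.zeroPart := Submodule.add_mem _ (hσ.sigma_mem_zeroPart hx.mem_zeroPart)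
    hx.mem_zeroPart
  have hreal : ∀ c, ∃ t : ℝ, ⁅r, D.J c⁆ = (t : ℂ) • D.J c := by
    intro c
    obtain ⟨μ, hμ⟩ := exists_lie_J_eq_smul (hσ.sigma_mem_zeroPart hx.mem_zeroPart) c
    -- The eigenvalue of `σ x` on `J_c` is conjugate to an eigenvalue of `x`, on `σ J_c`; the latter
    -- is an integer.
    have h1 : ⁅x, σ (D.J c)⁆ = starRingEnd ℂ μ • σ (D.J c) := by
      rw [← LinearMap.map_smulₛₗ, ← hμ, hσ.lie, hσ.invol]
    obtain ⟨d, hd⟩ := exists_repr_ne_zero (D := D) (y := σ (D.J c)) fun h0 =>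
      D.J.ne_zero c (hσ.sigma_injective (h0.trans (map_zero σ).symm))
    have h2 := hx.eq_genHeight h1 hd
    have h3 : μ = ((genHeight D d : ℝ) : ℂ) := by
      rw [← Complex.conj_conj μ, h2]
      simp
    refine ⟨genHeight D d + genHeight D c, ?_⟩
    rw [hr, add_lie, hμ, h3, Complex.ofReal_add, add_smul]
    congr 1
    apply D.J.repr.injective
    ext e
    rw [hx, map_smul, Finsupp.smul_apply, smul_eq_mul, Module.Basis.repr_self,
      Finsupp.single_apply]
    split_ifs with h
    · rw [h]; simp
    · simp
  choose t ht using hreal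
  have htr : killingForm ℂ L r r = ∑ c, ((t c : ℂ)) ^ 2 := by
    rw [killingForm_apply_apply, LinearMap.trace_eq_matrix_trace ℂ D.J, Matrix.trace]
    refine Finset.sum_congr rfl fun c _ => ?_
    rw [Matrix.diag_apply, LinearMap.toMatrix_apply, LinearMap.comp_apply, LieAlgebra.ad_apply,
      LieAlgebra.ad_apply, ht, lie_smul, ht, smul_smul, map_smul, Module.Basis.repr_self]
    simp [sq]
  have h := hσ.negDef r hrσ hne
  rw [htr] at h
  have h' : (∑ c, ((t c : ℂ)) ^ 2) = ((∑ c, t c ^ 2 : ℝ) : ℂ) := by push_cast; rfl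
  rw [h', Complex.ofReal_re] at h
  exact absurd h (not_lt_of_ge (Finset.sum_nonneg fun c _ => sq_nonneg _))

/-- Conjugation negates the height element and leaves its integral eigenvalues unchanged, so it
reverses heights. -/
lemma sigma_mem_posPart (hσ : D.IsCompactRealForm σ) {y : L} (hy : y ∈ D.negPart) :
    σ y ∈ D.posPart := by
  obtain ⟨x, hx⟩ := hσ.exists_isHeightElt
  rw [← D.J.sum_repr y, map_sum]
  refine Submodule.sum_mem _ fun c _ => ?_
  rw [LinearMap.map_smulₛₗ]
  by_cases hc : D.J.repr y c = 0
  · rw [hc, map_zero, zero_smul]; exact Submodule.zero_mem _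
  refine Submodule.smul_mem _ _ fun d hd => ?_
  have hdeg := Set.mem_ofPred.1 (hy c hc)
  have h0 : ⁅x, D.J c⁆ = (genHeight D c : ℂ) • D.J c := by
    apply D.J.repr.injective
    ext e
    rw [hx, map_smul, Finsupp.smul_apply, smul_eq_mul, Module.Basis.repr_self,
      Finsupp.single_apply]
    split_ifs with h
    · rw [h]
    · simp
  have h1 : ⁅x, σ (D.J c)⁆ = (-(genHeight D c : ℂ)) • σ (D.J c) := by
    have h2 := congrArg σ h0
    rw [hσ.lie, hσ.sigma_heightElt hx, neg_lie, LinearMap.map_smulₛₗ, map_intCast] at h2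
    rw [neg_smul, ← h2, neg_neg]
  have h2 := hx.eq_genHeight h1 hd
  rw [Set.mem_ofPred, ← genHeight_pos_iff]
  have h3 : -genHeight D c = genHeight D d := by exact_mod_cast h2
  have h4 : ¬ 0 < genHeight D c := fun h => lt_asymm hdeg ((genHeight_pos_iff c).1 h)
  have h5 := genHeight_ne_zero (D := D) (c := c) hdeg.ne
  omega

/-- The real elements of the Borel subalgebra belong to the Cartan subalgebra. -/
lemma mem_zeroPart (hσ : D.IsCompactRealForm σ) {y : L} (hy : σ y = y)
    (hy' : y ∈ D.nonposPart) : y ∈ D.zeroPart := by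
  set p := D.projNeg y with hp
  set q := y - p with hq
  have hq0 : q ∈ D.zeroPart := D.sub_projNeg_mem hy'
  -- The negative part of `y = σ y`. It vanishes, since `σ` maps lowering elements to raising ones
  -- and preserves the Cartan subalgebra.
  have h1 : p = D.projNeg (σ p) + D.projNeg (σ q) := by
    rw [← map_add, ← map_add, hq, add_sub_cancel, hy]
  have h2 : D.projNeg (σ p) = 0 :=
    D.projDeg_eq_zero (A := {d | d < 0}) (B := {d | 0 < d})
      (fun _ ha ha' => lt_asymm (Set.mem_ofPred.1 ha) (Set.mem_ofPred.1 ha'))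
      (hσ.sigma_mem_posPart (D.projDeg_mem _ y))
  have h3 : D.projNeg (σ q) = 0 :=
    D.projDeg_eq_zero (A := {d | d < 0}) (B := {0})
      (fun a ha ha' => by
        rw [Set.mem_singleton_iff.1 ha] at ha'
        exact lt_irrefl _ (Set.mem_ofPred.1 ha'))
      (hσ.sigma_mem_zeroPart hq0)
  rw [h2, h3, add_zero] at h1
  have h4 : y = q := by rw [hq, h1, sub_zero]
  rw [h4]
  exact hq0

end IsCompactRealForm

end RootDecomposition

end CoadjointOrbit

end



/-! ### The smooth connection form on a chart of the compact orbit -/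

noncomputable section

namespace CoadjointOrbit

set_option linter.unusedSectionVars false

open Finset hiding antidiagonal mem_antidiagonal

open LieAlgebra (ad)

section Smooth

variable {E : Type*} [NormedAddCommGroup E] [NormedSpace ℝ E] {O : Set E}
  {n : Type*} [Fintype n] [DecidableEq n]

lemma contDiffOn_det {M : E → Matrix n n ℂ} (h : ∀ c d, ContDiffOn ℝ ∞ (fun z => M z c d) O) :
    ContDiffOn ℝ ∞ (fun z => (M z).det) O := by
  simp only [Matrix.det_apply']
  exact ContDiffOn.sum fun σ _ => contDiffOn_const.mul (contDiffOn_prod fun i _ => h _ _)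

lemma contDiffOn_inv {M : E → Matrix n n ℂ} (h : ∀ c d, ContDiffOn ℝ ∞ (fun z => M z c d) O)
    (hM : ∀ z ∈ O, IsUnit (M z)) (c d : n) : ContDiffOn ℝ ∞ (fun z => (M z)⁻¹ c d) O := by
  simp only [Matrix.inv_def, Matrix.smul_apply, Ring.inverse_eq_inv', smul_eq_mul,
    Matrix.adjugate_apply]
  refine ((contDiffOn_det h).inv fun z hz =>
    ((Matrix.isUnit_iff_isUnit_det _).1 (hM z hz)).ne_zero).mul (contDiffOn_det fun c' d' => ?_)
  by_cases hc : c' = d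
  · subst hc
    simp only [Matrix.updateRow_self]
    exact contDiffOn_const
  · simp only [Matrix.updateRow_ne hc]
    exact h _ _

lemma hasDerivAt_line {F : Type*} [NormedAddCommGroup F] [NormedSpace ℝ F] {g : E → F} (hO : IsOpen O)
    (hg : ContDiffOn ℝ ∞ g O) {z : E} (hz : z ∈ O) (U : E) :
    HasDerivAt (fun t : ℝ => g (z + t • U)) (fderiv ℝ g z U) 0 := by
  have h1 : DifferentiableAt ℝ g z :=
    (hg.differentiableOn (by simp)).differentiableAt (hO.mem_nhds hz)
  have h2 : HasDerivAt (fun t : ℝ => z + t • U) U 0 := by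
    have := ((hasDerivAt_id (0 : ℝ)).smul_const U).const_add z
    simpa using this
  have h3 : HasFDerivAt g (fderiv ℝ g z) (z + (0 : ℝ) • U) := by
    rw [zero_smul, add_zero]; exact h1.hasFDerivAt
  exact h3.comp_hasDerivAt (0 : ℝ) h2

lemma eventually_line_mem (hO : IsOpen O) {z : E} (hz : z ∈ O) (U : E) :
    ∀ᶠ t : ℝ in nhds 0, z + t • U ∈ O := by
  have h : Continuous fun t : ℝ => z + t • U := by fun_prop
  refine h.continuousAt.eventually_mem (hO.mem_nhds ?_)
  simpa using hz

end Smooth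

section Polynomials

variable {I : Type*} [Fintype I]

lemma hasDerivAt_eval_line (p : MvPolynomial I ℂ) (z U : I → ℂ) :
    HasDerivAt (fun t : ℝ => MvPolynomial.eval (z + t • U) p)
      (∑ i, U i * MvPolynomial.eval z (MvPolynomial.pderiv i p)) 0 := by
  classical
  induction p using MvPolynomial.induction_on with
  | C r =>
    simp only [MvPolynomial.eval_C, MvPolynomial.pderiv_C, map_zero, mul_zero,
      Finset.sum_const_zero]
    exact hasDerivAt_const _ _
  | add p q hp hq =>
    simp only [map_add, mul_add, Finset.sum_add_distrib]
    exact hp.add hq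
  | mul_X p j hp =>
    simp only [map_mul, MvPolynomial.eval_X]
    have h1 : HasDerivAt (fun t : ℝ => (z + t • U) j) (U j) 0 := by
      have := ((hasDerivAt_id (0 : ℝ)).smul_const (U j)).const_add (z j)
      simpa using this
    refine (hp.mul h1).congr_deriv ?_
    have h2 : ∀ i, U i * MvPolynomial.eval z (MvPolynomial.pderiv i (p * MvPolynomial.X j)) =
        U i * MvPolynomial.eval z (MvPolynomial.pderiv i p) * z j +
          if i = j then U j * MvPolynomial.eval z p else 0 := by
      intro i
      rw [Derivation.leibniz, MvPolynomial.pderiv_X, map_add, smul_eq_mul, smul_eq_mul, map_mul,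
        map_mul, MvPolynomial.eval_X]
      by_cases h : i = j
      · subst h; simp; ring
      · rw [if_neg h, Pi.single_eq_of_ne (Ne.symm h)]; simp; ring
    simp only [h2, Finset.sum_add_distrib, ← Finset.sum_mul, Finset.sum_ite_eq', Finset.mem_univ,
      if_true, zero_smul, add_zero]
    ring

end Polynomials

namespace RootDecomposition

universe u v w x

variable {L : Type u} [LieRing L] [LieAlgebra ℂ L] {Δ : Type v} [DecidableEq Δ]
  {I : Type w} {Θ : Type x} (D : RootDecomposition L Δ I Θ)

variable [Fintype I] [Fintype Θ] [DecidableEq I] [DecidableEq Θ] [Fintype Δ]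

lemma contDiff_apply_ad_pow (φ : L →ₗ[ℂ] ℂ) (x : L) (k : ℕ) :
    ContDiff ℝ ∞ fun z : I → ℂ => φ (((ad ℂ L (D.zElt z)) ^ k) x) := by
  induction k generalizing φ with
  | zero =>
    simp only [pow_zero, Module.End.one_apply]
    exact contDiff_const
  | succ k ih =>
    have h : ∀ z : I → ℂ, φ (((ad ℂ L (D.zElt z)) ^ (k + 1)) x) =
        ∑ i, z i * (φ ∘ₗ ad ℂ L (D.J (Gen.raise i))) (((ad ℂ L (D.zElt z)) ^ k) x) := by
      intro z
      rw [pow_succ', Module.End.mul_apply, LieAlgebra.ad_apply]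
      conv_lhs => rw [zElt]
      rw [sum_lie, map_sum]
      refine Finset.sum_congr rfl fun i _ => ?_
      rw [smul_lie, map_smul]
      rfl
    simp only [h]
    exact ContDiff.sum fun i _ => (contDiff_apply ℝ ℂ i).mul (ih _)

lemma contDiff_apply_adPoly (q : ℕ → ℂ) (φ : L →ₗ[ℂ] ℂ) (x : L) :
    ContDiff ℝ ∞ fun z : I → ℂ => φ (D.adPoly q z x) := by
  simp only [D.adPoly_apply q _ x le_rfl, map_sum, map_smul, smul_eq_mul]
  exact ContDiff.sum fun k _ => contDiff_const.mul (D.contDiff_apply_ad_pow φ x k)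

/-- the components of the connection form on a chart -/
def chartConn (b : L →ₗ[ℂ] ℂ) (s : (I → ℂ) → Matrix (Gen I Θ) (Gen I Θ) ℂ) (z : I → ℂ) (i : I) :
    ℂ :=
  -Complex.I * b (D.op (s z)⁻¹ (D.op (D.expZ z) (D.adPoly dexpNeg z (D.J (Gen.raise i)))))

/-- the connection form on a chart -/
def chartForm (b : L →ₗ[ℂ] ℂ) (s : (I → ℂ) → Matrix (Gen I Θ) (Gen I Θ) ℂ) (z : I → ℂ) :
    (I → ℂ) →L[ℂ] ℂ :=
  ∑ i, D.chartConn b s z i • ContinuousLinearMap.proj i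

lemma chartForm_apply (b : L →ₗ[ℂ] ℂ) (s : (I → ℂ) → Matrix (Gen I Θ) (Gen I Θ) ℂ)
    (z U : I → ℂ) : D.chartForm b s z U =
      -Complex.I * b (D.op (s z)⁻¹ (D.op (D.expZ z) (D.adPoly dexpNeg z (D.zElt U)))) := by
  rw [chartForm, _root_.sum_apply, zElt]
  simp only [map_sum, map_smul, Finset.mul_sum]
  refine Finset.sum_congr rfl fun i _ => ?_
  rw [_root_.smul_apply, ContinuousLinearMap.proj_apply, chartConn]
  simp only [smul_eq_mul]
  ring

lemma apply_op_eq_sum (φ : L →ₗ[ℂ] ℂ) (M : Matrix (Gen I Θ) (Gen I Θ) ℂ) (x : L) :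
    φ (D.op M x) = ∑ c, (∑ d, M c d * D.J.coord d x) * φ (D.J c) := by
  rw [D.apply_eq_sum φ]
  simp only [repr_op, smul_eq_mul]
  rfl

variable {D} in
lemma contDiffOn_apply_op {E : Type*} [NormedAddCommGroup E] [NormedSpace ℝ E] {O : Set E}
    {M : E → Matrix (Gen I Θ) (Gen I Θ) ℂ} {x : E → L} {φ : L →ₗ[ℂ] ℂ}
    (hM : ∀ c d, ContDiffOn ℝ ∞ (fun z => M z c d) O)
    (hx : ∀ d, ContDiffOn ℝ ∞ (fun z => D.J.coord d (x z)) O) :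
    ContDiffOn ℝ ∞ (fun z => φ (D.op (M z) (x z))) O := by
  have h : ∀ z, φ (D.op (M z) (x z)) = ∑ c, (∑ d, M z c d * D.J.coord d (x z)) * φ (D.J c) :=
    fun z => D.apply_op_eq_sum φ _ _
  refine ContDiffOn.congr (f := fun z => ∑ c, (∑ d, M z c d * D.J.coord d (x z)) * φ (D.J c)) ?_
    fun z _ => h z
  exact ContDiffOn.sum fun c _ =>
    (ContDiffOn.sum fun d _ => (hM c d).mul (hx d)).mul contDiffOn_const

lemma contDiff_coord_op_expZ (i : I) (d : Gen I Θ) : ContDiff ℝ ∞ fun z : I → ℂ =>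
    D.J.coord d (D.op (D.expZ z) (D.adPoly dexpNeg z (D.J (Gen.raise i)))) := by
  have h : ∀ z : I → ℂ,
      D.J.coord d (D.op (D.expZ z) (D.adPoly dexpNeg z (D.J (Gen.raise i)))) =
      ∑ c, D.J.coord c (D.adPoly dexpNeg z (D.J (Gen.raise i))) *
        D.J.coord d (D.adPoly expNeg (-z) (D.J c)) := fun z => by
    rw [op_expZ]
    exact D.apply_eq_sum (D.J.coord d ∘ₗ D.adPoly expNeg (-z)) _
  have h' : ∀ c, ContDiff ℝ ∞ fun z : I → ℂ => D.J.coord d (D.adPoly expNeg (-z) (D.J c)) :=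
    fun c => (D.contDiff_apply_adPoly expNeg (D.J.coord d) (D.J c)).comp contDiff_neg
  rw [funext h]
  exact ContDiff.sum fun c _ => (D.contDiff_apply_adPoly _ _ _).mul (h' c)

lemma coadjoint_eq (b : L →ₗ[ℂ] ℂ) (g : Matrix (Gen I Θ) (Gen I Θ) ℂ) (y : L) :
    D.coadjoint b g y = b (D.op g⁻¹ y) := by
  rw [coadjoint, D.apply_eq_sum b]
  refine Finset.sum_congr rfl fun c _ => ?_
  rw [repr_op, smul_eq_mul, mul_comm]
  rfl

namespace IsChart

variable {D} {σ : L →ₛₗ[starRingEnd ℂ] L} {O : Set (I → ℂ)}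
  {s : (I → ℂ) → Matrix (Gen I Θ) (Gen I Θ) ℂ}

lemma isUnit (hs : D.IsChart σ O s) {z : I → ℂ} (hz : z ∈ O) : IsUnit (s z) :=
  (D.isUnit_and_inv_mem_closure (P := fun y => σ y = y) (fun y hy => by rw [map_neg, hy])
    (hs.mem_group z hz)).1

lemma inv_mem (hs : D.IsChart σ O s) {z : I → ℂ} (hz : z ∈ O) : (s z)⁻¹ ∈ D.compactGroup σ :=
  (D.isUnit_and_inv_mem_closure (P := fun y => σ y = y) (fun y hy => by rw [map_neg, hy])
    (hs.mem_group z hz)).2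

lemma op_lie (hs : D.IsChart σ O s) {z : I → ℂ} (hz : z ∈ O) (x x' : L) :
    D.op (s z) ⁅x, x'⁆ = ⁅D.op (s z) x, D.op (s z) x'⁆ :=
  D.op_lie_of_mem_closure (P := fun y => σ y = y) (hs.mem_group z hz) x x'

lemma op_inv_lie (hs : D.IsChart σ O s) {z : I → ℂ} (hz : z ∈ O) (x x' : L) :
    D.op (s z)⁻¹ ⁅x, x'⁆ = ⁅D.op (s z)⁻¹ x, D.op (s z)⁻¹ x'⁆ :=
  D.op_lie_of_mem_closure (P := fun y => σ y = y) (hs.inv_mem hz) x x'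

lemma mem_borelGroup (hs : D.IsChart σ O s) {z : I → ℂ} (hz : z ∈ O) :
    (D.expZ z)⁻¹ * s z ∈ D.borelGroup := by
  obtain ⟨β, hβ, h⟩ := hs.mem_coset z hz
  rw [h, ← mul_assoc, Matrix.nonsing_inv_mul _
    ((Matrix.isUnit_iff_isUnit_det _).1 (D.isUnit_expZ z)), one_mul]
  exact hβ

lemma inv_mem_borelGroup (hs : D.IsChart σ O s) {z : I → ℂ} (hz : z ∈ O) :
    (s z)⁻¹ * D.expZ z ∈ D.borelGroup := by
  have h := (D.isUnit_and_inv_mem_closure (P := fun y => y ∈ D.borel)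
    (fun y hy => D.borel.neg_mem hy) (hs.mem_borelGroup hz)).2
  rwa [Matrix.mul_inv_rev, Matrix.nonsing_inv_nonsing_inv _
    ((Matrix.isUnit_iff_isUnit_det _).1 (D.isUnit_expZ z))] at h

lemma contDiffOn_chartConn (hs : D.IsChart σ O s) (b : L →ₗ[ℂ] ℂ) (i : I) :
    ContDiffOn ℝ ∞ (fun z => D.chartConn b s z i) O := by
  have h1 := contDiffOn_inv hs.smooth fun z hz => hs.isUnit hz
  have h2 : ∀ d, ContDiffOn ℝ ∞ (fun z : I → ℂ =>
      D.J.coord d (D.op (D.expZ z) (D.adPoly dexpNeg z (D.J (Gen.raise i))))) O :=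
    fun d => (D.contDiff_coord_op_expZ i d).contDiffOn
  have h3 := contDiffOn_apply_op (D := D) (φ := b) h1 h2
  exact contDiffOn_const.mul h3

lemma contDiffOn_chartForm (hs : D.IsChart σ O s) (b : L →ₗ[ℂ] ℂ) :
    ContDiffOn ℝ ∞ (D.chartForm b s) O := by
  have h : ∀ i : I, ContDiffOn ℝ ∞ (fun z => D.chartConn b s z i •
      (ContinuousLinearMap.proj i : (I → ℂ) →L[ℂ] ℂ)) O := fun i =>
    (hs.contDiffOn_chartConn b i).smul contDiffOn_const
  exact ContDiffOn.sum fun i _ => h i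

/-- the connection form on the vector fields of the action -/
lemma chartForm_actionVec (hs : D.IsChart σ O s) {b : L →ₗ[ℂ] ℂ} (hb : D.IsCartanFunctional b)
    {z : I → ℂ} (hz : z ∈ O) (y : L) :
    D.chartForm b s z (D.actionVec y z) = -Complex.I * b (D.op (s z)⁻¹ y) -
      MvPolynomial.eval z (D.famLin (D.orbitFun b) y) := by
  set E := D.adPoly expNeg z y with hE
  have hN : b (D.projPos E) = 0 :=
    hb.apply_eq_zero (A := {d | 0 < d}) (fun h => lt_irrefl _ (Set.mem_ofPred.1 h))
      (D.projDeg_mem _ E)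
  have hy : D.op (D.expZ z) E = y := by
    rw [hE, ← op_expZ_inv, D.op_op_inv (D.isUnit_expZ z)]
  -- The element `s(z)⁻¹ e^Z` lies in `B⁻`, so `b` is unchanged on the Borel part; this is the
  -- counterpart of `bSer_eq`.
  have hw : b (D.op (s z)⁻¹ (D.op (D.expZ z) (E - D.projPos E))) = b E := by
    rw [← op_mul_apply, hb.apply_op (hs.inv_mem_borelGroup hz) (D.sub_projPos_mem E), map_sub, hN,
      sub_zero]
  rw [map_sub, map_sub, map_sub, hy] at hw
  rw [chartForm_apply, adPoly_dexpNeg_actionVec, ← hE, eval_famLin_orbitFun, ← hE, ← hw]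
  ring

end IsChart

end RootDecomposition

end CoadjointOrbit

end



/-! ### Motion of the section along the action, and the curvature on a chart -/

noncomputable section

namespace CoadjointOrbit

set_option linter.unusedSectionVars false

open Finset hiding antidiagonal mem_antidiagonal

open LieAlgebra (ad)

namespace HasWeakDeriv

variable {V : Type*} [AddCommGroup V] [Module ℂ V] {F : ℝ → V} {F' : V}

lemma map_conj (hF : HasWeakDeriv F F') (σ : V →ₛₗ[starRingEnd ℂ] V) :
    HasWeakDeriv (fun t => σ (F t)) (σ F') := fun φ => by
  let ψ : V →ₗ[ℂ] ℂ :=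
    { toFun := fun v => starRingEnd ℂ (φ (σ v))
      map_add' := fun v v' => by simp only [map_add]
      map_smul' := fun r v => by
        simp only [LinearMap.map_smulₛₗ, map_smul, smul_eq_mul, map_mul, Complex.conj_conj,
          RingHom.id_apply] }
  have h := (hF ψ).star
  have e : ∀ v, star (ψ v) = φ (σ v) := fun v => Complex.conj_conj _
  simpa only [e] using h

end HasWeakDeriv

lemma hasDerivAt_clm_apply {E : Type*} [NormedAddCommGroup E] [NormedSpace ℂ E]
    {c : ℝ → E →L[ℂ] ℂ} {c' : E →L[ℂ] ℂ} {u : ℝ → E} {u' : E} (hc : HasDerivAt c c' 0)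
    (hu : HasDerivAt u u' 0) :
    HasDerivAt (fun t => c t (u t)) (c' (u 0) + c 0 u') 0 := by
  have h : HasDerivAt (fun t => (c t).restrictScalars ℝ) (c'.restrictScalars ℝ) 0 :=
    (ContinuousLinearMap.restrictScalarsL ℂ E ℂ ℝ ℝ).hasFDerivAt.comp_hasDerivAt (0 : ℝ) hc
  exact h.clm_apply hu

namespace RootDecomposition

universe u v w x

variable {L : Type u} [LieRing L] [LieAlgebra ℂ L] {Δ : Type v} [DecidableEq Δ]
  {I : Type w} {Θ : Type x} {D : RootDecomposition L Δ I Θ}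

variable [Fintype Δ] [Fintype I] [Fintype Θ] [DecidableEq I] [DecidableEq Θ]
  {σ : L →ₛₗ[starRingEnd ℂ] L} {O : Set (I → ℂ)}
  {s : (I → ℂ) → Matrix (Gen I Θ) (Gen I Θ) ℂ} {b : L →ₗ[ℂ] ℂ}

namespace IsChart

/-- the logarithmic derivative of the section along a line is a real element -/
lemma exists_hasWeakDeriv (hs : D.IsChart σ O s) (hσ : D.IsCompactRealForm σ) {z : I → ℂ}
    (hz : z ∈ O) (U : I → ℂ) : ∃ x, σ x = x ∧
      (∀ v, HasWeakDeriv (fun t : ℝ => D.op (s (z + t • U)) v) (D.op (s z) ⁅x, v⁆)) ∧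
      ∀ v, HasWeakDeriv (fun t : ℝ => D.op (s (z + t • U))⁻¹ v) (-⁅x, D.op (s z)⁻¹ v⁆) := by
  have hline := eventually_line_mem hs.isOpen hz U
  have hz0 : z + (0 : ℝ) • U = z := by rw [zero_smul, add_zero]
  set S' : Matrix (Gen I Θ) (Gen I Θ) ℂ := Matrix.of fun c d => fderiv ℝ (fun z => s z c d) z U
    with hS'
  set R' : Matrix (Gen I Θ) (Gen I Θ) ℂ := Matrix.of fun c d =>
    fderiv ℝ (fun z => (s z)⁻¹ c d) z U with hR'
  have hS : ∀ v, HasWeakDeriv (fun t : ℝ => D.op (s (z + t • U)) v) (D.op S' v) :=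
    D.hasWeakDeriv_of_hasDerivAt fun c d => hasDerivAt_line hs.isOpen (hs.smooth c d) hz U
  have hR : ∀ v, HasWeakDeriv (fun t : ℝ => D.op (s (z + t • U))⁻¹ v) (D.op R' v) :=
    D.hasWeakDeriv_of_hasDerivAt fun c d => hasDerivAt_line hs.isOpen
      (contDiffOn_inv hs.smooth (fun z hz => hs.isUnit hz) c d) hz U
  -- Differentiating the automorphism property of `s` shows that `s⁻¹ s'` is a derivation, hence of
  -- the form `ad x`.
  have hder : ∀ v v', D.op S' ⁅v, v'⁆ = ⁅D.op S' v, D.op (s z) v'⁆ + ⁅D.op (s z) v, D.op S' v'⁆ := by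
    intro v v'
    have h1 := HasWeakDeriv.lie D.J (hS v) (hS v')
    rw [hz0] at h1
    exact (hS ⁅v, v'⁆).unique h1 (hline.mono fun t ht => hs.op_lie ht v v')
  obtain ⟨x, hx⟩ := hσ.exists_eq_ad (D.op (s z)⁻¹ ∘ₗ D.op S') fun v v' => by
    simp only [LinearMap.comp_apply]
    rw [hder, map_add, hs.op_inv_lie hz, hs.op_inv_lie hz, D.op_inv_op (hs.isUnit hz),
      D.op_inv_op (hs.isUnit hz)]
  have hx' : ∀ v, D.op S' v = D.op (s z) ⁅x, v⁆ := fun v => by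
    rw [← hx, LinearMap.comp_apply, D.op_op_inv (hs.isUnit hz)]
  refine ⟨x, ?_, fun v => (hS v).congr_deriv (hx' v), fun v => (hR v).congr_deriv ?_⟩
  -- `s` commutes with the conjugation, so its derivative does too; as `ad` is injective, `x` is
  -- real.
  · refine hσ.eq_of_lie_eq fun v => ?_
    have h1 : D.op S' v = σ (D.op S' (σ v)) :=
      (hS v).unique ((hS (σ v)).map_conj σ) (hline.mono fun t ht => by
        rw [D.sigma_op hσ.lie (hs.mem_group _ ht), hσ.invol])
    rw [hx', hx', D.sigma_op hσ.lie (hs.mem_group _ hz), hσ.lie, hσ.invol] at h1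
    have h2 := congrArg (D.op (s z)⁻¹) h1
    rw [D.op_inv_op (hs.isUnit hz), D.op_inv_op (hs.isUnit hz)] at h2
    exact h2.symm
  -- The derivative of the inverse follows from differentiating `s⁻¹ s = 1`.
  · have h1 := HasWeakDeriv.apply D.J hR (hS (D.op (s z)⁻¹ v))
    rw [hz0] at h1
    have h2 := h1.unique (HasWeakDeriv.const (D.op (s z)⁻¹ v)) (hline.mono fun t ht =>
      D.op_inv_op (hs.isUnit ht) _)
    rw [hx', D.op_inv_op (hs.isUnit hz), D.op_op_inv (hs.isUnit hz)] at h2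
    exact eq_neg_of_add_eq_zero_left h2

/-- along the vector field of the action of a real element `y`, the section is displaced
by `y`, up to an element of the Cartan subalgebra -/
lemma op_inv_sub_mem_zeroPart (hs : D.IsChart σ O s) (hσ : D.IsCompactRealForm σ) {z : I → ℂ}
    (hz : z ∈ O) {y x : L} (hy : σ y = y) (hx : σ x = x)
    (h : ∀ v, HasWeakDeriv (fun t : ℝ => D.op (s (z + t • D.actionVec y z)) v)
      (D.op (s z) ⁅x, v⁆)) : D.op (s z)⁻¹ y - x ∈ D.zeroPart := by
  set U := D.actionVec y z with hU
  have hline := eventually_line_mem hs.isOpen hz U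
  have hz0 : z + (0 : ℝ) • U = z := by rw [zero_smul, add_zero]
  set E := D.adPoly expNeg z y with hE
  set N := D.projPos E with hN
  have hinv : ∀ v, D.op (s z)⁻¹ (D.op (D.expZ z) (D.adPoly expNeg z (D.op (s z) v))) = v :=
    fun v => by
      rw [← op_expZ_inv, D.op_op_inv (D.isUnit_expZ z), D.op_inv_op (hs.isUnit hz)]
  -- `κ` is the logarithmic derivative of the factor `e^{-Z} s ∈ B⁻`. Only membership of this factor
  -- in the group is given, so that `κ` belongs to the Borel subalgebra has to be derived.
  set κ := x - D.op (s z)⁻¹ (D.op (D.expZ z) N) with hκ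
  -- The elements of `B⁻` preserve the Borel subalgebra, and so does the derivative of a curve in
  -- `B⁻`: `κ` normalizes the Borel subalgebra.
  have h1 : ∀ v ∈ D.nonposPart, ⁅κ, v⁆ ∈ D.nonposPart := by
    intro v hv
    have h2 : HasWeakDeriv (fun t : ℝ => D.adPoly expNeg (z + t • U) (D.op (s (z + t • U)) v))
        (-⁅N, D.adPoly expNeg z (D.op (s z) v)⁆ + D.adPoly expNeg z (D.op (s z) ⁅x, v⁆)) := by
      have h3 := HasWeakDeriv.apply D.J (T := fun t : ℝ => D.adPoly expNeg (z + t • U))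
        (T' := -(ad ℂ L N ∘ₗ D.adPoly expNeg z)) (fun v => by
          have h4 := D.hasWeakDeriv_adPoly_expNeg z U v
          rw [hU, adPoly_dexpNeg_actionVec] at h4
          exact h4) (h v)
      rw [hz0] at h3
      exact h3
    have h5 : -⁅N, D.adPoly expNeg z (D.op (s z) v)⁆ + D.adPoly expNeg z (D.op (s z) ⁅x, v⁆) ∈
        D.nonposPart := by
      rw [mem_nonposPart_iff]
      intro i
      refine (h2 (D.J.coord (Gen.raise i))).unique
        ((hasDerivAt_const (0 : ℝ) (0 : ℂ)).congr_of_eventuallyEq (hline.mono fun t ht => ?_))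
      have h6 := D.op_mem_nonposPart (hs.mem_borelGroup ht) hv
      rw [op_mul_apply, op_expZ_inv] at h6
      exact (D.mem_nonposPart_iff.1 h6) i
    have h7 := D.op_mem_nonposPart (hs.inv_mem_borelGroup hz) h5
    rw [op_mul_apply, map_add, map_add, hinv, map_neg, map_neg, op_expZ_lie, hs.op_inv_lie hz, hinv]
      at h7
    rw [hκ, sub_lie]
    convert h7 using 1
    abel
  -- The Borel subalgebra is its own normalizer: the bracket with the height element multiplies each
  -- raising component of `κ` by a nonzero number.
  have h2 : κ ∈ D.nonposPart := by
    obtain ⟨h, hh⟩ := hσ.exists_isHeightElt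
    rw [mem_nonposPart_iff]
    intro i
    have h3 : h ∈ D.nonposPart :=
      D.gradedPart_mono (fun d hd => Set.mem_ofPred.2 (le_of_eq hd)) hh.mem_zeroPart
    have h4 := D.mem_nonposPart_iff.1 (h1 h h3) i
    rw [← lie_skew, map_neg, Finsupp.neg_apply, neg_eq_zero, hh] at h4
    exact (mul_eq_zero.1 h4).resolve_left
      (Int.cast_ne_zero.2 (IsCompactRealForm.genHeight_ne_zero (D.deg_raise_pos i).ne'))
  refine hσ.mem_zeroPart ?_ ?_
  · rw [map_sub, D.sigma_op hσ.lie (hs.inv_mem hz), hy, hx]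
  -- The difference is the Borel part of `e^{-ad Z} y`, transported by an element of `B⁻`, minus
  -- `κ`; being also real, it belongs to the Cartan subalgebra.
  · have h3 : D.op (s z)⁻¹ y - x = D.op (s z)⁻¹ (D.op (D.expZ z) (E - N)) - κ := by
      rw [map_sub, map_sub, hκ, hE, ← op_expZ_inv, D.op_op_inv (D.isUnit_expZ z)]
      abel
    rw [h3, ← op_mul_apply]
    exact D.nonposPart.sub_mem
      (D.op_mem_nonposPart (hs.inv_mem_borelGroup hz) (D.sub_projPos_mem E)) h2

/-- the derivative of the moment map along the vector fields of the action -/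
lemma hasDerivAt_moment (hs : D.IsChart σ O s) (hσ : D.IsCompactRealForm σ)
    (hb : D.IsCartanFunctional b) {z : I → ℂ} (hz : z ∈ O) {y : L} (hy : σ y = y) (y' : L) :
    HasDerivAt (fun t : ℝ => b (D.op (s (z + t • D.actionVec y z))⁻¹ y'))
      (-b (D.op (s z)⁻¹ ⁅y, y'⁆)) 0 := by
  obtain ⟨x, hx, h, h'⟩ := hs.exists_hasWeakDeriv hσ hz (D.actionVec y z)
  refine (h' y' b).congr_deriv ?_
  have h1 := hb.apply_lie_zeroPart (hs.op_inv_sub_mem_zeroPart hσ hz hy hx h) (D.op (s z)⁻¹ y')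
  rw [sub_lie, map_sub, sub_eq_zero] at h1
  rw [map_neg, ← h1, hs.op_inv_lie hz]

end IsChart

variable (D) in
lemma hasDerivAt_eval_actionVec (y : L) (z : I → ℂ) (p : MvPolynomial I ℂ) :
    HasDerivAt (fun t : ℝ => MvPolynomial.eval (z + t • D.actionVec y z) p)
      (-MvPolynomial.eval z (D.xiLin y p)) 0 := by
  refine (hasDerivAt_eval_line p z _).congr_deriv ?_
  rw [derivation_eq_sum_vars (D.xiLin y) p, map_sum, ← Finset.sum_neg_distrib]
  rw [Finset.sum_subset (Finset.subset_univ p.vars) fun i _ hi => by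
    rw [MvPolynomial.pderiv_eq_zero_of_notMem_vars hi, mul_zero, map_zero, neg_zero]]
  refine Finset.sum_congr rfl fun i _ => ?_
  rw [actionVec_eq_neg_eval, map_mul, neg_mul]

variable (D) in
lemma hasDerivAt_actionVec (y y' : L) (z : I → ℂ) :
    HasDerivAt (fun t : ℝ => D.actionVec y' (z + t • D.actionVec y z))
      (fun i => MvPolynomial.eval z (D.xiLin y (D.xiLin y' (MvPolynomial.X i)))) 0 := by
  rw [hasDerivAt_pi]
  intro i
  simp only [actionVec_eq_neg_eval D y']
  exact ((D.hasDerivAt_eval_actionVec y z _).neg).congr_deriv (neg_neg _)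

/-- The product rule applied to the identity `chartForm_actionVec` along the action of `y`, with the
equivariance of the moment map on the right-hand side. -/
lemma IsChart.fderiv_chartForm (hs : D.IsChart σ O s) (hσ : D.IsCompactRealForm σ)
    (hb : D.IsCartanFunctional b) {z : I → ℂ} (hz : z ∈ O) {y : L} (hy : σ y = y) (y' : L) :
    fderiv ℝ (D.chartForm b s) z (D.actionVec y z) (D.actionVec y' z) +
        D.chartForm b s z
          (fun i => MvPolynomial.eval z (D.xiLin y (D.xiLin y' (MvPolynomial.X i)))) =
      Complex.I * b (D.op (s z)⁻¹ ⁅y, y'⁆) +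
        MvPolynomial.eval z (D.xiLin y (D.famLin (D.orbitFun b) y')) := by
  set U := D.actionVec y z with hU
  have hline := eventually_line_mem hs.isOpen hz U
  have hz0 : z + (0 : ℝ) • U = z := by rw [zero_smul, add_zero]
  have h1 := hasDerivAt_clm_apply
    (hasDerivAt_line hs.isOpen (hs.contDiffOn_chartForm b) hz U) (D.hasDerivAt_actionVec y y' z)
  rw [← hU, hz0] at h1
  have h2 := ((hs.hasDerivAt_moment hσ hb hz hy y').const_mul (-Complex.I)).sub
    (D.hasDerivAt_eval_actionVec y z (D.famLin (D.orbitFun b) y'))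
  refine (h1.unique (h2.congr_of_eventuallyEq (hline.mono fun t ht => ?_))).trans ?_
  · exact hs.chartForm_actionVec hb ht y'
  · ring

/-- The coadjoint orbit representation of a compact group, on a holomorphic chart of the orbit. -/
lemma IsCartanFunctional.isOrbitGauge_orbitFun (hb : D.IsCartanFunctional b)
    (hσ : D.IsCompactRealForm σ) (hs : D.IsChart σ O s) :
    D.IsOrbitGauge σ b O s (D.orbitFun b) := by
  refine ⟨D.actionVec, fun y _ z _ => D.isActionVector_actionVec y z, D.chartForm b s,
    hs.contDiffOn_chartForm b, fun y y' hy hy' z hz => ?_, fun y hy ψ hψ z hz => ?_⟩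
  · have h1 := hs.fderiv_chartForm hσ hb hz hy y'
    have h2 := hs.fderiv_chartForm hσ hb hz hy' y
    -- The second derivatives of the coordinates differ by the field of the bracket; this produces
    -- the term `A_{[y,y']}` of the curvature.
    have h3 : (fun i => MvPolynomial.eval z (D.xiLin y (D.xiLin y' (MvPolynomial.X i)))) =
        (fun i => MvPolynomial.eval z (D.xiLin y' (D.xiLin y (MvPolynomial.X i)))) -
          D.actionVec ⁅y, y'⁆ z := by
      funext i
      rw [Pi.sub_apply, actionVec_eq_neg_eval, xiLin_lie, Derivation.commutator_apply, map_sub]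
      ring
    have h4 := congrArg (MvPolynomial.eval z) (hb.famLin_orbitFun_lie y y')
    rw [map_sub] at h4
    rw [h3, map_sub, hs.chartForm_actionVec hb hz] at h1
    rw [← lie_skew, map_neg, map_neg] at h2
    rw [coadjoint_eq]
    -- The moment of `⁅y, y'⁆` enters twice from the derivatives and once, with the opposite sign,
    -- from `A_{[y,y']}`; the polynomial terms cancel by the cocycle identity.
    linear_combination h1 - h2 - h4
  · have h1 : fderiv ℝ ψ z = (fderiv ℂ ψ z).restrictScalars ℝ :=
      (hψ.differentiableAt (hs.isOpen.mem_nhds hz)).fderiv_restrictScalars ℝ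
    have h2 : (fun i => MvPolynomial.eval z (D.xiLin y (MvPolynomial.X i))) =
        -D.actionVec y z := by
      funext i
      rw [Pi.neg_apply, actionVec_eq_neg_eval, neg_neg]
    rw [holOp, h1, h2, hs.chartForm_actionVec hb hz, coadjoint_eq, map_neg,
      ContinuousLinearMap.coe_restrictScalars']
    ring

end RootDecomposition

end CoadjointOrbit

end

/-! ### The main theorem -/

theorem proposition6 {L : Type*} [LieRing L] [LieAlgebra ℂ L] {Δ : Type*} [Fintype Δ]
    [DecidableEq Δ] {I Θ : Type*} [Finite Θ]
    (D : CoadjointOrbit.RootDecomposition L Δ I Θ) :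
    (∀ b : L →ₗ[ℂ] ℂ, D.IsCartanFunctional b →
      ∃ f : CoadjointOrbit.Gen I Θ → MvPolynomial I ℂ,
        -- the recursive formulae define a unique family `f`
        D.IsRecursiveFamily b f ∧ (∀ f', D.IsRecursiveFamily b f' → f' = f) ∧
        -- the operators `ξ_a + f_a` form a representation
        (∃ ρ : L →ₗ[ℂ] Module.End ℂ (MvPolynomial I ℂ), (∀ a, ρ (D.J a) = D.Jhat f a) ∧
          ∀ y y', ρ ⁅y, y'⁆ = ρ y * ρ y' - ρ y' * ρ y) ∧
        -- it is the coadjoint orbit representation in the particular gauge `f_a ∈ R_{-a}`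
        D.IsHomogeneousFamily f ∧ D.IsFormalOrbitGauge b f ∧
        (∀ f', D.IsHomogeneousFamily f' → D.IsFormalOrbitGauge b f' → f' = f) ∧
        -- for a compact group, this holds on every holomorphic chart of the orbit
        (∀ [Fintype I] [Fintype Θ] [DecidableEq I] [DecidableEq Θ]
          (σ : L →ₛₗ[starRingEnd ℂ] L), D.IsCompactRealForm σ →
          (∀ y, σ y = y → (b y).im = 0) →
          ∀ (O : Set (I → ℂ))
            (s : (I → ℂ) → Matrix (CoadjointOrbit.Gen I Θ) (CoadjointOrbit.Gen I Θ) ℂ),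
            D.IsChart σ O s → D.IsOrbitGauge σ b O s f)) ∧
    -- the raising operators do not depend on the highest weight
    (∀ (b b' : L →ₗ[ℂ] ℂ) (f f' : CoadjointOrbit.Gen I Θ → MvPolynomial I ℂ),
      D.IsRecursiveFamily b f → D.IsRecursiveFamily b' f' →
      ∀ i, D.Jhat f (CoadjointOrbit.Gen.raise i) = D.Jhat f' (CoadjointOrbit.Gen.raise i)) := by
  refine ⟨fun b hb => ⟨D.orbitFun b, hb.isRecursiveFamily_orbitFun,
    fun f' hf' => hf'.unique hb.isRecursiveFamily_orbitFun,
    ⟨D.operators _, D.operators_J _, D.operators_lie hb.famLin_orbitFun_lie⟩,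
    hb.isHomogeneousFamily_orbitFun, hb.isFormalOrbitGauge_orbitFun,
    fun f' hf' hg => hb.eq_orbitFun hf' hg,
    fun σ hσ _ O s hs => hb.isOrbitGauge_orbitFun hσ hs⟩, ?_⟩
  intro b b' f f' hf hf' i
  rw [CoadjointOrbit.RootDecomposition.Jhat, CoadjointOrbit.RootDecomposition.Jhat, hf.raise,
    hf'.raise]
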